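/- **Theorem.** Every symmetric Boolean function computable in $\mathsf{AC}^0$ is exactly computable in $\mathsf{QAC}^0$, i.e. $\mathsf{SymAC}^0\subseteq\mathsf{EQAC}^0$. Explicitly: Let $f=(f_n)_{n\ge 0}$ with $f_n\colon\{0,1\}^n\to\{0,1\}$ be a family of symmetric functions ($f_n(x)$ depends only on the Hamming weight of $x$). Suppose there are a constant $d$ and a polynomial $p$ such that for every $n$ the function $f_n$ is computed by a Boolean circuit with gates $\neg$, $\mathsf{AND}$, $\mathsf{OR}$ (unbounded fan-in and fan-out), of depth at most $d$ and with at most $p(n)$ gates. Then there are a constant $d'$ and a polynomial $p'$ such that for every $n$ there are a number $a$ of ancillas and a $\mathsf{QAC}$ circuit $C$ on $n+a+1$ qubits, of depth at most $d'$ and size at most $p'(n)$, that decides $f_n$ with zero error: for every $x\in\{0,1\}^n$, measuring the last qubit of $C\,|x\rangle|0^a\rangle|0\rangle$ in the computational basis gives $f_n(x)$ with probability $1$. Here a $\mathsf{QAC}$ circuit of depth $d$ is a product $C=M_d\cdots M_1$ of layers, where each layer is a product of gates acting on disjoint sets of qubits, and each gate is either an arbitrary single-qubit unitary or a generalized Toffoli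 gate $|x_1,\dots,x_m\rangle|b\rangle\mapsto|x_1,\dots,x_m\rangle|b\oplus\mathsf{AND}(x_1,\dots,x_m)\rangle$ with $m\ge1$; its size is the number of gates plus the number of qubits. Both classes are taken in the non-uniform sense. -/

import Mathlib

/-! ### Boolean functions -/

/-- A language over `{0,1}`, given by its slices `f n : {0,1}ⁿ → {0,1}`. -/
abbrev BoolFamily : Type := (n : ℕ) → (Fin n → Bool) → Bool

/-- The Hamming weight `|x|`. -/
def hammingWeight {n : ℕ} (x : Fin n → Bool) : ℕ :=
  (Finset.univ.filter fun i => x i = true).card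

/-- `f` is symmetric: `f x` depends only on `|x|`. -/
def IsSymmetric {n : ℕ} (f : (Fin n → Bool) → Bool) : Prop :=
  ∀ x y : Fin n → Bool, hammingWeight x = hammingWeight y → f x = f y

/-! ### Classical circuits with gates NOT, AND, OR of unbounded fan-in and fan-out -/

/-- A gate whose input wires are taken from `W`. -/
inductive ACGate (W : Type) : Type
  | not (w : W) : ACGate W
  | and (S : Finset W) : ACGate W
  | or (S : Finset W) : ACGate W

/-- The Boolean value of a gate when its wires carry the values `v`. -/
def ACGate.eval {W : Type} (v : W → Bool) : ACGate W → Bool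
  | .not w => !(v w)
  | .and S => decide (∀ w ∈ S, v w = true)
  | .or S => decide (∃ w ∈ S, v w = true)

/-- The input wires of a gate. -/
def ACGate.inputs {W : Type} : ACGate W → Finset W
  | .not w => {w}
  | .and S => S
  | .or S => S

/-- A Boolean circuit on `n` input bits: a directed acyclic graph of `size` gates, listed in a
topological order, so that the input wires of gate `i` are input bits or gates before `i`. -/
structure ACCircuit (n : ℕ) : Type where
  /-- the number of gates -/
  size : ℕ
  /-- the gates -/
  gate : (i : Fin size) → ACGate (Fin n ⊕ Fin (i : ℕ))
  /-- the output wire -/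
  output : Fin n ⊕ Fin size

/-- The value of gate `i` on input `x`. -/
def ACCircuit.gateVal {n : ℕ} (C : ACCircuit n) (x : Fin n → Bool) (i : Fin C.size) : Bool :=
  (C.gate i).eval (Sum.elim x fun j : Fin (i : ℕ) => C.gateVal x ⟨j, j.isLt.trans i.isLt⟩)
termination_by (i : ℕ)

/-- The output bit on input `x`. -/
def ACCircuit.eval {n : ℕ} (C : ACCircuit n) (x : Fin n → Bool) : Bool :=
  Sum.elim x (C.gateVal x) C.output

/-- The maximal number of gates on a path that ends with gate `i`. -/
def ACCircuit.gateDepth {n : ℕ} (C : ACCircuit n) (i : Fin C.size) : ℕ :=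
  (C.gate i).inputs.sup
    (Sum.elim (fun _ => 0) fun j : Fin (i : ℕ) => C.gateDepth ⟨j, j.isLt.trans i.isLt⟩) + 1
termination_by (i : ℕ)

/-- The depth: the maximal length of a path to the output. -/
def ACCircuit.depth {n : ℕ} (C : ACCircuit n) : ℕ :=
  Sum.elim (fun _ => 0) C.gateDepth C.output

/-- `AC⁰`: constant-depth polynomial-size circuits (non-uniform). -/
def AC0 : Set BoolFamily :=
  {f | ∃ (d : ℕ) (p : Polynomial ℕ), ∀ n : ℕ, ∃ C : ACCircuit n,
    C.depth ≤ d ∧ C.size ≤ p.eval n ∧ ∀ x, C.eval x = f n x}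

/-- The symmetric functions in `AC⁰`. -/
def SymAC0 : Set BoolFamily :=
  {f | f ∈ AC0 ∧ ∀ n, IsSymmetric (f n)}

/-! ### QAC circuits

For a finite set `Q` of qubits, the computational basis states are the maps `Q → Bool`, and an
operator is a matrix in this basis: the entry `M y x` is `⟨y| M |x⟩`. -/

/-- The gates of a QAC circuit: an arbitrary single-qubit unitary, or the generalized Toffoli gate
`|x⟩|b⟩ ↦ |x⟩|b ⊕ AND(x)⟩` with at least one control. -/
inductive QACGate (Q : Type) : Type
  | single (q : Q) (U : Matrix.unitaryGroup Bool ℂ) : QACGate Q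
  | toffoli (S : Finset Q) (hS : S.Nonempty) (t : Q) (ht : t ∉ S) : QACGate Q

/-- The qubits on which a gate acts. -/
def QACGate.support {Q : Type} [DecidableEq Q] : QACGate Q → Finset Q
  | .single q _ => {q}
  | .toffoli S _ t _ => insert t S

/-- The operator of a gate: it acts as the identity on the qubits outside its support. -/
noncomputable def QACGate.toMatrix {Q : Type} [Fintype Q] [DecidableEq Q] :
    QACGate Q → Matrix (Q → Bool) (Q → Bool) ℂ
  | .single q U => Matrix.of fun y x =>
      if ∀ r, r ≠ q → y r = x r then (U : Matrix Bool Bool ℂ) (y q) (x q) else 0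
  | .toffoli S _ t _ => Matrix.of fun y x =>
      if y = Function.update x t (xor (x t) (decide (∀ s ∈ S, x s = true))) then 1 else 0

/-- A QAC circuit on the qubits `Q`: layers `M₁, …, M_d`, applied in this order, each of which is a
product of gates that act on disjoint sets of qubits. -/
structure QACCircuit (Q : Type) [DecidableEq Q] : Type where
  /-- the layers, the first one to be applied at the head -/
  layers : List (List (QACGate Q))
  /-- the gates of a layer act on disjoint sets of qubits -/
  disjoint : ∀ L ∈ layers, L.Pairwise fun g h => Disjoint g.support h.support

/-- The number of layers. -/
def QACCircuit.depth {Q : Type} [DecidableEq Q] (C : QACCircuit Q) : ℕ :=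
  C.layers.length

/-- The number of gates plus the number of qubits. -/
def QACCircuit.size {Q : Type} [Fintype Q] [DecidableEq Q] (C : QACCircuit Q) : ℕ :=
  (C.layers.map List.length).sum + Fintype.card Q

/-- The operator `M_d ⋯ M₁` of a circuit. -/
noncomputable def QACCircuit.toMatrix {Q : Type} [Fintype Q] [DecidableEq Q]
    (C : QACCircuit Q) : Matrix (Q → Bool) (Q → Bool) ℂ :=
  (C.layers.map fun L => (L.map QACGate.toMatrix).prod).reverse.prod

/-- The register of a deciding circuit: `n` input qubits, `a` ancillas, and one output qubit. -/
abbrev Register (n a : ℕ) : Type := Fin n ⊕ Fin a ⊕ Unit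

/-- The output (last) qubit. -/
def Register.out {n a : ℕ} : Register n a := Sum.inr (Sum.inr ())

/-- The basis state `|x⟩|0ᵃ⟩|0⟩`. -/
def Register.init {n : ℕ} (a : ℕ) (x : Fin n → Bool) : Register n a → Bool :=
  Sum.elim x fun _ => false

/-- The probability that measuring the output qubit of `C|x⟩|0ᵃ⟩|0⟩` gives `b`. -/
noncomputable def outputProb {n a : ℕ} (C : QACCircuit (Register n a)) (x : Fin n → Bool)
    (b : Bool) : ℝ :=
  ∑ y : Register n a → Bool,
    if y Register.out = b then ‖C.toMatrix y (Register.init a x)‖ ^ 2 else 0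

/-- `C` decides `f` with error `ε`. -/
def Decides {n a : ℕ} (C : QACCircuit (Register n a)) (f : (Fin n → Bool) → Bool) (ε : ℝ) : Prop :=
  ∀ x, 1 - ε ≤ outputProb C x (f x)

/-- `EQAC⁰`: exactly decided by constant-depth polynomial-size QAC circuits (non-uniform). -/
def EQAC0 : Set BoolFamily :=
  {f | ∃ (d : ℕ) (p : Polynomial ℕ), ∀ n : ℕ, ∃ (a : ℕ) (C : QACCircuit (Register n a)),
    C.depth ≤ d ∧ C.size ≤ p.eval n ∧ Decides C (f n) 0}

/-! Two facts meet. Classically, a symmetric function in AC⁰ is constant on all weights between L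
and n - L for a polylogarithmic L (`exists_const_of_mem_SymAC0`). Quantumly, every symmetric
function of this kind has an exact circuit of constant depth and polynomial size
(`QComp.exists_symmetric`). The common scale is m = `logRoot n`, about the square root of log n: L
is a power of m, whereas sizes may be any power of 2 ^ (m ^ 2), which is still polynomial in n.

Classical part (Razborov–Smolensky). Suppose the value changes between two consecutive middle
weights. Leave M inputs y free and pad with ones and zeros: M + 1 paddings read off the window of
the value sequence that starts at |y|. Positions with equal windows differ by multiples of one g ≥ 2
(`IsWindowShift.dvd`), so for some ω ≠ 1 with ω ^ g = 1, taken in a field of characteristic 2 or 3,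
the window determines ω ^ |y|. Constant-depth circuits are approximated over such fields by
polynomials of low degree (`ACCircuit.exists_approx`); hence so is ω ^ |y|, which contradicts
`smolensky`.

Quantum part. In constant depth, 2 ^ O(m ^ 2) ancillas suffice to prepare exactly a state whose m
targets are all zero or all one with probability 1/2 each (`hasNekomata_fin`): many independent
columns are each all ones with tiny probability, their entrywise disjunction is all zero or all one
with constant probability each, and after exact reweighting one Grover step removes everything else.
Such a state gives exact parity through a phase test (`QCompOn.phaseTest`), and parity conjugated by
Hadamard gates is fan-out (`QComp.copy_of_parity`). Iteration yields fan-out to any power of m.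

With fan-out, the phase test with a root of unity of order 2 ^ e decides exactly whether poly(m)
bits have weight k (`QComp.exists_count`). For n bits, hash the positions into poly(m) buckets with
poly(m) hash functions such that every small set is separated by one of them; thresholds up to a
power of m on the numbers of ones and of zeros become thresholds on numbers of hit buckets
(`le_popcount_iff`). These thresholds determine the function. -/

open Function

set_option linter.unusedSectionVars false

/-- State vectors of the register `Q`. -/
abbrev QVec (Q : Type) : Type := (Q → Bool) → ℂ

/-- The layers of a circuit, the first one to be applied at the head. -/
abbrev Layers (Q : Type) : Type := List (List (QACGate Q))

/-- The basis state `|z⟩`. -/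
noncomputable def basis {Q : Type} (z : Q → Bool) : QVec Q :=
  fun y => open Classical in if y = z then 1 else 0

theorem basis_apply {Q : Type} (z y : Q → Bool) [Decidable (y = z)] :
    basis z y = if y = z then 1 else 0 := by
  unfold basis
  congr

/-! ### Circuits as operators on state vectors; inverses and commutation. -/

section Semantics

variable {Q : Type} [DecidableEq Q]

/-- The permutation of basis states of a generalized Toffoli gate. -/
def toffoliMap (S : Finset Q) (t : Q) (y : Q → Bool) : Q → Bool :=
  update y t (xor (y t) (decide (∀ s ∈ S, y s = true)))

/-- The action of a gate on state vectors. -/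
noncomputable def QACGate.act : QACGate Q → Module.End ℂ (QVec Q)
  | .single q U =>
    { toFun := fun ψ y => ∑ b, (U : Matrix Bool Bool ℂ) (y q) b * ψ (update y q b)
      map_add' := fun ψ φ => by
        ext y; simp [mul_add]; ring
      map_smul' := fun c ψ => by
        ext y; simp; ring }
  | .toffoli S _ t _ =>
    LinearMap.funLeft ℂ ℂ (toffoliMap S t)

theorem QACGate.act_single (q : Q) (U : Matrix.unitaryGroup Bool ℂ) (ψ : QVec Q) (y : Q → Bool) :
    (QACGate.single q U).act ψ y
      = ∑ b, (U : Matrix Bool Bool ℂ) (y q) b * ψ (update y q b) := rfl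

theorem QACGate.act_toffoli (S : Finset Q) (hS : S.Nonempty) (t : Q) (ht : t ∉ S) (ψ : QVec Q)
    (y : Q → Bool) :
    (QACGate.toffoli S hS t ht).act ψ y = ψ (toffoliMap S t y) := rfl

theorem QACGate.toMatrix_toffoli [Fintype Q] (S : Finset Q) (hS : S.Nonempty) (t : Q) (ht : t ∉ S)
    (y x : Q → Bool) :
    (QACGate.toffoli S hS t ht).toMatrix y x = if y = toffoliMap S t x then 1 else 0 := by
  simp only [QACGate.toMatrix, Matrix.of_apply, toffoliMap]
  congr

theorem toffoli_involutive {S : Finset Q} {t : Q} (ht : t ∉ S) :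
    Involutive (toffoliMap S t) := by
  intro y
  unfold toffoliMap
  have h : ∀ b, (∀ s ∈ S, update y t b s = true) ↔ ∀ s ∈ S, y s = true := fun b =>
    forall₂_congr fun s hs => by rw [update_of_ne (by rintro rfl; exact ht hs)]
  ext q
  by_cases hq : q = t
  · subst hq
    simp only [update_self, h]
    cases y q <;> cases decide (∀ s ∈ S, y s = true) <;> rfl
  · simp [update_of_ne hq]

/-- Links the matrices of the definition to an action by substitution in the argument. For a Toffoli
gate, precomposition with the permutation agrees with its matrix because the permutation is an
involution. -/
theorem QACGate.act_eq_mulVec [Fintype Q] (g : QACGate Q) (ψ : QVec Q) :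
    g.act ψ = g.toMatrix.mulVec ψ := by
  ext y
  cases g with
  | single q U =>
    rw [QACGate.act_single, Matrix.mulVec, dotProduct]
    simp only [QACGate.toMatrix, Matrix.of_apply, ite_mul, zero_mul]
    rw [← Finset.sum_filter]
    refine Finset.sum_bij (fun b _ => update y q b) ?_ ?_ ?_ ?_
    · intro b _
      simp only [Finset.mem_filter, Finset.mem_univ, true_and]
      intro r hr
      rw [update_of_ne hr]
    · intro b _ c _ h
      simpa using congrFun h q
    · intro x hx
      refine ⟨x q, Finset.mem_univ _, ?_⟩
      simp only [Finset.mem_filter, Finset.mem_univ, true_and] at hx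
      ext r
      by_cases hr : r = q
      · subst hr; simp
      · rw [update_of_ne hr, hx r hr]
    · intro b _
      simp
  | toffoli S hS t ht =>
    rw [QACGate.act_toffoli, Matrix.mulVec, dotProduct]
    simp only [QACGate.toMatrix_toffoli, ite_mul, zero_mul, one_mul]
    have h : ∀ x : Q → Bool, y = toffoliMap S t x ↔ x = toffoliMap S t y := by
      intro x
      have := toffoli_involutive (S := S) ht
      constructor
      · rintro h; rw [h]; exact (this x).symm
      · rintro h; rw [h]; exact (this y).symm
    simp only [h]
    simp

/-- The action of a layer. -/
noncomputable def runLayer (L : List (QACGate Q)) : Module.End ℂ (QVec Q) :=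
  (L.map QACGate.act).prod

/-- The action of a circuit. -/
noncomputable def run (C : Layers Q) : Module.End ℂ (QVec Q) :=
  (C.map runLayer).reverse.prod

@[simp] theorem runLayer_nil : runLayer ([] : List (QACGate Q)) = 1 := rfl

@[simp] theorem runLayer_cons (g : QACGate Q) (L : List (QACGate Q)) :
    runLayer (g :: L) = g.act * runLayer L := by simp [runLayer]

theorem runLayer_append (L M : List (QACGate Q)) :
    runLayer (L ++ M) = runLayer L * runLayer M := by simp [runLayer]

@[simp] theorem run_nil : run ([] : Layers Q) = 1 := rfl

@[simp] theorem run_cons (L : List (QACGate Q)) (C : Layers Q) :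
    run (L :: C) = run C * runLayer L := by simp [run]

theorem run_append (C D : Layers Q) : run (C ++ D) = run D * run C := by simp [run]

theorem QACCircuit.toMatrix_mulVec [Fintype Q] (C : QACCircuit Q) (ψ : QVec Q) :
    C.toMatrix.mulVec ψ = run C.layers ψ := by
  have hg : ∀ g : QACGate Q, Matrix.toLinAlgEquiv' g.toMatrix = g.act := fun g => by
    ext1 ψ
    ext y
    simp [QACGate.act_eq_mulVec]
  have hL : ∀ L : List (QACGate Q),
      Matrix.toLinAlgEquiv' (L.map QACGate.toMatrix).prod = runLayer L := fun L => by
    rw [map_list_prod, List.map_map, runLayer]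
    congr 2
    ext1 g; exact hg g
  have : Matrix.toLinAlgEquiv' C.toMatrix = run C.layers := by
    rw [QACCircuit.toMatrix, map_list_prod, List.map_reverse, List.map_map, run]
    congr 3
    ext1 L; exact hL L
  rw [← this]; simp

/-! ### Inverses -/

/-- The inverse gate. -/
noncomputable def QACGate.symm : QACGate Q → QACGate Q
  | .single q U => .single q U⁻¹
  | .toffoli S hS t ht => .toffoli S hS t ht

@[simp] theorem QACGate.support_symm (g : QACGate Q) : g.symm.support = g.support := by
  cases g <;> rfl

theorem QACGate.act_single_mul (q : Q) (U V : Matrix.unitaryGroup Bool ℂ) :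
    (QACGate.single q U).act * (QACGate.single q V).act = (QACGate.single q (U * V)).act := by
  ext1 ψ
  ext y
  simp only [Module.End.mul_apply, QACGate.act_single, update_idem, update_self,
    Matrix.UnitaryGroup.mul_val, Matrix.mul_apply, Fintype.sum_bool]
  ring

theorem QACGate.act_single_one (q : Q) : (QACGate.single q 1).act = 1 := by
  ext1 ψ
  ext y
  rw [QACGate.act_single]
  simp only [Matrix.UnitaryGroup.one_val, Matrix.one_apply, ite_mul, one_mul, zero_mul]
  simp

theorem QACGate.act_symm_mul (g : QACGate Q) : g.symm.act * g.act = 1 := by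
  cases g with
  | single q U => rw [QACGate.symm, QACGate.act_single_mul, inv_mul_cancel, QACGate.act_single_one]
  | toffoli S hS t ht =>
    ext1 ψ
    ext y
    exact congrArg ψ (toffoli_involutive ht y)

/-- The inverse circuit. -/
noncomputable def Layers.symm (C : Layers Q) : Layers Q :=
  (C.map fun L => (L.map QACGate.symm).reverse).reverse

@[simp] theorem Layers.length_symm (C : Layers Q) : C.symm.length = C.length := by
  simp [Layers.symm]

theorem runLayer_symm_mul (L : List (QACGate Q)) :
    runLayer (L.map QACGate.symm).reverse * runLayer L = 1 := by
  induction L with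
  | nil => simp
  | cons g L ih =>
    rw [List.map_cons, List.reverse_cons, runLayer_append, runLayer_cons, runLayer_cons,
      runLayer_nil, mul_one, mul_assoc, ← mul_assoc g.symm.act, g.act_symm_mul, one_mul, ih]

theorem run_symm_mul (C : Layers Q) : run C.symm * run C = 1 := by
  induction C with
  | nil => simp [Layers.symm]
  | cons L C ih =>
    have : Layers.symm (L :: C) = Layers.symm C ++ [(L.map QACGate.symm).reverse] := by
      simp [Layers.symm]
    rw [this, run_append, run_cons, run_cons, run_nil, one_mul, mul_assoc, ← mul_assoc (run (Layers.symm C)),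
      ih, one_mul, runLayer_symm_mul]

theorem run_symm_run (C : Layers Q) (ψ : QVec Q) : run C.symm (run C ψ) = ψ := by
  rw [← Module.End.mul_apply, run_symm_mul, Module.End.one_apply]

theorem run_run_symm [Fintype Q] (C : Layers Q) (ψ : QVec Q) : run C (run C.symm ψ) = ψ := by
  have h := run_symm_mul C
  rw [mul_eq_one_comm] at h
  rw [← Module.End.mul_apply, h, Module.End.one_apply]

/-- The inner product of state vectors. -/
noncomputable def qinner [Fintype Q] (φ ψ : QVec Q) : ℂ := ∑ z, star (φ z) * ψ z

theorem QACGate.toMatrix_symm [Fintype Q] (g : QACGate Q) :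
    g.symm.toMatrix = g.toMatrix.conjTranspose := by
  ext y x
  cases g with
  | single q U =>
    simp only [QACGate.symm, QACGate.toMatrix, Matrix.of_apply, Matrix.conjTranspose_apply]
    by_cases h : ∀ r, r ≠ q → y r = x r
    · rw [if_pos h, if_pos fun r hr => (h r hr).symm]
      simp [Matrix.star_apply]
    · rw [if_neg h, if_neg fun h' => h fun r hr => (h' r hr).symm]
      simp
  | toffoli S hS t ht =>
    simp only [QACGate.symm, QACGate.toMatrix_toffoli, Matrix.conjTranspose_apply]
    have := toffoli_involutive (S := S) ht
    by_cases h : y = toffoliMap S t x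
    · rw [if_pos h, if_pos, star_one]
      rw [h]; exact (this x).symm
    · rw [if_neg h, if_neg, star_zero]
      intro h'
      apply h
      rw [h']; exact (this y).symm

theorem qinner_act [Fintype Q] (g : QACGate Q) (φ ψ : QVec Q) :
    qinner (g.act φ) ψ = qinner φ (g.symm.act ψ) := by
  rw [QACGate.act_eq_mulVec, QACGate.act_eq_mulVec, QACGate.toMatrix_symm]
  change star (g.toMatrix.mulVec φ) ⬝ᵥ ψ = star φ ⬝ᵥ _
  rw [Matrix.star_mulVec, Matrix.dotProduct_mulVec]

theorem qinner_runLayer [Fintype Q] (L : List (QACGate Q)) (φ ψ : QVec Q) :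
    qinner (runLayer L φ) ψ = qinner φ (runLayer (L.map QACGate.symm).reverse ψ) := by
  induction L generalizing φ ψ with
  | nil => simp
  | cons g L ih =>
    rw [runLayer_cons, Module.End.mul_apply, qinner_act, ih, List.map_cons, List.reverse_cons,
      runLayer_append, Module.End.mul_apply, runLayer_cons, runLayer_nil, mul_one]

theorem qinner_run [Fintype Q] (C : Layers Q) (φ ψ : QVec Q) :
    qinner (run C φ) ψ = qinner φ (run C.symm ψ) := by
  induction C generalizing φ ψ with
  | nil => simp [Layers.symm]
  | cons L C ih =>
    have : Layers.symm (L :: C) = Layers.symm C ++ [(L.map QACGate.symm).reverse] := by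
      simp [Layers.symm]
    rw [run_cons, Module.End.mul_apply, ih, qinner_runLayer, this, run_append,
      Module.End.mul_apply, run_cons, run_nil, one_mul]

theorem qinner_run_run [Fintype Q] (C : Layers Q) (φ ψ : QVec Q) :
    qinner (run C φ) (run C ψ) = qinner φ ψ := by
  rw [qinner_run, run_symm_run]

theorem qinner_basis_left [Fintype Q] (z : Q → Bool) (ψ : QVec Q) :
    qinner (basis z) ψ = ψ z := by
  simp [qinner, basis_apply]

/-- The total weight of a state prepared from a basis state is one. -/
theorem sum_norm_sq_run_basis [Fintype Q] (C : Layers Q) (z : Q → Bool) :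
    ∑ y, ‖run C (basis z) y‖ ^ 2 = 1 := by
  have h := qinner_run_run C (basis z) (basis z)
  rw [qinner_basis_left, basis_apply, if_pos rfl, qinner] at h
  have : ∀ y, star (run C (basis z) y) * run C (basis z) y
      = ((‖run C (basis z) y‖ ^ 2 : ℝ) : ℂ) := fun y => by
    rw [mul_comm, Complex.star_def, Complex.mul_conj, Complex.normSq_eq_norm_sq]
  simp only [this] at h
  exact_mod_cast h

/-! ### Well-formed circuits -/

/-- The gates of each layer act on disjoint sets of qubits. -/
def Layers.WF (C : Layers Q) : Prop :=
  ∀ L ∈ C, L.Pairwise fun g h => Disjoint g.support h.support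

theorem Layers.WF.nil : Layers.WF ([] : Layers Q) := by simp [Layers.WF]

theorem Layers.wf_cons {L : List (QACGate Q)} {C : Layers Q} :
    Layers.WF (L :: C) ↔ (L.Pairwise fun g h => Disjoint g.support h.support) ∧ C.WF := by
  simp [Layers.WF]

theorem Layers.WF.append {C D : Layers Q} (hC : C.WF) (hD : D.WF) : Layers.WF (C ++ D) := by
  intro L hL
  rcases List.mem_append.1 hL with h | h
  exacts [hC L h, hD L h]

theorem Layers.WF.symm {C : Layers Q} (hC : C.WF) : C.symm.WF := by
  intro L hL
  simp only [Layers.symm, List.mem_reverse, List.mem_map] at hL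
  obtain ⟨M, hM, rfl⟩ := hL
  rw [List.pairwise_reverse, List.pairwise_map]
  refine (hC M hM).imp ?_
  intro g h hgh
  simpa using hgh.symm

theorem Layers.wf_singleton_singleton (g : QACGate Q) : Layers.WF [[g]] := by
  simp [Layers.WF]

theorem QACGate.support_nonempty (g : QACGate Q) : g.support.Nonempty := by
  cases g <;> simp [QACGate.support]

/-- One qubit chosen from each support gives distinct qubits. Hence the number of gates is at most
depth times number of qubits, and only ancillas need counting later. -/
theorem length_le_of_pairwise_disjoint [Fintype Q] {L : List (QACGate Q)}
    (hL : L.Pairwise fun g h => Disjoint g.support h.support) :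
    L.length ≤ Fintype.card Q := by
  suffices h : ∃ S : Finset Q, L.length ≤ S.card ∧ ∀ q ∈ S, ∃ g ∈ L, q ∈ g.support by
    obtain ⟨S, hS, -⟩ := h
    exact hS.trans (Finset.card_le_univ S)
  induction L with
  | nil => exact ⟨∅, by simp⟩
  | cons g L ih =>
    rw [List.pairwise_cons] at hL
    obtain ⟨S, hS, hS'⟩ := ih hL.2
    obtain ⟨q, hq⟩ := g.support_nonempty
    refine ⟨insert q S, ?_, ?_⟩
    · rw [Finset.card_insert_of_notMem, List.length_cons]
      · lia
      · intro hqS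
        obtain ⟨h, hh, hqh⟩ := hS' q hqS
        exact Finset.disjoint_left.1 (hL.1 h hh) hq hqh
    · intro r hr
      rcases Finset.mem_insert.1 hr with rfl | hr
      · exact ⟨g, by simp, hq⟩
      · obtain ⟨h, hh, hrh⟩ := hS' r hr
        exact ⟨h, by simp [hh], hrh⟩

/-! ### Gates on disjoint sets of qubits commute -/

theorem QACGate.commute_of_disjoint {g h : QACGate Q} (hd : Disjoint g.support h.support) :
    Commute g.act h.act := by
  have key : ∀ (q : Q) (U : Matrix.unitaryGroup Bool ℂ) (S : Finset Q) (hS : S.Nonempty) (t : Q)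
      (ht : t ∉ S), Disjoint {q} (insert t S) →
      Commute (QACGate.single q U).act (QACGate.toffoli S hS t ht).act := by
    intro q U S hS t ht hd
    simp only [Finset.disjoint_singleton_left, Finset.mem_insert, not_or] at hd
    obtain ⟨hqt, hqS⟩ := hd
    ext1 ψ
    ext y
    simp only [Module.End.mul_apply, QACGate.act_single, QACGate.act_toffoli, toffoliMap]
    refine Finset.sum_congr rfl fun b _ => ?_
    have h1 : (∀ s ∈ S, update y q b s = true) ↔ ∀ s ∈ S, y s = true :=
      forall₂_congr fun s hs => by rw [update_of_ne (by rintro rfl; exact hqS hs)]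
    rw [update_of_ne (a := q) (a' := t) hqt, update_of_ne (a := t) (a' := q) (Ne.symm hqt)]
    simp only [h1]
    rw [update_comm hqt]
  cases g with
  | single q U =>
    cases h with
    | single r V =>
      simp only [QACGate.support, Finset.disjoint_singleton] at hd
      ext1 ψ
      ext y
      simp only [Module.End.mul_apply, QACGate.act_single, update_of_ne hd, update_of_ne (Ne.symm hd),
        Finset.mul_sum]
      rw [Finset.sum_comm]
      refine Finset.sum_congr rfl fun b _ => Finset.sum_congr rfl fun c _ => ?_
      rw [update_comm hd]; ring
    | toffoli S hS t ht => exact key q U S hS t ht hd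
  | toffoli S hS t ht =>
    cases h with
    | single r V => exact (key r V S hS t ht hd.symm).symm
    | toffoli S' hS' t' ht' =>
      simp only [QACGate.support, Finset.disjoint_insert_left, Finset.disjoint_insert_right,
        Finset.mem_insert, not_or] at hd
      obtain ⟨⟨htt, htS⟩, htS', -⟩ := hd
      ext1 ψ
      ext y
      simp only [Module.End.mul_apply, QACGate.act_toffoli, toffoliMap]
      have h1 : ∀ b, (∀ s ∈ S', update y t b s = true) ↔ ∀ s ∈ S', y s = true := fun b =>
        forall₂_congr fun s hs => by rw [update_of_ne (by rintro rfl; exact htS' hs)]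
      have h2 : ∀ b, (∀ s ∈ S, update y t' b s = true) ↔ ∀ s ∈ S, y s = true := fun b =>
        forall₂_congr fun s hs => by rw [update_of_ne (by rintro rfl; exact htS hs)]
      simp only [h1, h2, update_of_ne htt, update_of_ne (Ne.symm htt)]
      rw [update_comm htt]

theorem runLayer_commute {L M : List (QACGate Q)}
    (h : ∀ g ∈ L, ∀ k ∈ M, Disjoint g.support k.support) : Commute (runLayer L) (runLayer M) := by
  apply Commute.list_prod_left
  intro x hx
  obtain ⟨g, hg, rfl⟩ := List.mem_map.1 hx
  apply Commute.list_prod_right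
  intro y hy
  obtain ⟨k, hk, rfl⟩ := List.mem_map.1 hy
  exact QACGate.commute_of_disjoint (h g hg k hk)

/-! ### Parallel composition -/

/-- Two circuits side by side. -/
def Layers.par2 : Layers Q → Layers Q → Layers Q
  | [], D => D
  | L :: C, [] => L :: C
  | L :: C, M :: D => (L ++ M) :: par2 C D

/-- All qubits touched by `C` satisfy `P`. -/
def Layers.On (C : Layers Q) (P : Q → Prop) : Prop :=
  ∀ L ∈ C, ∀ g ∈ L, ∀ q ∈ g.support, P q

theorem Layers.on_cons {L : List (QACGate Q)} {C : Layers Q} {P : Q → Prop} :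
    Layers.On (L :: C) P ↔ (∀ g ∈ L, ∀ q ∈ g.support, P q) ∧ C.On P := by
  simp [Layers.On]

theorem Layers.length_par2 (C D : Layers Q) : (par2 C D).length = max C.length D.length := by
  induction C generalizing D with
  | nil => simp [par2]
  | cons L C ih =>
    cases D with
    | nil => simp [par2]
    | cons M D => simp [par2, ih]

theorem Layers.on_par2 {C D : Layers Q} {P : Q → Prop} (hC : C.On P) (hD : D.On P) :
    (par2 C D).On P := by
  induction C generalizing D with
  | nil => simpa [par2] using hD
  | cons L C ih =>
    cases D with
    | nil => simpa [par2] using hC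
    | cons M D =>
      rw [on_cons] at hC hD
      rw [par2, on_cons]
      refine ⟨fun g hg => ?_, ih hC.2 hD.2⟩
      rcases List.mem_append.1 hg with hg | hg
      exacts [hC.1 g hg, hD.1 g hg]

theorem disjoint_support_of_on {P R : Q → Prop} (hPR : ∀ q, P q → ¬ R q) {g h : QACGate Q}
    (hg : ∀ q ∈ g.support, P q) (hh : ∀ q ∈ h.support, R q) : Disjoint g.support h.support :=
  Finset.disjoint_left.2 fun q hq hq' => hPR q (hg q hq) (hh q hq')

theorem Layers.WF.par2 {C D : Layers Q} {P R : Q → Prop} (hC : C.WF) (hD : D.WF) (hCP : C.On P)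
    (hDR : D.On R) (hPR : ∀ q, P q → ¬ R q) : (par2 C D).WF := by
  induction C generalizing D with
  | nil => simpa [Layers.par2] using hD
  | cons L C ih =>
    cases D with
    | nil => simpa [Layers.par2] using hC
    | cons M D =>
      rw [wf_cons] at hC hD
      rw [on_cons] at hCP hDR
      rw [Layers.par2, wf_cons, List.pairwise_append]
      exact ⟨⟨hC.1, hD.1, fun g hg h hh =>
        disjoint_support_of_on hPR (hCP.1 g hg) (hDR.1 h hh)⟩, ih hC.2 hD.2 hCP.2 hDR.2⟩

/-- Layers merge pairwise since the remaining layers of `D` commute with the current layer of `C`.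
-/
theorem run_par2 {C D : Layers Q} {P R : Q → Prop} (hCP : C.On P)
    (hDR : D.On R) (hPR : ∀ q, P q → ¬ R q) : run (Layers.par2 C D) = run C * run D := by
  induction C generalizing D with
  | nil => simp [Layers.par2]
  | cons L C ih =>
    cases D with
    | nil => simp [Layers.par2]
    | cons M D =>
      rw [Layers.on_cons] at hCP hDR
      rw [Layers.par2, run_cons, run_cons, run_cons, ih hCP.2 hDR.2, runLayer_append]
      have hc : Commute (run D) (runLayer L) := by
        apply Commute.list_prod_left
        intro x hx
        simp only [List.mem_reverse, List.mem_map] at hx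
        obtain ⟨N, hN, rfl⟩ := hx
        exact (runLayer_commute fun g hg k hk =>
          disjoint_support_of_on hPR (hCP.1 g hg) (hDR.2 N hN k hk)).symm
      rw [mul_assoc, ← mul_assoc (run D), hc.eq]
      simp only [mul_assoc]

end Semantics

/-! ### Circuits acting on part of a larger register. -/

section Embedding

variable {A Q : Type} [DecidableEq A] [DecidableEq Q]

/-- A gate on the qubits `A`, applied to the qubits `e a`. -/
def QACGate.map (e : A ↪ Q) : QACGate A → QACGate Q
  | .single q U => .single (e q) U
  | .toffoli S hS t ht => .toffoli (S.map e) hS.map (e t) (by simpa using ht)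

/-- A circuit on the qubits `A`, applied to the qubits `e a`. -/
def Layers.embed (e : A ↪ Q) (C : Layers A) : Layers Q :=
  List.map (List.map (QACGate.map e)) C

@[simp] theorem Layers.length_embed (e : A ↪ Q) (C : Layers A) :
    (C.embed e).length = C.length := by simp [Layers.embed]

theorem QACGate.support_map (e : A ↪ Q) (g : QACGate A) :
    (g.map e).support = g.support.map e := by
  cases g <;> simp [QACGate.map, QACGate.support, Finset.map_insert]

theorem Layers.WF.embed {C : Layers A} (hC : C.WF) (e : A ↪ Q) : (C.embed e).WF := by
  intro L hL
  obtain ⟨M, hM, rfl⟩ := List.mem_map.1 hL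
  rw [List.pairwise_map]
  refine (hC M hM).imp ?_
  intro g h hgh
  rw [QACGate.support_map, QACGate.support_map]
  exact (Finset.disjoint_map e).2 hgh

theorem Layers.on_embed (C : Layers A) (e : A ↪ Q) : (C.embed e).On fun q => ∃ a, e a = q := by
  intro L hL
  obtain ⟨M, hM, rfl⟩ := List.mem_map.1 hL
  intro g hg q hq
  obtain ⟨h, hh, rfl⟩ := List.mem_map.1 hg
  rw [QACGate.support_map, Finset.mem_map] at hq
  obtain ⟨a, -, ha⟩ := hq
  exact ⟨a, ha⟩

theorem update_extend (e : A ↪ Q) (a : A → Bool) (z : Q → Bool) (q : A) (b : Bool) :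
    update (extend e a z) (e q) b = extend e (update a q b) z := by
  ext r
  by_cases hr : ∃ c, e c = r
  · obtain ⟨c, rfl⟩ := hr
    rw [e.injective.extend_apply]
    by_cases hc : c = q
    · subst hc; simp
    · rw [update_of_ne hc, update_of_ne (e.injective.ne hc), e.injective.extend_apply]
  · rw [extend_apply' _ _ _ hr, update_of_ne (by rintro rfl; exact hr ⟨q, rfl⟩),
      extend_apply' _ _ _ hr]

theorem QACGate.act_map (e : A ↪ Q) (g : QACGate A) (ψ : QVec Q) (z : Q → Bool) (a : A → Bool) :
    (g.map e).act ψ (extend e a z) = g.act (fun c => ψ (extend e c z)) a := by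
  cases g with
  | single q U =>
    simp only [QACGate.map, QACGate.act_single, e.injective.extend_apply, update_extend]
  | toffoli S hS t ht =>
    simp only [QACGate.map, QACGate.act_toffoli, toffoliMap]
    rw [update_extend]
    simp [e.injective.extend_apply]

theorem run_embed (e : A ↪ Q) (C : Layers A) (ψ : QVec Q) (z : Q → Bool) (a : A → Bool) :
    run (C.embed e) ψ (extend e a z) = run C (fun c => ψ (extend e c z)) a := by
  have hL : ∀ (L : List (QACGate A)) (ψ : QVec Q) (a : A → Bool),
      runLayer (L.map (QACGate.map e)) ψ (extend e a z)
        = runLayer L (fun c => ψ (extend e c z)) a := by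
    intro L
    induction L with
    | nil => intro ψ a; simp
    | cons g L ih =>
      intro ψ a
      simp only [List.map_cons, runLayer_cons, Module.End.mul_apply, QACGate.act_map, ih]
  induction C generalizing ψ with
  | nil => simp [Layers.embed]
  | cons L C ih =>
    have : Layers.embed e (L :: C) = L.map (QACGate.map e) :: Layers.embed e C := rfl
    rw [this, run_cons, Module.End.mul_apply, run_cons, Module.End.mul_apply, ih]
    have : (fun c => runLayer (L.map (QACGate.map e)) ψ (extend e c z))
        = runLayer L fun c => ψ (extend e c z) := funext fun c => hL L ψ c
    rw [this]

theorem extend_comp_self (e : A ↪ Q) (z : Q → Bool) : extend e (z ∘ e) z = z := by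
  ext q
  by_cases hq : ∃ a, e a = q
  · obtain ⟨a, rfl⟩ := hq
    rw [e.injective.extend_apply]; rfl
  · rw [extend_apply' _ _ _ hq]

/-- On a product state whose factor `γ` ignores the embedded qubits, only the other factor evolves:
on each slice with the outside qubits fixed, `γ` is a scalar. -/
theorem run_embed_mul (e : A ↪ Q) (C : Layers A) (γ : QVec Q) (α : QVec A)
    (hγ : ∀ z a, γ (extend e a z) = γ z) :
    run (C.embed e) (fun z => γ z * α (z ∘ e)) = fun z => γ z * run C α (z ∘ e) := by
  funext z
  conv_lhs => rw [← extend_comp_self e z]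
  rw [run_embed]
  have : (fun c : A → Bool => γ (extend e c z) * α (extend e c z ∘ e)) = γ z • α := by
    funext c
    rw [hγ, extend_comp e.injective]
    rfl
  rw [this, map_smul]
  rfl

/-- The indicator of agreement with `z` on the qubits of `P`. -/
noncomputable def agreeOn (P : Q → Prop) (z y : Q → Bool) : ℂ :=
  open Classical in if ∀ q, P q → y q = z q then 1 else 0

theorem run_embed_basis {e : A ↪ Q} {C : Layers A} {a b : A → Bool}
    (h : run C (basis a) = basis b) {z z' : Q → Bool} (hz : ∀ q, z (e q) = a q)
    (hz' : ∀ q, z' (e q) = b q) (hzz' : ∀ q, (∀ r, e r ≠ q) → z q = z' q) :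
    run (C.embed e) (basis z) = basis z' := by
  classical
  have key : ∀ (c : A → Bool) (w : Q → Bool), (∀ q, w (e q) = c q) →
      (∀ q, (∀ r, e r ≠ q) → z q = w q) →
      basis w = fun y => agreeOn (fun q => ∀ r, e r ≠ q) z y * basis c (y ∘ e) := by
    intro c w hw hzw
    ext y
    rw [basis_apply, basis_apply, agreeOn]
    by_cases hy : y = w
    · subst hy
      rw [if_pos rfl, if_pos fun q hq => (hzw q hq).symm, if_pos (show y ∘ e = c from funext hw), one_mul]
    · rw [if_neg hy]
      by_cases h1 : ∀ q, (∀ r, e r ≠ q) → y q = z q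
      · rw [if_pos h1, if_neg, mul_zero]
        intro h2
        apply hy
        ext q
        by_cases hq : ∃ r, e r = q
        · obtain ⟨r, rfl⟩ := hq
          rw [hw]; exact congrFun h2 r
        · push Not at hq
          rw [h1 q hq, hzw q hq]
      · rw [if_neg h1, zero_mul]
  rw [key a z hz fun _ _ => rfl, run_embed_mul, h, ← key b z' hz' hzz']
  intro y c
  unfold agreeOn
  refine if_congr (forall₂_congr fun q hq => ?_) rfl rfl
  rw [extend_apply' _ _ _ (by simpa using hq)]

end Embedding

/-! ### Families of circuits on disjoint registers. -/

section Parallel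

variable {I Q : Type} {A : I → Type} [Fintype I] [DecidableEq I] [DecidableEq Q]
  [∀ i, DecidableEq (A i)]

/-- The circuits `C i`, applied simultaneously to the qubits `e i a`. -/
noncomputable def Layers.par (e : ∀ i, A i ↪ Q) (C : ∀ i, Layers (A i)) : Layers Q :=
  ((Finset.univ.toList.map fun i => (C i).embed (e i)).foldr Layers.par2 [])

theorem Layers.length_par_le (e : ∀ i, A i ↪ Q) {C : ∀ i, Layers (A i)} {d : ℕ}
    (h : ∀ i, (C i).length ≤ d) : (Layers.par e C).length ≤ d := by
  unfold Layers.par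
  induction (Finset.univ : Finset I).toList with
  | nil => simp
  | cons i l ih =>
    rw [List.map_cons, List.foldr_cons, length_par2]
    exact max_le (by simpa using h i) ih

theorem Layers.on_foldr_par (e : ∀ i, A i ↪ Q) (C : ∀ i, Layers (A i)) (l : List I) :
    Layers.On ((l.map fun i => (C i).embed (e i)).foldr Layers.par2 [])
      fun q => ∃ i ∈ l, ∃ a, e i a = q := by
  induction l with
  | nil => simp [Layers.On]
  | cons i l ih =>
    rw [List.map_cons, List.foldr_cons]
    apply on_par2
    · intro L hL g hg q hq
      obtain ⟨a, ha⟩ := (C i).on_embed (e i) L hL g hg q hq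
      exact ⟨i, by simp, a, ha⟩
    · intro L hL g hg q hq
      obtain ⟨j, hj, a, ha⟩ := ih L hL g hg q hq
      exact ⟨j, by simp [hj], a, ha⟩

variable {e : ∀ i, A i ↪ Q} (hd : ∀ i j, i ≠ j → ∀ a b, e i a ≠ e j b)
include hd

theorem Layers.not_mem_range_of_notMem {i : I} {l : List I} (hi : i ∉ l) (q : Q)
    (hq : ∃ a, e i a = q) : ¬ ∃ j ∈ l, ∃ a, e j a = q := by
  rintro ⟨j, hj, b, rfl⟩
  obtain ⟨a, ha⟩ := hq
  exact hd i j (by rintro rfl; exact hi hj) a b ha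

theorem Layers.WF.par {C : ∀ i, Layers (A i)} (hC : ∀ i, (C i).WF) : (Layers.par e C).WF := by
  unfold Layers.par
  have hn := (Finset.univ : Finset I).nodup_toList
  generalize (Finset.univ : Finset I).toList = l at hn ⊢
  induction l with
  | nil => exact Layers.WF.nil
  | cons i l ih =>
    rw [List.nodup_cons] at hn
    rw [List.map_cons, List.foldr_cons]
    exact Layers.WF.par2 ((hC i).embed (e i)) (ih hn.2) ((C i).on_embed (e i))
      (on_foldr_par e C l) (not_mem_range_of_notMem hd hn.1)

/-- Circuits applied in parallel to a product state. -/
theorem run_par_prod (C : ∀ i, Layers (A i)) (γ : QVec Q) (α : ∀ i, QVec (A i))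
    (hγ : ∀ i z a, γ (extend (e i) a z) = γ z) :
    run (Layers.par e C) (fun z => γ z * ∏ i, α i (z ∘ e i))
      = fun z => γ z * ∏ i, run (C i) (α i) (z ∘ e i) := by
  -- Induction over the blocks already processed; the remaining blocks keep their initial factor.
  have key : ∀ l : List I, l.Nodup →
      run ((l.map fun i => (C i).embed (e i)).foldr Layers.par2 [])
        (fun z => γ z * ∏ i, α i (z ∘ e i))
      = fun z => γ z * ∏ i, (if i ∈ l then run (C i) (α i) else α i) (z ∘ e i) := by
    intro l hl
    induction l with
    | nil => simp
    | cons i l ih =>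
      rw [List.nodup_cons] at hl
      rw [List.map_cons, List.foldr_cons, run_par2 ((C i).on_embed (e i))
        (Layers.on_foldr_par e C l) (Layers.not_mem_range_of_notMem hd hl.1),
        Module.End.mul_apply, ih hl.2]
      have h1 : ∀ (β : ∀ i, QVec (A i)), (fun z : Q → Bool => γ z * ∏ k, β k (z ∘ e k))
          = fun z => (γ z * ∏ k ∈ Finset.univ.erase i, β k (z ∘ e k)) * β i (z ∘ e i) := by
        intro β
        funext z
        rw [← Finset.mul_prod_erase Finset.univ _ (Finset.mem_univ i)]
        ring
      rw [h1, h1, run_embed_mul]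
      · funext z
        have h2 : ∀ k ∈ Finset.univ.erase i, (k ∈ i :: l ↔ k ∈ l) := by
          intro k hk
          simp [Finset.ne_of_mem_erase hk]
        rw [if_neg hl.1, if_pos (by simp)]
        congr 2
        exact Finset.prod_congr rfl fun k hk => by simp only [h2 k hk]
      · intro z a
        rw [hγ]
        congr 1
        refine Finset.prod_congr rfl fun k hk => ?_
        have hk' : extend (e i) a z ∘ e k = z ∘ e k := by
          funext b
          simp only [comp_apply]
          rw [extend_apply']
          rintro ⟨c, hc⟩
          exact hd i k (Finset.ne_of_mem_erase hk).symm c b hc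
        rw [hk']
  rw [Layers.par, key _ (Finset.nodup_toList _)]
  simp

omit hd in
theorem basis_eq_agreeOn_mul_prod {w z : Q → Bool} (c : ∀ i, A i → Bool)
    (hw : ∀ i q, w (e i q) = c i q) (hzw : ∀ q, (∀ i r, e i r ≠ q) → z q = w q) :
    basis w = fun y => agreeOn (fun q => ∀ i r, e i r ≠ q) z y * ∏ i, basis (c i) (y ∘ e i) := by
  classical
  funext y
  rw [basis_apply, agreeOn]
  by_cases hy : y = w
  · subst hy
    rw [if_pos rfl, if_pos fun q hq => (hzw q hq).symm, Finset.prod_eq_one, one_mul]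
    intro i _
    rw [basis_apply, if_pos (show y ∘ e i = c i from funext (hw i))]
  · rw [if_neg hy]
    by_cases h1 : ∀ q, (∀ i r, e i r ≠ q) → y q = z q
    · rw [if_pos h1, one_mul]
      symm
      by_contra h2
      apply hy
      ext q
      by_cases hq : ∃ i r, e i r = q
      · obtain ⟨i, r, rfl⟩ := hq
        have h3 := Finset.prod_ne_zero_iff.1 h2 i (Finset.mem_univ i)
        rw [basis_apply] at h3
        rw [hw]
        exact congrFun (ite_ne_right_iff.1 h3).1 r
      · push Not at hq
        rw [h1 q hq, hzw q hq]
    · rw [if_neg h1, zero_mul]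

omit hd in
theorem agreeOn_extend_family (z : Q → Bool) (i : I) (y : Q → Bool) (c : A i → Bool) :
    agreeOn (fun q => ∀ i r, e i r ≠ q) z (extend (e i) c y)
      = agreeOn (fun q => ∀ i r, e i r ≠ q) z y := by
  classical
  unfold agreeOn
  refine if_congr (forall₂_congr fun q hq => ?_) rfl rfl
  rw [extend_apply' _ _ _ (by simpa using hq i)]

theorem run_par_basis {C : ∀ i, Layers (A i)} {a b : ∀ i, A i → Bool}
    (h : ∀ i, run (C i) (basis (a i)) = basis (b i)) {z z' : Q → Bool}
    (hz : ∀ i q, z (e i q) = a i q) (hz' : ∀ i q, z' (e i q) = b i q)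
    (hzz' : ∀ q, (∀ i r, e i r ≠ q) → z q = z' q) :
    run (Layers.par e C) (basis z) = basis z' := by
  rw [basis_eq_agreeOn_mul_prod a hz fun _ _ => rfl,
    run_par_prod hd _ _ _ (agreeOn_extend_family z)]
  simp only [h]
  rw [← basis_eq_agreeOn_mul_prod b hz' hzz']

end Parallel

/-! ### Diagonal operators, elementary gates and sign flips. -/

section Linear

variable {Q : Type} [Fintype Q] [DecidableEq Q]

theorem QVec.eq_sum (ψ : QVec Q) : ψ = ∑ z, ψ z • basis z := by
  funext y
  simp [Finset.sum_apply, basis_apply]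

/-- An operator that is diagonal on the support of `ψ`. -/
theorem apply_eq_mul_of_basis (T : Module.End ℂ (QVec Q)) (c : QVec Q) (ψ : QVec Q)
    (h : ∀ z, ψ z ≠ 0 → T (basis z) = c z • basis z) : T ψ = fun z => c z * ψ z := by
  conv_lhs => rw [QVec.eq_sum ψ]
  rw [map_sum]
  have : ∀ z, T (ψ z • basis z) = (c z * ψ z) • basis z := by
    intro z
    rw [map_smul]
    by_cases hz : ψ z = 0
    · simp [hz]
    · rw [h z hz, smul_smul, mul_comm]
  simp only [this]
  exact (QVec.eq_sum (fun z => c z * ψ z)).symm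

end Linear

section Gates

/-- The Pauli gate `X`. -/
noncomputable def xGate : Matrix.unitaryGroup Bool ℂ :=
  ⟨Matrix.of fun i j => if i = !j then 1 else 0, by
    rw [Matrix.mem_unitaryGroup_iff]
    ext i j
    cases i <;> cases j <;> simp [Matrix.mul_apply, Matrix.star_apply]⟩

/-- The Hadamard gate. -/
noncomputable def hGate : Matrix.unitaryGroup Bool ℂ :=
  ⟨Matrix.of fun i j => if i && j then -((√2 : ℝ) : ℂ)⁻¹ else ((√2 : ℝ) : ℂ)⁻¹, by
    have h : (((√2 : ℝ) : ℂ)⁻¹) * ((√2 : ℝ) : ℂ)⁻¹ = 1 / 2 := by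
      rw [← mul_inv, ← Complex.ofReal_mul, Real.mul_self_sqrt (by norm_num)]; norm_num
    rw [Matrix.mem_unitaryGroup_iff]
    ext i j
    cases i <;> cases j <;> simp [Matrix.mul_apply, Matrix.star_apply, Complex.conj_ofReal, h]
    all_goals norm_num⟩

/-- The rotation `|0⟩ ↦ c|0⟩ + s|1⟩`, `|1⟩ ↦ -s|0⟩ + c|1⟩`. -/
noncomputable def rotGate (c s : ℝ) (h : c ^ 2 + s ^ 2 = 1) : Matrix.unitaryGroup Bool ℂ :=
  ⟨Matrix.of fun i j => if i then (if j then (c : ℂ) else s) else (if j then -(s : ℂ) else c), by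
    have h' : (c : ℂ) * c + s * s = 1 := by
      have := congrArg Complex.ofReal h
      push_cast at this
      linear_combination this
    rw [Matrix.mem_unitaryGroup_iff]
    ext i j
    cases i <;> cases j <;>
      simp [Matrix.mul_apply, Matrix.star_apply, Complex.conj_ofReal] <;>
      first | ring1 | linear_combination h'⟩

/-- The phase gate `diag(1, ω)`. -/
noncomputable def phaseGate (ω : ℂ) (h : ‖ω‖ = 1) : Matrix.unitaryGroup Bool ℂ :=
  ⟨Matrix.diagonal fun i => if i then ω else 1, by
    have h' : ω * star ω = 1 := by
      rw [Complex.star_def, Complex.mul_conj, Complex.normSq_eq_norm_sq, h]; norm_num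
    rw [Matrix.mem_unitaryGroup_iff]
    ext i j
    cases i <;> cases j <;>
      simp [Matrix.mul_apply, Matrix.star_apply, Matrix.diagonal_apply]
    exact h'⟩

variable {Q : Type} [DecidableEq Q]

/-- Negations of the qubits of `S` on which the pattern `a` vanishes. -/
noncomputable def xLayer (S : Finset Q) (a : Q → Bool) : List (QACGate Q) :=
  S.toList.map fun q => .single q (if a q then 1 else xGate)

theorem runLayer_xLayer (S : Finset Q) (a : Q → Bool) (ψ : QVec Q) (z : Q → Bool) :
    runLayer (xLayer S a) ψ z = ψ fun q => if q ∈ S then z q == a q else z q := by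
  have key : ∀ (l : List Q), l.Nodup → ∀ z,
      runLayer (l.map fun q => .single q (if a q then 1 else xGate)) ψ z
        = ψ fun q => if q ∈ l then z q == a q else z q := by
    intro l
    induction l with
    | nil => intro _ z; simp
    | cons q l ih =>
      intro hl z
      rw [List.nodup_cons] at hl
      rw [List.map_cons, runLayer_cons, Module.End.mul_apply, QACGate.act_single]
      simp only [ih hl.2]
      have h1 : ∀ b, (fun r => if r ∈ l then update z q b r == a r else update z q b r)
          = update (fun r => if r ∈ q :: l then z r == a r else z r) q b := by
        intro b
        ext r
        by_cases hr : r = q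
        · subst hr; simp [hl.1]
        · simp [hr]
      simp only [h1]
      have h2 : (fun r => if r ∈ q :: l then z r == a r else z r)
          = update (fun r => if r ∈ q :: l then z r == a r else z r) q (z q == a q) :=
        (update_eq_self_iff.2 (by simp)).symm
      rw [h2]
      simp only [update_idem]
      generalize (fun r => if r ∈ q :: l then z r == a r else z r) = F
      cases a q <;> cases z q <;> simp [xGate]
  simpa [xLayer] using key S.toList S.nodup_toList z

theorem pairwise_disjoint_map_single {I : Type} (l : List I) (hl : l.Nodup) (q : I → Q)
    (hq : Injective q) (U : I → Matrix.unitaryGroup Bool ℂ) :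
    (l.map fun i => QACGate.single (q i) (U i)).Pairwise
      fun g h => Disjoint g.support h.support := by
  rw [List.pairwise_map]
  refine hl.imp ?_
  intro i j hij
  simpa [QACGate.support] using hq.ne hij

/-- The target `t` is flipped if the qubits of `S` carry the pattern `a`. -/
noncomputable def toffPat (S : Finset Q) (hS : S.Nonempty) (t : Q) (ht : t ∉ S) (a : Q → Bool) :
    Layers Q :=
  [xLayer S a, [.toffoli S hS t ht], xLayer S a]

theorem wf_toffPat (S : Finset Q) (hS : S.Nonempty) (t : Q) (ht : t ∉ S) (a : Q → Bool) :
    (toffPat S hS t ht a).WF := by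
  have := pairwise_disjoint_map_single S.toList S.nodup_toList id injective_id
    fun q => if a q then 1 else xGate
  simp [toffPat, Layers.WF]
  exact this

theorem run_toffPat (S : Finset Q) (hS : S.Nonempty) (t : Q) (ht : t ∉ S) (a : Q → Bool)
    (ψ : QVec Q) (z : Q → Bool) :
    run (toffPat S hS t ht a) ψ z
      = ψ (update z t (xor (z t) (decide (∀ s ∈ S, z s = a s)))) := by
  simp only [toffPat, run_cons, run_nil, one_mul, runLayer_cons, runLayer_nil, mul_one, Module.End.mul_apply,
    runLayer_xLayer, QACGate.act_toffoli, toffoliMap]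
  congr 1
  have h1 : (∀ s ∈ S, (if s ∈ S then z s == a s else z s) = true) ↔ ∀ s ∈ S, z s = a s :=
    forall₂_congr fun s hs => by simp [hs]
  simp only [h1]
  ext q
  by_cases hq : q = t
  · subst hq; simp [ht]
  · by_cases hqS : q ∈ S
    · simp only [update_of_ne hq, hqS, if_true]
      cases z q <;> cases a q <;> rfl
    · simp [update_of_ne hq, hqS]

/-- A sign on the basis states with pattern `a` on `S` and value `b` at `t`. -/
noncomputable def flipPat (S : Finset Q) (hS : S.Nonempty) (t : Q) (ht : t ∉ S) (a : Q → Bool)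
    (b : Bool) : Layers Q :=
  [[.single t (hGate * if b then 1 else xGate)]] ++ toffPat S hS t ht a ++
    [[.single t (hGate * if b then 1 else xGate)⁻¹]]

theorem wf_flipPat (S : Finset Q) (hS : S.Nonempty) (t : Q) (ht : t ∉ S) (a : Q → Bool)
    (b : Bool) : (flipPat S hS t ht a b).WF :=
  ((Layers.wf_singleton_singleton _).append (wf_toffPat S hS t ht a)).append
    (Layers.wf_singleton_singleton _)

theorem length_flipPat (S : Finset Q) (hS : S.Nonempty) (t : Q) (ht : t ∉ S) (a : Q → Bool)
    (b : Bool) : (flipPat S hS t ht a b).length = 5 := rfl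

/-- Phase kickback: a Hadamard gate on each side turns the controlled X on `t` into a controlled
sign on `t = 1`, and an extra X moves this sign to `t = 0`. -/
theorem run_flipPat (S : Finset Q) (hS : S.Nonempty) (t : Q) (ht : t ∉ S) (a : Q → Bool)
    (b : Bool) (ψ : QVec Q) (z : Q → Bool) :
    run (flipPat S hS t ht a b) ψ z
      = (if (∀ s ∈ S, z s = a s) ∧ z t = b then -1 else 1) * ψ z := by
  have h0 : ∀ c, (∀ s ∈ S, update z t c s = a s) ↔ ∀ s ∈ S, z s = a s := fun c =>
    forall₂_congr fun s hs => by rw [update_of_ne (by rintro rfl; exact ht hs)]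
  have h : (((√2 : ℝ) : ℂ)⁻¹) * ((√2 : ℝ) : ℂ)⁻¹ = 1 / 2 := by
    rw [← mul_inv, ← Complex.ofReal_mul, Real.mul_self_sqrt (by norm_num)]; norm_num
  have hz : z = update z t (z t) := by simp
  simp only [flipPat, run_append, run_cons, run_nil, one_mul, runLayer_cons, runLayer_nil, mul_one,
    Module.End.mul_apply, QACGate.act_single, run_toffPat, update_idem, update_self, h0]
  have hm : (if (∀ s ∈ S, z s = a s) ∧ z t = b then (-1 : ℂ) else 1)
      = if decide (∀ s ∈ S, z s = a s) && (z t == b) then -1 else 1 := by simp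
  rw [hm, show ψ z = ψ (update z t (z t)) by rw [← hz]]
  generalize decide (∀ s ∈ S, z s = a s) = m
  generalize hφ : (fun c => ψ (update z t c)) = φ
  have hφ' : ∀ c, ψ (update z t c) = φ c := fun c => by rw [← hφ]
  simp only [hφ']
  cases m <;> cases b <;> cases z t <;>
    simp [hGate, xGate, Matrix.mul_apply, Matrix.star_apply, Complex.conj_ofReal] <;>
    first | ring1 | linear_combination (2 * φ false) * h | linear_combination (2 * φ true) * h |
      linear_combination (-2 * φ false) * h | linear_combination (-2 * φ true) * h

theorem run_flipPat_of_iff (S : Finset Q) (hS : S.Nonempty) (t : Q) (ht : t ∉ S) (a : Q → Bool)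
    (b : Bool) (ψ : QVec Q) (z : Q → Bool) {p : Prop} [Decidable p]
    (hp : p ↔ (∀ s ∈ S, z s = a s) ∧ z t = b) :
    run (flipPat S hS t ht a b) ψ z = (if p then -1 else 1) * ψ z := by
  rw [run_flipPat]
  congr 1
  exact if_congr hp.symm rfl rfl

end Gates

theorem basis_comp_involutive {Q : Type} [Fintype Q] [DecidableEq Q] {π : (Q → Bool) → Q → Bool}
    (hπ : Involutive π) (w : Q → Bool) : (fun z => basis w (π z)) = basis (π w) := by
  funext z
  rw [basis_apply, basis_apply]
  exact if_congr hπ.eq_iff rfl rfl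

theorem run_toffPat_basis {Q : Type} [Fintype Q] [DecidableEq Q] (S : Finset Q) (hS : S.Nonempty)
    (t : Q) (ht : t ∉ S) (a : Q → Bool) (w : Q → Bool) {b : Bool}
    (hb : b = true ↔ ∀ s ∈ S, w s = a s) :
    run (toffPat S hS t ht a) (basis w) = basis (update w t (xor (w t) b)) := by
  obtain rfl : b = decide (∀ s ∈ S, w s = a s) := Bool.eq_iff_iff.2 (by simpa using hb)
  rw [← basis_comp_involutive (π := fun z => update z t (xor (z t) (decide (∀ s ∈ S, z s = a s))))]
  · funext z
    rw [run_toffPat]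
    congr!
  · intro z
    have h0 : ∀ c, (∀ s ∈ S, update z t c s = a s) ↔ ∀ s ∈ S, z s = a s := fun c =>
      forall₂_congr fun s hs => by rw [update_of_ne (by rintro rfl; exact ht hs)]
    simp [h0]

theorem act_xGate_basis {Q : Type} [Fintype Q] [DecidableEq Q] (q : Q) (w : Q → Bool) :
    (QACGate.single q xGate).act (basis w) = basis (update w q (!w q)) := by
  rw [← basis_comp_involutive (π := fun z => update z q (!z q))]
  · funext z
    rw [QACGate.act_single]
    cases hz : z q <;> simp [xGate]
  · intro z
    simp

theorem run_symm_basis {Q : Type} [DecidableEq Q] {C : Layers Q} {a b : Q → Bool}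
    (h : run C (basis a) = basis b) : run C.symm (basis b) = basis a := by
  rw [← h, run_symm_run]

/-! ### Exact computation with clean ancillas, and its closure properties. -/

/-- The basis state with inputs `x`, outputs `y` and ancillas in the state zero. -/
def regState {ι κ A : Type} (x : ι → Bool) (y : κ → Bool) : ι ⊕ κ ⊕ A → Bool :=
  Sum.elim x (Sum.elim y fun _ => false)

/-- There is a circuit of depth at most `d` with at most `s` ancillas that computes `g x` in its
output register for all `x ∈ D`, restoring the inputs and the ancillas. -/
def QCompOn {ι κ : Type} [DecidableEq ι] [DecidableEq κ] (D : Set (ι → Bool)) (d s : ℕ)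
    (g : (ι → Bool) → κ → Bool) : Prop :=
  ∃ (A : Type) (_ : Fintype A) (_ : DecidableEq A) (C : Layers (ι ⊕ κ ⊕ A)),
    C.WF ∧ C.length ≤ d ∧ Fintype.card A ≤ s ∧
      ∀ x ∈ D, run C (basis (regState x fun _ => false)) = basis (regState x (g x))

/-- `QCompOn` for all inputs. -/
abbrev QComp {ι κ : Type} [DecidableEq ι] [DecidableEq κ] (d s : ℕ)
    (g : (ι → Bool) → κ → Bool) : Prop :=
  QCompOn Set.univ d s g

theorem QCompOn.mono {ι κ : Type} [DecidableEq ι] [DecidableEq κ] {D : Set (ι → Bool)}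
    {d d' s s' : ℕ} {g : (ι → Bool) → κ → Bool} (h : QCompOn D d s g) (hd : d ≤ d')
    (hs : s ≤ s') : QCompOn D d' s' g := by
  obtain ⟨A, _, _, C, hW, hl, hA, hC⟩ := h
  exact ⟨A, _, _, C, hW, hl.trans hd, hA.trans hs, hC⟩

theorem QCompOn.reindex {ι κ ι' κ' : Type} [DecidableEq ι] [DecidableEq κ] [DecidableEq ι']
    [DecidableEq κ'] {D : Set (ι → Bool)} {d s : ℕ} {g : (ι → Bool) → κ → Bool}
    (h : QCompOn D d s g) (eι : ι ↪ ι') (eκ : κ ≃ κ') {D' : Set (ι' → Bool)}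
    {g' : (ι' → Bool) → κ' → Bool} (hD : ∀ x ∈ D', x ∘ eι ∈ D)
    (hg : ∀ x ∈ D', ∀ k, g' x (eκ k) = g (x ∘ eι) k) : QCompOn D' d s g' := by
  obtain ⟨A, _, _, C, hW, hl, hA, hC⟩ := h
  let e : ι ⊕ κ ⊕ A ↪ ι' ⊕ κ' ⊕ A :=
    eι.sumMap (eκ.toEmbedding.sumMap (Embedding.refl A))
  refine ⟨A, _, _, C.embed e, hW.embed e, by simpa using hl, hA, fun x hx => ?_⟩
  refine run_embed_basis (hC _ (hD x hx)) ?_ ?_ ?_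
  · rintro (i | k | a) <;> simp [e, regState]
  · rintro (i | k | a) <;> simp [e, regState, hg x hx]
  · rintro (i | k | a) hq
    · rfl
    · exact absurd (by simp [e]) (hq (Sum.inr (Sum.inl (eκ.symm k))))
    · rfl

/-- Compute, use, uncompute: the value of `g` lives in ancillas, which the inverse circuit clears.
This costs the depth of `g` twice, and the output of `g` counts among the ancillas. -/
theorem QCompOn.comp {ι κ μ : Type} [DecidableEq ι] [DecidableEq κ] [DecidableEq μ] [Fintype κ]
    {D : Set (ι → Bool)} {D' : Set (κ → Bool)} {d d' s s' : ℕ} {g : (ι → Bool) → κ → Bool}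
    {h : (κ → Bool) → μ → Bool} (hh : QCompOn D' d' s' h) (hg : QCompOn D d s g)
    (hD : ∀ x ∈ D, g x ∈ D') :
    QCompOn D (2 * d + d') (Fintype.card κ + s + s') fun x => h (g x) := by
  obtain ⟨A, _, _, C, hW, hl, hA, hC⟩ := hg
  obtain ⟨A', _, _, C', hW', hl', hA', hC'⟩ := hh
  let e : ι ⊕ κ ⊕ A ↪ ι ⊕ μ ⊕ (κ ⊕ A ⊕ A') :=
    ⟨Sum.elim Sum.inl (Sum.elim (fun k => .inr (.inr (.inl k))) fun a => .inr (.inr (.inr (.inl a)))),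
      by rintro (i | k | a) (i' | k' | a') <;> simp⟩
  let e' : κ ⊕ μ ⊕ A' ↪ ι ⊕ μ ⊕ (κ ⊕ A ⊕ A') :=
    ⟨Sum.elim (fun k => .inr (.inr (.inl k)))
      (Sum.elim (fun m => .inr (.inl m)) fun a => .inr (.inr (.inr (.inr a)))),
      by rintro (i | k | a) (i' | k' | a') <;> simp⟩
  refine ⟨κ ⊕ A ⊕ A', inferInstance, inferInstance,
    C.embed e ++ C'.embed e' ++ C.symm.embed e,
    ((hW.embed e).append (hW'.embed e')).append (hW.symm.embed e), ?_, ?_, fun x hx => ?_⟩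
  · simp; omega
  · simp; omega
  · let z₁ : ι ⊕ μ ⊕ (κ ⊕ A ⊕ A') → Bool :=
      Sum.elim x (Sum.elim (fun _ => false) (Sum.elim (g x) fun _ => false))
    let z₂ : ι ⊕ μ ⊕ (κ ⊕ A ⊕ A') → Bool :=
      Sum.elim x (Sum.elim (h (g x)) (Sum.elim (g x) fun _ => false))
    have h₁ : run (C.embed e) (basis (regState x fun _ => false)) = basis z₁ := by
      refine run_embed_basis (hC x hx) ?_ ?_ ?_
      · rintro (i | k | a) <;> rfl
      · rintro (i | k | a) <;> rfl
      · rintro (i | m | k | a | a) hq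
        · rfl
        · rfl
        · exact absurd rfl (hq (.inr (.inl k)))
        · rfl
        · rfl
    have h₂ : run (C'.embed e') (basis z₁) = basis z₂ := by
      refine run_embed_basis (hC' _ (hD x hx)) ?_ ?_ ?_
      · rintro (i | k | a) <;> rfl
      · rintro (i | k | a) <;> rfl
      · rintro (i | m | k | a | a) hq
        · rfl
        · exact absurd rfl (hq (.inr (.inl m)))
        · rfl
        · rfl
        · rfl
    have h₃ : run (C.symm.embed e) (basis z₂) = basis (regState x (h (g x))) := by
      refine run_embed_basis (run_symm_basis (hC x hx)) ?_ ?_ ?_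
      · rintro (i | k | a) <;> rfl
      · rintro (i | k | a) <;> rfl
      · rintro (i | m | k | a | a) hq
        · rfl
        · rfl
        · exact absurd rfl (hq (.inr (.inl k)))
        · rfl
        · rfl
    rw [run_append, run_append, Module.End.mul_apply, Module.End.mul_apply, h₁, h₂, h₃]

theorem QComp.comp {ι κ μ : Type} [DecidableEq ι] [DecidableEq κ] [DecidableEq μ] [Fintype κ]
    {d d' s s' : ℕ} {g : (ι → Bool) → κ → Bool}
    {h : (κ → Bool) → μ → Bool} (hh : QComp d' s' h) (hg : QComp d s g) :
    QComp (2 * d + d') (Fintype.card κ + s + s') fun x => h (g x) :=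
  QCompOn.comp hh hg fun _ _ => Set.mem_univ _

theorem QComp.reindex {ι κ ι' κ' : Type} [DecidableEq ι] [DecidableEq κ] [DecidableEq ι']
    [DecidableEq κ'] {d s : ℕ} {g : (ι → Bool) → κ → Bool}
    (h : QComp d s g) (eι : ι ↪ ι') (eκ : κ ≃ κ')
    {g' : (ι' → Bool) → κ' → Bool} (hg : ∀ x k, g' x (eκ k) = g (x ∘ eι) k) : QComp d s g' :=
  QCompOn.reindex h eι eκ (fun _ _ => Set.mem_univ _) fun x _ => hg x

/-- Circuits on disjoint registers, run in parallel. -/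
theorem QComp.sigma {I : Type} [Fintype I] [DecidableEq I] {ι κ : I → Type}
    [∀ i, DecidableEq (ι i)] [∀ i, DecidableEq (κ i)] {d s : ℕ}
    {g : ∀ i, (ι i → Bool) → κ i → Bool} (h : ∀ i, QComp d s (g i)) :
    QComp d (Fintype.card I * s)
      fun (x : (Σ i, ι i) → Bool) (k : Σ i, κ i) => g k.1 (fun j => x ⟨k.1, j⟩) k.2 := by
  choose A hF hE C hW hl hA hC using h
  let e : ∀ i, ι i ⊕ κ i ⊕ A i ↪ (Σ i, ι i) ⊕ (Σ i, κ i) ⊕ (Σ i, A i) := fun i =>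
    (Embedding.sigmaMk i).sumMap ((Embedding.sigmaMk i).sumMap (Embedding.sigmaMk i))
  have hd : ∀ i j, i ≠ j → ∀ a b, e i a ≠ e j b := by
    rintro i j hij (a | a | a) (b | b | b) <;> simp [e, hij]
  refine ⟨Σ i, A i, inferInstance, inferInstance, Layers.par e C, Layers.WF.par hd hW,
    Layers.length_par_le e hl, ?_, fun x _ => ?_⟩
  · rw [Fintype.card_sigma]
    exact (Finset.sum_le_card_nsmul _ _ s fun i _ => hA i).trans_eq (by simp)
  · refine run_par_basis hd (fun i => hC i (fun j => x ⟨i, j⟩) (Set.mem_univ _)) ?_ ?_ ?_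
    · rintro i (a | a | a) <;> rfl
    · rintro i (a | a | a) <;> rfl
    · rintro (⟨i, a⟩ | ⟨i, a⟩ | ⟨i, a⟩) hq
      · rfl
      · exact absurd rfl (hq i (.inr (.inl a)))
      · rfl

/-- The single-output test whether the qubits carry the pattern `a`, negated if `c`. -/
theorem QComp.pattern {ι : Type} [Fintype ι] [DecidableEq ι] (a : ι → Bool) (c : Bool) :
    QComp 4 0 fun (x : ι → Bool) (_ : Unit) => xor c (decide (∀ i, x i = a i)) := by
  let t : ι ⊕ Unit ⊕ Empty := .inr (.inl ())
  have hX : ∀ w : ι ⊕ Unit ⊕ Empty → Bool,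
      run [[QACGate.single t (if c then xGate else 1)]] (basis w)
        = basis (update w t (xor c (w t))) := by
    intro w
    cases c
    · simp [QACGate.act_single_one]
    · simp [act_xGate_basis]
  have hX' : ∀ w : ι ⊕ Unit ⊕ Empty → Bool,
      run [[QACGate.single t xGate]] (basis w) = basis (update w t (!w t)) := by
    intro w
    simp [act_xGate_basis]
  rcases isEmpty_or_nonempty ι with hι | hι
  · refine ⟨Empty, inferInstance, inferInstance, [[QACGate.single t xGate]] ++
      [[QACGate.single t (if c then xGate else 1)]],
      (Layers.wf_singleton_singleton _).append (Layers.wf_singleton_singleton _), by simp, by simp,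
      fun x _ => ?_⟩
    rw [run_append, Module.End.mul_apply, hX', hX]
    congr 1
    funext q
    rcases q with i | i | i
    · exact hι.elim i
    · change update _ t _ t = _
      rw [update_self, update_self]
      simp [t, regState]
    · exact i.elim
  · have hS : (Finset.univ.map Embedding.inl : Finset (ι ⊕ Unit ⊕ Empty)).Nonempty := by
      simp
    have ht : t ∉ (Finset.univ.map Embedding.inl : Finset (ι ⊕ Unit ⊕ Empty)) := by
      simp [t]
    refine ⟨Empty, inferInstance, inferInstance, toffPat _ hS t ht (Sum.elim a fun _ => false) ++
      [[QACGate.single t (if c then xGate else 1)]],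
      (wf_toffPat _ _ _ _ _).append (Layers.wf_singleton_singleton _), by simp [toffPat], by simp,
      fun x _ => ?_⟩
    rw [run_append, Module.End.mul_apply,
      run_toffPat_basis _ hS t ht _ _ (b := decide (∀ i, x i = a i)) (by simp [regState]), hX]
    congr 1
    funext q
    rcases q with i | i | i
    · rw [update_of_ne (by simp [t]), update_of_ne (by simp [t])]; rfl
    · change update _ t _ t = _
      rw [update_self, update_self]
      simp [t, regState]
    · exact i.elim

theorem QComp.and {ι : Type} [Fintype ι] [DecidableEq ι] :
    QComp 4 0 fun (x : ι → Bool) (_ : Unit) => decide (∀ i, x i = true) := by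
  simpa using QComp.pattern (fun _ : ι => true) false

theorem QComp.or {ι : Type} [Fintype ι] [DecidableEq ι] :
    QComp 4 0 fun (x : ι → Bool) (_ : Unit) => decide (∃ i, x i = true) := by
  have h := QComp.pattern (fun _ : ι => false) true
  convert h using 3
  rw [Bool.eq_iff_iff]
  simp

/-- Selecting some of the input bits. -/
theorem QComp.proj {ι κ : Type} [DecidableEq ι] [Fintype κ] [DecidableEq κ] (f : κ ↪ ι) :
    QComp 4 0 fun (x : ι → Bool) k => x (f k) := by
  -- The conjunction of a single bit is a copy of it; as `f` is injective, no input is copied twice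
  -- and no fan-out is needed.
  have h := QComp.sigma (I := κ) (ι := fun _ => Unit) (κ := fun _ => Unit)
    (fun _ => QComp.and (ι := Unit))
  rw [mul_zero] at h
  refine h.reindex ⟨fun k => f k.1, fun k l hkl => by
    rcases k with ⟨k, ⟨⟩⟩; rcases l with ⟨l, ⟨⟩⟩; simpa using hkl⟩ (Equiv.sigmaUnique κ _) ?_
  rintro x ⟨k, ⟨⟩⟩
  change x (f k) = decide (∀ i : Unit, x (f k) = true)
  simp

/-- Several functions of the same input, given circuits that copy the input bits. -/
theorem QComp.fork {J ι : Type} [Fintype J] [DecidableEq J] [Fintype ι] [DecidableEq ι]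
    {κ : J → Type} [∀ j, DecidableEq (κ j)] {dc sc d s : ℕ}
    (hc : QComp dc sc fun (b : Unit → Bool) (_ : J) => b ())
    {g : ∀ j, (ι → Bool) → κ j → Bool} (h : ∀ j, QComp d s (g j)) :
    QComp (2 * dc + d)
      (Fintype.card ι * Fintype.card J + Fintype.card ι * sc + Fintype.card J * s)
      fun x (k : Σ j, κ j) => g k.1 x k.2 := by
  have h1 : QComp dc (Fintype.card ι * sc)
      fun (x : ι → Bool) (k : Σ _ : ι, J) => x k.1 := by
    refine (QComp.sigma (I := ι) (fun _ => hc)).reindex (Equiv.sigmaUnique ι fun _ => Unit).toEmbedding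
      (Equiv.refl _) ?_
    intro x k
    rfl
  have h2 : QComp d (Fintype.card J * s) fun (y : (Σ _ : ι, J) → Bool) (k : Σ j, κ j) =>
      g k.1 (fun i => y ⟨i, k.1⟩) k.2 := by
    refine (QComp.sigma (I := J) h).reindex
      ⟨fun k : Σ _ : J, ι => (⟨k.2, k.1⟩ : Σ _ : ι, J), ?_⟩ (Equiv.refl _) ?_
    · rintro ⟨j, i⟩ ⟨j', i'⟩
      simp +contextual
    · intro x k
      rfl
  refine (QComp.comp h2 h1).mono le_rfl (le_of_eq ?_)
  simp

theorem eq_of_agreeOn_ne_zero {Q : Type} {P : Q → Prop} {w z : Q → Bool} (h : agreeOn P w z ≠ 0) :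
    ∀ q, P q → z q = w q := by
  by_contra hc
  exact h (if_neg hc)

theorem agreeOn_extend {A Q : Type} (e : A ↪ Q) {P : Q → Prop} (hP : ∀ q, P q → ∀ r, e r ≠ q)
    (w z : Q → Bool) (a : A → Bool) : agreeOn P w (extend e a z) = agreeOn P w z := by
  classical
  unfold agreeOn
  refine if_congr (forall₂_congr fun q hq => ?_) rfl rfl
  rw [extend_apply' _ _ _ (by simpa using hP q hq)]

theorem agreeOn_mul_basis {A Q : Type} [DecidableEq A] [DecidableEq Q] [Fintype A] [Fintype Q]
    (e : A ↪ Q) {w z : Q → Bool} (hw : ∀ q, (∀ r, e r ≠ q) → z q = w q) (y : Q → Bool) :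
    agreeOn (fun q => ∀ r, e r ≠ q) z y * basis (w ∘ e) (y ∘ e) = basis w y := by
  rw [basis_apply, basis_apply, agreeOn]
  by_cases hy : y = w
  · subst hy
    rw [if_pos rfl, if_pos rfl, if_pos fun q hq => (hw q hq).symm, one_mul]
  · rw [if_neg hy]
    by_cases h1 : ∀ q, (∀ r, e r ≠ q) → y q = z q
    · rw [if_pos h1, if_neg, mul_zero]
      intro h2
      apply hy
      ext q
      by_cases hq : ∃ r, e r = q
      · obtain ⟨r, rfl⟩ := hq
        exact congrFun h2 r
      · push Not at hq
        rw [h1 q hq, hw q hq]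
    · rw [if_neg h1, zero_mul]

theorem runLayer_phase {I Q : Type} [Fintype I] [DecidableEq Q] (q : I → Q) (ω : I → ℂ)
    (hω : ∀ i, ‖ω i‖ = 1) (ψ : QVec Q) :
    runLayer (Finset.univ.toList.map fun i => QACGate.single (q i) (phaseGate (ω i) (hω i))) ψ
      = fun z => (∏ i, if z (q i) then ω i else 1) * ψ z := by
  have hact : ∀ i (ψ : QVec Q), (QACGate.single (q i) (phaseGate (ω i) (hω i))).act ψ
      = fun z => (if z (q i) then ω i else 1) * ψ z := by
    intro i ψ
    funext z
    rw [QACGate.act_single]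
    have : update z (q i) (z (q i)) = z := by simp
    cases hz : z (q i) <;> rw [hz] at this <;> simp [phaseGate, this]
  have key : ∀ l : List I,
      runLayer (l.map fun i => QACGate.single (q i) (phaseGate (ω i) (hω i))) ψ
      = fun z => (l.map fun i => if z (q i) then ω i else 1).prod * ψ z := by
    intro l
    induction l with
    | nil => simp
    | cons i l ih =>
      rw [List.map_cons, runLayer_cons, Module.End.mul_apply, ih, hact]
      funext z
      simp only [List.map_cons, List.prod_cons, mul_assoc]
  rw [key]
  funext z
  rw [Finset.prod_map_toList]

theorem mul_basis {Q : Type} [DecidableEq Q] [Fintype Q] (c : QVec Q) (y : Q → Bool) :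
    (fun z => c z * basis y z) = c y • basis y := by
  funext z
  rw [Pi.smul_apply, smul_eq_mul, basis_apply]
  split_ifs with h
  · rw [h]
  · simp

/-! ### The exact phase test. -/

section PhaseTest

variable {I A : Type} [Fintype I] [DecidableEq I] [Fintype A] [DecidableEq A]

/-- The phase of a basis state with targets `t`, controlled by `x`. -/
noncomputable def ctrlPhase (ω φ : I → ℂ) (x t : I → Bool) : ℂ :=
  (∏ i, if x i && t i then ω i else 1) * ∏ i, if t i then φ i else 1

theorem QComp.pairwiseAnd :
    QComp 4 0 fun (x : I ⊕ I → Bool) (i : I) => x (.inl i) && x (.inr i) := by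
  have h := QComp.sigma (I := I) (fun _ => QComp.and (ι := Bool))
  rw [mul_zero] at h
  refine h.reindex ⟨fun k => if k.2 then .inl k.1 else .inr k.1, ?_⟩ (Equiv.sigmaUnique I _) ?_
  · rintro ⟨i, b⟩ ⟨j, c⟩
    cases b <;> cases c <;> simp
  · rintro x ⟨i, ⟨⟩⟩
    refine Bool.eq_iff_iff.2 (Iff.trans ?_ (@decide_eq_true_iff _ (_)).symm)
    change (x (.inl i) && x (.inr i)) = true ↔
      ∀ b : Bool, x (if b = true then .inl i else .inr i) = true
    simp only [Bool.forall_bool, Bool.and_eq_true, if_true, Bool.false_eq_true, if_false]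
    exact and_comm

/-- The register of the phase test: controls, output, the register of the prepared state, and
scratch qubits. -/
abbrev PhaseReg (I A B : Type) : Type := I ⊕ Unit ⊕ ((I ⊕ A) ⊕ I ⊕ B)

/-- If the weighted phases are all one, or average to zero, then this can be tested exactly. -/
theorem QCompOn.phaseTest [Nonempty I] (C : Layers (I ⊕ A)) (hW : C.WF) (ω φ : I → ℂ)
    (hω : ∀ i, ‖ω i‖ = 1) (hφ : ∀ i, ‖φ i‖ = 1) (D : Set (I → Bool)) (g : (I → Bool) → Bool)
    (h1 : ∀ x ∈ D, g x = true → ∀ z, run C (basis fun _ => false) z ≠ 0 →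
      ctrlPhase ω φ x (fun i => z (.inl i)) = 1)
    (h0 : ∀ x ∈ D, g x = false →
      ∑ z, (‖run C (basis fun _ => false) z‖ ^ 2 : ℝ) *
        ctrlPhase ω φ x (fun i => z (.inl i)) = 0) :
    QCompOn D (4 * C.length + 23) (2 * Fintype.card I + Fintype.card A)
      fun x (_ : Unit) => g x := by
  obtain ⟨B, _, _, T, hTW, hTl, hB, hT⟩ := QComp.pairwiseAnd (I := I)
  let eR : I ⊕ A ↪ PhaseReg I A B := ⟨fun r => .inr (.inr (.inl r)), fun r r' => by simp⟩
  have heR : ∀ r, eR r = .inr (.inr (.inl r)) := fun _ => rfl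
  let eT : (I ⊕ I) ⊕ I ⊕ B ↪ PhaseReg I A B :=
    ⟨Sum.elim (Sum.elim .inl fun i => .inr (.inr (.inl (.inl i)))) fun r => .inr (.inr (.inr r)),
      by rintro ((i | i) | i | b) ((i' | i') | i' | b') <;> simp⟩
  let out : PhaseReg I A B := .inr (.inl ())
  let P : List (QACGate (PhaseReg I A B)) := Finset.univ.toList.map
    fun i => QACGate.single (.inr (.inr (.inr (.inl i)))) (phaseGate (ω i) (hω i))
  let P' : List (QACGate (PhaseReg I A B)) := Finset.univ.toList.map
    fun i => QACGate.single (.inr (.inr (.inl (.inl i)))) (phaseGate (φ i) (hφ i))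
  -- Prepare the state, apply the phases, unprepare. `T` writes the conjunctions of controls and
  -- targets into scratch qubits, so that the single-qubit phases `P` act as controlled phases, and
  -- is then undone.
  let V : Layers (PhaseReg I A B) := C.embed eR ++ (T.embed eT ++ [P] ++ [P'] ++ T.symm.embed eT) ++
    C.symm.embed eR
  have hS : (Finset.univ.map eR).Nonempty := by simp
  have hout : out ∉ Finset.univ.map eR := by simp [out, heR]
  -- The output is flipped exactly when the prepared register has returned to zero.
  let N : Layers (PhaseReg I A B) := toffPat (Finset.univ.map eR) hS out hout fun _ => false
  have hPW : ∀ (q : I → PhaseReg I A B), Injective q → ∀ (U : I → Matrix.unitaryGroup Bool ℂ),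
      Layers.WF [Finset.univ.toList.map fun i => QACGate.single (q i) (U i)] := by
    intro q hq U
    rw [Layers.wf_cons]
    exact ⟨pairwise_disjoint_map_single _ (Finset.nodup_toList _) q hq U, Layers.WF.nil⟩
  have hVW : V.WF := ((hW.embed eR).append ((((hTW.embed eT).append
    (hPW _ (fun i j => by simp) _)).append (hPW _ (fun i j => by simp) _)).append
      (hTW.symm.embed eT))).append (hW.symm.embed eR)
  let ref : (I → Bool) → Bool → PhaseReg I A B → Bool := fun x b => regState x fun _ => b
  let ext : (I → Bool) → Bool → QVec (I ⊕ A) → QVec (PhaseReg I A B) := fun x b χ z =>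
    agreeOn (fun q => ∀ r, eR r ≠ q) (ref x b) z * χ (z ∘ eR)
  have hext : ∀ x b (E : Layers (I ⊕ A)) χ, run (E.embed eR) (ext x b χ) = ext x b (run E χ) :=
    fun x b E χ => run_embed_mul eR E _ χ fun z a => agreeOn_extend eR (fun _ h => h) _ _ _
  have hext0 : ∀ x b, ext x b (basis fun _ => false) = basis (ref x b) := by
    intro x b
    funext y
    exact agreeOn_mul_basis eR (w := ref x b) (fun _ _ => rfl) y
  have hsupp : ∀ x b χ z, ext x b χ z ≠ 0 →
      z = Sum.elim x (Sum.elim (fun _ => b) (Sum.elim (z ∘ eR) fun _ => false)) ∧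
        χ (z ∘ eR) ≠ 0 := by
    intro x b χ z hz
    refine ⟨?_, right_ne_zero_of_mul hz⟩
    have h := eq_of_agreeOn_ne_zero (left_ne_zero_of_mul hz)
    funext q
    rcases q with i | u | r | w
    · exact h (.inl i) (by simp [heR])
    · exact h (.inr (.inl u)) (by simp [heR])
    · rfl
    · exact h (.inr (.inr (.inr w))) (by simp [heR])
  have hDiag : ∀ x b χ, run (T.embed eT ++ [P] ++ [P'] ++ T.symm.embed eT) (ext x b χ)
      = ext x b (fun r => ctrlPhase ω φ x (fun i => r (.inl i)) * χ r) := by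
    intro x b χ
    -- With clean scratch qubits the middle part maps each basis state to a multiple of itself, so
    -- it suffices to follow basis states.
    rw [apply_eq_mul_of_basis _ (fun z => ctrlPhase ω φ x fun i => z (eR (.inl i)))]
    · funext z
      simp only [ext, comp_apply]
      ring
    · intro z hz
      obtain ⟨hz, -⟩ := hsupp x b χ z hz
      let z' : PhaseReg I A B → Bool := Sum.elim x (Sum.elim (fun _ => b) (Sum.elim (z ∘ eR)
        (Sum.elim (fun i => x i && z (eR (.inl i))) fun _ => false)))
      have hTz : run (T.embed eT) (basis z) = basis z' := by
        refine run_embed_basis (hT (Sum.elim x fun i => z (eR (.inl i))) (Set.mem_univ _)) ?_ ?_ ?_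
        · rintro ((i | i) | i | i) <;> rw [hz] <;> rfl
        · rintro ((i | i) | i | i) <;> rfl
        · rintro (i | u | (r | r) | i | i) hq
          · rw [hz]; rfl
          · rw [hz]; rfl
          · rfl
          · rfl
          · exact absurd rfl (hq (.inr (.inl i)))
          · exact absurd rfl (hq (.inr (.inr i)))
      have hTz' : run (T.symm.embed eT) (basis z') = basis z := by
        refine run_embed_basis (run_symm_basis
          (hT (Sum.elim x fun i => z (eR (.inl i))) (Set.mem_univ _))) ?_ ?_ ?_
        · rintro ((i | i) | i | i) <;> rfl
        · rintro ((i | i) | i | i) <;> rw [hz] <;> rfl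
        · rintro (i | u | (r | r) | i | i) hq
          · rw [hz]; rfl
          · rw [hz]; rfl
          · rfl
          · rfl
          · exact absurd rfl (hq (.inr (.inl i)))
          · exact absurd rfl (hq (.inr (.inr i)))
      simp only [run_append, Module.End.mul_apply, hTz, run_cons, run_nil, one_mul]
      rw [runLayer_phase _ ω hω, mul_basis, map_smul, runLayer_phase _ φ hφ, mul_basis, map_smul,
        map_smul, hTz', smul_smul]
      rfl
  have hV : ∀ x b χ, run V (ext x b χ) = ext x b (run C.symm
      (fun r => ctrlPhase ω φ x (fun i => r (.inl i)) * run C χ r)) := by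
    intro x b χ
    rw [← hext, ← hDiag, ← hext]
    simp only [V, run_append, Module.End.mul_apply]
  refine ⟨(I ⊕ A) ⊕ I ⊕ B, inferInstance, inferInstance, V ++ N ++ V.symm,
    (hVW.append (wf_toffPat _ _ _ _ _)).append hVW.symm, ?_, ?_, fun x hx => ?_⟩
  -- `V` has depth at most 2|C| + (4 + 1 + 1 + 4); it occurs twice, around the 3 layers of `N`.
  · simp [V, N, toffPat]; omega
  · simp; omega
  have hstart : (regState x fun _ => false : PhaseReg I A B → Bool) = ref x false := rfl
  rw [run_append, run_append, Module.End.mul_apply, Module.End.mul_apply, hstart]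
  cases hg : g x
  · rw [← hext0, hV]
    set χ := run C.symm (fun r => ctrlPhase ω φ x (fun i => r (.inl i)) *
      run C (basis fun _ => false) r) with hχ
    -- The amplitude of returning to zero is the average of the phases, which vanishes by `h0`. Thus
    -- `N` does nothing, and the inverse of `V` undoes `V`.
    have hχ0 : χ (fun _ => false) = 0 := by
      rw [← qinner_basis_left (fun _ => false) χ, hχ, ← qinner_run, qinner, ← h0 x hx hg]
      refine Finset.sum_congr rfl fun z _ => ?_
      rw [← Complex.normSq_eq_norm_sq, ← Complex.mul_conj, Complex.star_def]
      ring
    have hN : run N (ext x false χ) = ext x false χ := by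
      rw [apply_eq_mul_of_basis _ fun _ => 1]
      · simp
      · intro z hz
        obtain ⟨-, hz⟩ := hsupp x false χ z hz
        rw [run_toffPat_basis _ hS out hout _ z (b := false), one_smul]
        · simp
        · refine iff_of_false (by simp) fun h => ?_
          apply hz
          rw [← hχ0]
          congr 1
          funext r
          exact h _ (by simp)
    rw [hN, hχ, ← hV, hext0, run_symm_run]
    congr 1
    funext q
    rcases q with i | u | r | w <;> simp [ref, regState, hg]
  -- All phases on the support are one, so `V` fixes the state, whatever the output qubit is.
  · have hVb : ∀ b, run V (basis (ref x b)) = basis (ref x b) := by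
      intro b
      rw [← hext0, hV]
      have : (fun r => ctrlPhase ω φ x (fun i => r (.inl i)) * run C (basis fun _ => false) r)
          = run C (basis fun _ => false) := by
        funext r
        by_cases hr : run C (basis fun _ => false) r = 0
        · rw [hr, mul_zero]
        · rw [h1 x hx hg r hr, one_mul]
      rw [this, run_symm_run]
    have hall : ∀ s ∈ Finset.univ.map eR, ref x false s = false := by
      intro s hs
      rw [Finset.mem_map] at hs
      obtain ⟨r, -, rfl⟩ := hs
      rfl
    rw [hVb, run_toffPat_basis _ hS out hout _ _ (b := true) (iff_of_true rfl hall)]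
    · have : update (ref x false) out (xor (ref x false out) true) = ref x true := by
        funext q
        rcases q with i | u | r | w
        · rw [update_of_ne (by simp [out])]; rfl
        · change update _ out _ out = _
          rw [update_self]; rfl
        · rw [update_of_ne (by simp [out])]; rfl
        · rw [update_of_ne (by simp [out])]; rfl
      rw [this, run_symm_basis (hVb true)]
      congr 1
      funext q
      rcases q with i | u | r | w <;> simp [ref, regState, hg]

end PhaseTest

/-! ### Parity and fan-out from a nekomata. -/

section Parity

variable {I : Type} [Fintype I] [DecidableEq I]

/-- The number of ones. -/
def popcount (x : I → Bool) : ℕ := (Finset.univ.filter fun i => x i = true).card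

/-- The targets `I` of a state prepared by a circuit are all zero or all one, with probability `1/2`
each. -/
def HasNekomata (I : Type) [Fintype I] [DecidableEq I] (d s : ℕ) : Prop :=
  ∃ (A : Type) (_ : Fintype A) (_ : DecidableEq A) (C : Layers (I ⊕ A)),
    C.WF ∧ C.length ≤ d ∧ Fintype.card A ≤ s ∧
    (∀ z, run C (basis fun _ => false) z ≠ 0 →
      (∀ i, z (.inl i) = false) ∨ ∀ i, z (.inl i) = true) ∧
    ∑ z, (if ∀ i, z (.inl i) = false then ‖run C (basis fun _ => false) z‖ ^ 2 else 0) = 1 / 2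

theorem HasNekomata.mono {d d' s s' : ℕ} (h : HasNekomata I d s) (hd : d ≤ d') (hs : s ≤ s') :
    HasNekomata I d' s' := by
  obtain ⟨A, _, _, C, hW, hl, hA, hC⟩ := h
  exact ⟨A, _, _, C, hW, hl.trans hd, hA.trans hs, hC⟩

theorem prod_ite_popcount (x : I → Bool) :
    ∏ i, (if x i then (-1 : ℂ) else 1) = (-1) ^ popcount x := by
  rw [Finset.prod_ite, Finset.prod_const_one, mul_one, Finset.prod_const, popcount]

/-- The all-zero branch has phase 1 and the all-one branch phase -(-1)^|x|; the extra sign sits on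
the single target `i₀`. For odd |x| both phases are 1, and for even |x| they cancel because both
branches have probability 1/2. -/
theorem QComp.parity [Nonempty I] {d s : ℕ} (h : HasNekomata I d s) :
    QComp (4 * d + 23) (2 * Fintype.card I + s)
      fun (x : I → Bool) (_ : Unit) => decide (Odd (popcount x)) := by
  obtain ⟨A, _, _, C, hW, hl, hA, hC, hC2⟩ := h
  obtain ⟨i₀⟩ := ‹Nonempty I›
  have ht0 : ∀ x, ctrlPhase (fun _ => -1) (fun i => if i = i₀ then -1 else 1) x
      (fun _ : I => false) = 1 := fun x => by simp [ctrlPhase]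
  have ht1 : ∀ x, ctrlPhase (fun _ => -1) (fun i => if i = i₀ then -1 else 1) x
      (fun _ : I => true) = -(-1) ^ popcount x := fun x => by
    simp only [ctrlPhase, Bool.and_true, if_true]
    rw [prod_ite_popcount]
    simp
  refine (QCompOn.phaseTest (D := Set.univ) C hW (fun _ => -1) (fun i => if i = i₀ then -1 else 1)
    (fun i => by simp) (fun i => by split_ifs <;> simp) (fun x => decide (Odd (popcount x)))
    ?_ ?_).mono (by omega) (by omega)
  · intro x _ hx z hz
    rw [decide_eq_true_iff] at hx
    rcases hC z hz with h | h
    · simp only [h, ht0]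
    · simp only [h, ht1, hx.neg_one_pow, neg_neg]
  · intro x _ hx
    rw [decide_eq_false_iff_not, Nat.not_odd_iff_even] at hx
    have hsum := sum_norm_sq_run_basis C (fun _ => false)
    have key : ∀ z, ((‖run C (basis fun _ => false) z‖ ^ 2 : ℝ) : ℂ) *
        ctrlPhase (fun _ => -1) (fun i => if i = i₀ then -1 else 1) x (fun i => z (.inl i))
        = ((2 * (if ∀ i, z (.inl i) = false then ‖run C (basis fun _ => false) z‖ ^ 2 else 0)
          - ‖run C (basis fun _ => false) z‖ ^ 2 : ℝ) : ℂ) := by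
      intro z
      by_cases hz : run C (basis fun _ => false) z = 0
      · simp [hz]
      · rcases hC z hz with h | h
        · simp only [h, ht0]
          simp
          ring
        · simp only [h, ht1, hx.neg_one_pow]
          rw [if_neg fun h' => by simpa using h' i₀]
          push_cast
          ring
    simp only [key]
    rw [← Complex.ofReal_sum, Finset.sum_sub_distrib, ← Finset.mul_sum, hC2, hsum]
    norm_num

theorem run_hGate_unit (f : Bool → ℂ) :
    run [[QACGate.single () hGate]] (fun a : Unit → Bool => f (a ()))
      = fun a => ((√2 : ℝ) : ℂ)⁻¹ * (f false + (if a () then -1 else 1) * f true) := by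
  funext a
  simp only [run_cons, run_nil, one_mul, runLayer_cons, runLayer_nil, mul_one, QACGate.act_single]
  cases h : a () <;> simp [hGate] <;> ring

/-- Hadamard gates make the targets uniform; the sign (-1)^(b·|y|), obtained by computing the
parity, flipping the sign under control of `b` and uncomputing, is a product over the targets; a
second round of Hadamard gates turns each factor into `|b⟩`. -/
theorem QComp.copy_of_parity {d s : ℕ}
    (h : QComp d s fun (x : I → Bool) (_ : Unit) => decide (Odd (popcount x))) :
    QComp (2 * d + 7) (s + 1) fun (b : Unit → Bool) (_ : I) => b () := by
  obtain ⟨A, _, _, G, hW, hl, hA, hG⟩ := h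
  let e : I ⊕ Unit ⊕ A ↪ Unit ⊕ I ⊕ (Unit ⊕ A) := ⟨fun r => .inr r, Sum.inr_injective⟩
  have he : ∀ r, e r = .inr r := fun _ => rfl
  let eH : I → Unit ↪ Unit ⊕ I ⊕ (Unit ⊕ A) := fun i => ⟨fun _ => .inr (.inl i), fun _ _ _ => rfl⟩
  have heH : ∀ i u, eH i u = .inr (.inl i) := fun _ _ => rfl
  let H : Layers (Unit ⊕ I ⊕ (Unit ⊕ A)) := Layers.par eH fun _ => [[QACGate.single () hGate]]
  have hd : ∀ i j, i ≠ j → ∀ a b, eH i a ≠ eH j b := by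
    intro i j hij a b
    simpa [heH] using hij
  have hHW : H.WF := Layers.WF.par hd fun _ => Layers.wf_singleton_singleton _
  have hHl : H.length ≤ 1 := Layers.length_par_le eH fun _ => le_rfl
  have hS : ({.inl ()} : Finset (Unit ⊕ I ⊕ (Unit ⊕ A))).Nonempty := by simp
  have ht : (.inr (.inr (.inl ())) : Unit ⊕ I ⊕ (Unit ⊕ A)) ∉
      ({.inl ()} : Finset (Unit ⊕ I ⊕ (Unit ⊕ A))) := by simp
  let F := flipPat _ hS _ ht (fun _ => true) true
  refine ⟨Unit ⊕ A, inferInstance, inferInstance,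
    H ++ (G.embed e ++ F ++ G.symm.embed e) ++ H,
    (hHW.append (((hW.embed e).append (wf_flipPat _ _ _ _ _ _)).append (hW.symm.embed e))).append
      hHW, ?_, ?_, fun b _ => ?_⟩
  · simp [F, length_flipPat]; omega
  · simp; omega
  let γ : QVec (Unit ⊕ I ⊕ (Unit ⊕ A)) :=
    agreeOn (fun q => ∀ i r, eH i r ≠ q) (regState b fun _ => false)
  have hγ : ∀ i z a, γ (extend (eH i) a z) = γ z := agreeOn_extend_family _
  have hrun : ∀ f : Bool → ℂ, run H (fun z => γ z * ∏ i, f (z (.inr (.inl i))))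
      = fun z => γ z * ∏ i : I, ((√2 : ℝ) : ℂ)⁻¹ *
        (f false + (if z (.inr (.inl i)) then -1 else 1) * f true) := by
    intro f
    refine (run_par_prod hd _ γ (fun _ a => f (a ())) hγ).trans ?_
    funext z
    congr 1
    refine Finset.prod_congr rfl fun i _ => ?_
    rw [run_hGate_unit]
    rfl
  have hbasis : ∀ c : Bool, basis (regState b fun _ => c)
      = fun z => γ z * ∏ i : I, if z (.inr (.inl i)) = c then 1 else 0 := by
    intro c
    rw [basis_eq_agreeOn_mul_prod (e := eH) (z := regState b fun _ => false) fun _ _ => c]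
    · funext z
      congr 1
      refine Finset.prod_congr rfl fun i _ => ?_
      rw [basis_apply]
      refine if_congr ?_ rfl rfl
      rw [funext_iff]
      simp [heH]
    · intro i u; rfl
    · rintro (u | i | r) hq
      · rfl
      · exact absurd rfl (hq i ())
      · rfl
  have hh : ((√2 : ℝ) : ℂ)⁻¹ * (((√2 : ℝ) : ℂ)⁻¹ * 2) = 1 := by
    rw [← mul_assoc, ← mul_inv, ← Complex.ofReal_mul, Real.mul_self_sqrt (by norm_num)]; norm_num
  have hmid : run (G.embed e ++ F ++ G.symm.embed e) (fun z => γ z * ∏ _i : I, ((√2 : ℝ) : ℂ)⁻¹)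
      = fun z => γ z * ∏ i : I, ((√2 : ℝ) : ℂ)⁻¹ *
        (if b () && z (.inr (.inl i)) then -1 else 1) := by
    -- The parity is computed only into a scratch qubit, so the conjugated sign flip is diagonal.
    rw [apply_eq_mul_of_basis _
      (fun z => ∏ i : I, if b () && z (.inr (.inl i)) then -1 else 1)]
    · funext z
      simp only [Finset.prod_mul_distrib]
      ring
    · intro z hz
      have hz' := eq_of_agreeOn_ne_zero (left_ne_zero_of_mul hz)
      have hz1 : z (.inl ()) = b () := hz' (.inl ()) (by simp [heH])
      have hz2 : ∀ r, z (.inr (.inr r)) = false := fun r => hz' (.inr (.inr r)) (by simp [heH])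
      let y : I → Bool := fun i => z (.inr (.inl i))
      let z' : Unit ⊕ I ⊕ (Unit ⊕ A) → Bool :=
        update z (.inr (.inr (.inl ()))) (decide (Odd (popcount y)))
      have h1 : run (G.embed e) (basis z) = basis z' := by
        refine run_embed_basis (hG y (Set.mem_univ _)) ?_ ?_ ?_
        · rintro (i | r | r)
          · rfl
          · exact hz2 _
          · exact hz2 _
        · rintro (i | r | r)
          · rfl
          · simp [z', he, regState]
          · simp [z', he, regState, hz2]
        · rintro (u | r) hq
          · rfl
          · exact absurd rfl (hq r)
      have h2 : run (G.symm.embed e) (basis z') = basis z := by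
        refine run_embed_basis (run_symm_basis (hG y (Set.mem_univ _))) ?_ ?_ ?_
        · rintro (i | r | r)
          · rfl
          · simp [z', he, regState]
          · simp [z', he, regState, hz2]
        · rintro (i | r | r)
          · rfl
          · exact hz2 _
          · exact hz2 _
        · rintro (u | r) hq
          · rfl
          · exact absurd rfl (hq r)
      rw [run_append, run_append, Module.End.mul_apply, Module.End.mul_apply, h1]
      have h3 : run F (basis z') = (∏ i : I, if b () && z (.inr (.inl i)) then (-1 : ℂ) else 1) •
          basis z' := by
        have : run F (basis z') = fun w => (if (∀ s ∈ ({.inl ()} : Finset (Unit ⊕ I ⊕ (Unit ⊕ A))),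
            w s = true) ∧ w (.inr (.inr (.inl ()))) = true then -1 else 1) * basis z' w := by
          funext w
          rw [run_flipPat]
          congr!
        rw [this, mul_basis]
        congr 1
        have hz1' : z' (.inl ()) = b () := hz1
        have hz2' : z' (.inr (.inr (.inl ()))) = decide (Odd (popcount y)) := by simp [z']
        simp only [Finset.mem_singleton, forall_eq, hz1', hz2', decide_eq_true_iff]
        cases b ()
        · simp
        · simp only [true_and, Bool.true_and]
          rw [prod_ite_popcount y]
          rcases Nat.even_or_odd (popcount y) with h | h
          · rw [if_neg (Nat.not_odd_iff_even.2 h), h.neg_one_pow]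
          · rw [if_pos h, h.neg_one_pow]
      rw [h3, map_smul, h2]
  rw [run_append, run_append, Module.End.mul_apply, Module.End.mul_apply, hbasis false,
    hrun fun c => if c = false then 1 else 0]
  simp only [if_true, Bool.true_eq_false, if_false, mul_zero, add_zero, mul_one]
  rw [hmid, hrun fun c => ((√2 : ℝ) : ℂ)⁻¹ * if b () && c then -1 else 1]
  rw [show (fun _ : I => b ()) = fun _ => b () from rfl, hbasis (b ())]
  funext z
  congr 1
  refine Finset.prod_congr rfl fun i _ => ?_
  cases b () <;> cases z (.inr (.inl i)) <;> simp <;> linear_combination hh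

end Parity

/-! ### Exact amplitude amplification. -/

section Amplify

variable {Q : Type} [Fintype Q] [DecidableEq Q]

/-- One exact Grover step. -/
theorem run_amplify (U F Z : Layers Q) (P : (Q → Bool) → Prop) [DecidablePred P]
    (hF : ∀ ψ z, run F ψ z = (if P z then -1 else 1) * ψ z)
    (hZ : ∀ ψ z, run Z ψ z = (if z = fun _ => false then -1 else 1) * ψ z)
    (hmass : ∑ z, (if P z then ‖run U (basis fun _ => false) z‖ ^ 2 else 0) = 1 / 4)
    (z : Q → Bool) :
    run (U ++ F ++ U.symm ++ Z ++ U) (basis fun _ => false) z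
      = if P z then -2 * run U (basis fun _ => false) z else 0 := by
  set Ψ := run U (basis fun _ => false) with hΨ
  set φ := run F Ψ with hφ
  -- This amplitude is the unmarked mass minus the marked mass, 1 - 2 · (1/4).
  have h0 : run U.symm φ (fun _ => false) = 1 / 2 := by
    rw [← qinner_basis_left (fun _ => false) (run U.symm φ), ← qinner_run, ← hΨ, qinner]
    have key : ∀ z, star (Ψ z) * φ z
        = ((‖Ψ z‖ ^ 2 - 2 * (if P z then ‖Ψ z‖ ^ 2 else 0) : ℝ) : ℂ) := by
      intro z
      have : star (Ψ z) * Ψ z = ((‖Ψ z‖ ^ 2 : ℝ) : ℂ) := by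
        rw [mul_comm, Complex.star_def, Complex.mul_conj, Complex.normSq_eq_norm_sq]
      rw [hφ, hF]
      split_ifs
      · rw [neg_one_mul, mul_neg, this]; push_cast; ring
      · rw [one_mul, this]; push_cast; ring
    simp only [key]
    rw [← Complex.ofReal_sum, Finset.sum_sub_distrib, ← Finset.mul_sum, hmass,
      sum_norm_sq_run_basis]
    norm_num
  -- Negating the amplitude 1/2 at zero subtracts exactly one copy of the zero state.
  have h1 : run Z (run U.symm φ) = run U.symm φ - basis fun _ => false := by
    funext z
    rw [hZ, Pi.sub_apply, basis_apply]
    split_ifs with h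
    · rw [h, h0]; norm_num
    · simp
  simp only [run_append, Module.End.mul_apply]
  -- Applying `U` again leaves FΨ - Ψ, which is -2Ψ on marked states and zero elsewhere.
  rw [← hΨ, ← hφ, h1, map_sub, run_run_symm, ← hΨ, Pi.sub_apply, hφ, hF]
  split_ifs
  · ring
  · ring

end Amplify

/-! ### From constant mass to probability exactly 1/2. -/

section Reweight

variable {I A : Type} [Fintype I] [DecidableEq I] [Fintype A] [DecidableEq A]

theorem act_rotGate {Q : Type} [DecidableEq Q] (q : Q) (c s : ℝ) (h : c ^ 2 + s ^ 2 = 1)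
    (ψ : QVec Q) (z : Q → Bool) (hψ : ψ (update z q true) = 0) :
    (QACGate.single q (rotGate c s h)).act ψ z
      = (if z q then (s : ℂ) else c) * ψ (update z q false) := by
  rw [QACGate.act_single]
  simp [rotGate, hψ]

/-- The assignments of `I ⊕ A ⊕ Bool` as triples. -/
def assignEquiv (I A : Type) : (I ⊕ A ⊕ Bool → Bool) ≃ (I ⊕ A → Bool) × Bool × Bool where
  toFun z := (fun r => z (r.elim .inl fun a => .inr (.inl a)),
    z (.inr (.inr false)), z (.inr (.inr true)))
  invFun p := Sum.elim (fun i => p.1 (.inl i)) (Sum.elim (fun a => p.1 (.inr a))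
    fun b => if b then p.2.2 else p.2.1)
  left_inv z := by
    funext q
    rcases q with i | a | b
    · rfl
    · rfl
    · cases b <;> rfl
  right_inv p := by
    ext r
    · rcases r with i | a <;> rfl
    · rfl
    · rfl

/-- The two flag qubits are independent of the rest, so weighted masses factor. -/
theorem sum_assign (f : (I ⊕ A → Bool) → ℝ) (h k : Bool → ℝ) :
    ∑ z : I ⊕ A ⊕ Bool → Bool, f (fun r => z (r.elim .inl fun a => .inr (.inl a))) *
      (h (z (.inr (.inr false))) * k (z (.inr (.inr true))))
      = (∑ z, f z) * ((∑ b, h b) * ∑ b, k b) := by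
  refine (Fintype.sum_equiv (assignEquiv I A) _ (fun p => f p.1 * (h p.2.1 * k p.2.2))
    fun z => rfl).trans ?_
  rw [Fintype.sum_prod_type, Finset.sum_mul]
  refine Finset.sum_congr rfl fun z _ => ?_
  simp only [Fintype.sum_prod_type, Fintype.sum_bool]
  ring

/-- A state whose targets agree with constant probability can be amplified to a nekomata. -/
theorem HasNekomata.of_mass [Nonempty I] (U : Layers (I ⊕ A)) (hW : U.WF)
    (h0 : 1 / 8 ≤ ∑ z, if ∀ i, z (.inl i) = false then ‖run U (basis fun _ => false) z‖ ^ 2 else 0)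
    (h1 : 1 / 8 ≤ ∑ z, if ∀ i, z (.inl i) = true then ‖run U (basis fun _ => false) z‖ ^ 2 else 0) :
    HasNekomata I (3 * U.length + 18) (Fintype.card A + 2) := by
  obtain ⟨i₀⟩ := ‹Nonempty I›
  set Ψ := run U (basis fun _ => false) with hΨ
  set p₀ := ∑ z, if ∀ i, z (.inl i) = false then ‖Ψ z‖ ^ 2 else 0 with hp₀
  set p₁ := ∑ z, if ∀ i, z (.inl i) = true then ‖Ψ z‖ ^ 2 else 0 with hp₁
  -- A flag rotated in this way is one with probability 1/(8p), which cuts a mass p ≥ 1/8 down to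
  -- exactly 1/8.
  have hq : ∀ p : ℝ, 1 / 8 ≤ p → √(1 - 1 / (8 * p)) ^ 2 + √(1 / (8 * p)) ^ 2 = 1 := by
    intro p hp
    have hle : 1 / (8 * p) ≤ 1 := by
      rw [div_le_one (by linarith)]; linarith
    rw [Real.sq_sqrt (by linarith), Real.sq_sqrt (by positivity)]
    ring
  let e : I ⊕ A ↪ I ⊕ A ⊕ Bool :=
    ⟨fun r => r.elim .inl fun a => .inr (.inl a), by rintro (i | a) (i' | a') <;> simp⟩
  have he1 : ∀ i, e (.inl i) = .inl i := fun _ => rfl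
  have he2 : ∀ a, e (.inr a) = .inr (.inl a) := fun _ => rfl
  let R : List (QACGate (I ⊕ A ⊕ Bool)) :=
    [.single (.inr (.inr false)) (rotGate _ _ (hq p₀ h0)),
      .single (.inr (.inr true)) (rotGate _ _ (hq p₁ h1))]
  let U' := U.embed e ++ [R]
  have hRW : Layers.WF [R] := by
    simp [R, Layers.WF, QACGate.support]
  have hU'W : U'.WF := (hW.embed e).append hRW
  let η₀ : Bool → ℝ := fun b => if b then √(1 / (8 * p₀)) else √(1 - 1 / (8 * p₀))
  let η₁ : Bool → ℝ := fun b => if b then √(1 / (8 * p₁)) else √(1 - 1 / (8 * p₁))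
  have hU' : ∀ z, run U' (basis fun _ => false) z
      = Ψ (z ∘ e) * ((η₀ (z (.inr (.inr false))) * η₁ (z (.inr (.inr true))) : ℝ) : ℂ) := by
    intro z
    have hb : run (U.embed e) (basis fun _ => false)
        = fun z => (if z (.inr (.inr false)) = false ∧ z (.inr (.inr true)) = false then 1 else 0)
          * Ψ (z ∘ e) := by
      rw [hΨ, ← run_embed_mul e U
        (fun z => if z (.inr (.inr false)) = false ∧ z (.inr (.inr true)) = false then 1 else 0)]
      · congr 1
        funext y
        rw [← agreeOn_mul_basis e (w := fun _ => false) (z := fun _ => false) (fun _ _ => rfl) y]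
        congr 1
        have hiff : (∀ q, (∀ r, e r ≠ q) → y q = false) ↔
            y (.inr (.inr false)) = false ∧ y (.inr (.inr true)) = false := by
          refine ⟨fun h => ⟨h _ ?_, h _ ?_⟩, ?_⟩
          · rintro (i | a) <;> simp [he1, he2]
          · rintro (i | a) <;> simp [he1, he2]
          · rintro ⟨ha, hb⟩ (i | a | b) hq
            · exact absurd rfl (hq (.inl i))
            · exact absurd rfl (hq (.inr a))
            · cases b
              exacts [ha, hb]
        by_cases hc : y (.inr (.inr false)) = false ∧ y (.inr (.inr true)) = false
        · rw [if_pos hc]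
          exact if_pos (hiff.2 hc)
        · rw [if_neg hc]
          exact if_neg (mt hiff.1 hc)
      · intro z a
        have : ∀ b, extend e a z (.inr (.inr b)) = z (.inr (.inr b)) := by
          intro b
          rw [extend_apply']
          rintro ⟨i | a, h⟩ <;> simp [he1, he2] at h
        simp only [this]
    have hue : ∀ (z : I ⊕ A ⊕ Bool → Bool) b c, update z (.inr (.inr b)) c ∘ e = z ∘ e := by
      intro z b c
      funext r
      rcases r with i | a <;> simp [he1, he2]
    simp only [U', R, run_append, Module.End.mul_apply, run_cons, run_nil, one_mul, runLayer_cons,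
      runLayer_nil, mul_one, hb]
    rw [act_rotGate, act_rotGate]
    · simp [hue, η₀, η₁]
      split_ifs <;> push_cast <;> ring
    · simp
    · rw [act_rotGate]
      · simp
      · simp
  let F₀ := flipPat (Finset.univ.map Embedding.inl) (by simp)
    (.inr (.inr false) : I ⊕ A ⊕ Bool) (by simp) (fun _ => false) true
  let F₁ := flipPat (Finset.univ.map Embedding.inl) (by simp)
    (.inr (.inr true) : I ⊕ A ⊕ Bool) (by simp) (fun _ => true) true
  -- The sign at the zero state: one flag serves as target, all other qubits are controls, and `i₀`
  -- shows that there is one.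
  let Z := flipPat (Finset.univ.erase (.inr (.inr true)))
    ⟨.inl i₀, by simp⟩ (.inr (.inr true) : I ⊕ A ⊕ Bool) (by simp) (fun _ => false) false
  let P₀ : (I ⊕ A ⊕ Bool → Bool) → Prop := fun z =>
    (∀ i, z (.inl i) = false) ∧ z (.inr (.inr false)) = true
  let P₁ : (I ⊕ A ⊕ Bool → Bool) → Prop := fun z =>
    (∀ i, z (.inl i) = true) ∧ z (.inr (.inr true)) = true
  have hex : ∀ z, P₀ z → ¬ P₁ z := by
    intro z hz hz'
    have := hz.1 i₀
    rw [hz'.1 i₀] at this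
    simp at this
  have hF : ∀ ψ z, run (F₀ ++ F₁) ψ z = (if P₀ z ∨ P₁ z then -1 else 1) * ψ z := by
    intro ψ z
    rw [run_append, Module.End.mul_apply, run_flipPat, run_flipPat, ← mul_assoc]
    congr 1
    have hP₀ : ((∀ s ∈ Finset.univ.map Embedding.inl, z s = (fun _ : I ⊕ A ⊕ Bool => false) s) ∧
        z (.inr (.inr false)) = true) ↔ P₀ z := by simp [P₀]
    have hP₁ : ((∀ s ∈ Finset.univ.map Embedding.inl, z s = (fun _ : I ⊕ A ⊕ Bool => true) s) ∧
        z (.inr (.inr true)) = true) ↔ P₁ z := by simp [P₁]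
    simp only [hP₀, hP₁]
    by_cases ha : P₀ z
    · simp [ha, hex z ha]
    · simp [ha]
  have hZ : ∀ ψ z, run Z ψ z = (if z = fun _ => false then -1 else 1) * ψ z := by
    intro ψ z
    refine run_flipPat_of_iff _ _ _ _ _ _ ψ z ⟨?_, fun h => ?_⟩
    · rintro rfl
      simp
    · funext q
      by_cases hq : q = .inr (.inr true)
      · rw [hq, h.2]
      · exact h.1 q (by simp [hq])
  have hsq : ∀ z, ‖run U' (basis fun _ => false) z‖ ^ 2 = ‖Ψ (z ∘ e)‖ ^ 2 *
      (η₀ (z (.inr (.inr false))) ^ 2 * η₁ (z (.inr (.inr true))) ^ 2) := by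
    intro z
    rw [hU', norm_mul, mul_pow, Complex.norm_real, Real.norm_eq_abs, sq_abs, mul_pow]
  have hη : ∀ p : ℝ, 1 / 8 ≤ p → ∑ b : Bool,
      (if b then √(1 / (8 * p)) else √(1 - 1 / (8 * p))) ^ 2 = 1 := by
    intro p hp
    have := hq p hp
    rw [Fintype.sum_bool]
    simp only [if_true, Bool.false_eq_true, if_false]
    linarith
  have hm₀ : ∑ z, (if P₀ z then ‖run U' (basis fun _ => false) z‖ ^ 2 else 0) = 1 / 8 := by
    have h := sum_assign (fun z : I ⊕ A → Bool => if ∀ i, z (.inl i) = false then ‖Ψ z‖ ^ 2 else 0)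
      (fun b => if b then η₀ b ^ 2 else 0) (fun b => η₁ b ^ 2)
    rw [← hp₀, hη p₁ h1] at h
    have h8 : p₀ * ((∑ b : Bool, if b then η₀ b ^ 2 else 0) * 1) = 1 / 8 := by
      simp only [Fintype.sum_bool, if_true, η₀, Bool.false_eq_true, if_false, add_zero]
      rw [Real.sq_sqrt (by positivity)]
      field_simp
    rw [← h8, ← h]
    refine Finset.sum_congr rfl fun z _ => ?_
    rw [hsq]
    simp only [P₀]
    by_cases ha : ∀ i, z (.inl i) = false
    · cases hb : z (.inr (.inr false))
      · simp
      · simp [ha]; left; rfl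
    · have : ¬ ∀ i, z ((Sum.inl i : I ⊕ A).elim .inl fun a => .inr (.inl a)) = false := ha
      simp only [ha, false_and, if_false, this, zero_mul]
  have hm₁ : ∑ z, (if P₁ z then ‖run U' (basis fun _ => false) z‖ ^ 2 else 0) = 1 / 8 := by
    have h := sum_assign (fun z : I ⊕ A → Bool => if ∀ i, z (.inl i) = true then ‖Ψ z‖ ^ 2 else 0)
      (fun b => η₀ b ^ 2) (fun b => if b then η₁ b ^ 2 else 0)
    rw [← hp₁, hη p₀ h0] at h
    have h8 : p₁ * (1 * ∑ b : Bool, if b then η₁ b ^ 2 else 0) = 1 / 8 := by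
      simp only [Fintype.sum_bool, if_true, η₁, Bool.false_eq_true, if_false, add_zero]
      rw [Real.sq_sqrt (by positivity)]
      field_simp
    rw [← h8, ← h]
    refine Finset.sum_congr rfl fun z _ => ?_
    rw [hsq]
    simp only [P₁]
    by_cases ha : ∀ i, z (.inl i) = true
    · cases hb : z (.inr (.inr true))
      · simp
      · simp [ha]; left; rfl
    · have : ¬ ∀ i, z ((Sum.inl i : I ⊕ A).elim .inl fun a => .inr (.inl a)) = true := ha
      simp only [ha, false_and, if_false, this, zero_mul]
  -- The marked mass is 1/4 = sin²(π/6), for which a single Grover step is exact.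
  have hmass : ∑ z, (if P₀ z ∨ P₁ z then ‖run U' (basis fun _ => false) z‖ ^ 2 else 0) = 1 / 4 := by
    have : (1 / 4 : ℝ) = 1 / 8 + 1 / 8 := by norm_num
    rw [this]
    nth_rewrite 1 [← hm₀]
    rw [← hm₁, ← Finset.sum_add_distrib]
    refine Finset.sum_congr rfl fun z _ => ?_
    by_cases ha : P₀ z
    · simp [ha, hex z ha]
    · simp [ha]
  have hfin := run_amplify U' (F₀ ++ F₁) Z _ hF hZ hmass
  refine ⟨A ⊕ Bool, inferInstance, inferInstance, U' ++ (F₀ ++ F₁) ++ U'.symm ++ Z ++ U',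
    (((hU'W.append ((wf_flipPat _ _ _ _ _ _).append (wf_flipPat _ _ _ _ _ _))).append
      hU'W.symm).append (wf_flipPat _ _ _ _ _ _)).append hU'W, ?_, ?_, ?_, ?_⟩
  · have hZl : Z.length = 5 := length_flipPat _ _ _ _ _ _
    simp [U', F₀, F₁, hZl, length_flipPat]; omega
  · simp
  · intro z hz
    rw [hfin, ite_ne_right_iff] at hz
    rcases hz.1 with h | h
    exacts [.inl h.1, .inr h.1]
  -- The step doubles marked amplitudes, so each marked part has mass 4 · (1/8).
  · have : (1 / 2 : ℝ) = 4 * (1 / 8) := by norm_num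
    rw [this, ← hm₀, Finset.mul_sum]
    refine Finset.sum_congr rfl fun z _ => ?_
    rw [hfin]
    by_cases ha : ∀ i, z (.inl i) = false
    · have hb : ¬ P₁ z := by
        intro h
        have := h.1 i₀
        rw [ha i₀] at this
        simp at this
      simp only [hb, or_false, P₀, ha, implies_true, true_and, if_true]
      split_ifs
      · rw [norm_mul, mul_pow]; norm_num
      · simp
    · simp [ha, P₀]

end Reweight

/-! ### One column: a reflection with a small all-one amplitude. -/

section Column

variable {J : Type} [Fintype J] [DecidableEq J]

/-- The same single-qubit gate on all qubits. -/
noncomputable def gateLayer (J : Type) [Fintype J] [DecidableEq J]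
    (U : Matrix.unitaryGroup Bool ℂ) : Layers J :=
  Layers.par (fun j : J => (⟨fun _ => j, fun _ _ _ => rfl⟩ : Unit ↪ J))
    fun _ => [[QACGate.single () U]]

theorem wf_gateLayer (U : Matrix.unitaryGroup Bool ℂ) : (gateLayer J U).WF :=
  Layers.WF.par (fun _ _ hij _ _ => hij) fun _ => Layers.wf_singleton_singleton _

theorem length_gateLayer (U : Matrix.unitaryGroup Bool ℂ) : (gateLayer J U).length ≤ 1 :=
  Layers.length_par_le _ fun _ => le_rfl

theorem run_gateLayer_basis (U : Matrix.unitaryGroup Bool ℂ) (w z : J → Bool) :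
    run (gateLayer J U) (basis w) z = ∏ j, (U : Matrix Bool Bool ℂ) (z j) (w j) := by
  have h1 : basis w = fun z : J → Bool => 1 * ∏ j, basis (fun _ : Unit => w j)
      (z ∘ (⟨fun _ => j, fun _ _ _ => rfl⟩ : Unit ↪ J)) := by
    rw [basis_eq_agreeOn_mul_prod (e := fun j : J => (⟨fun _ => j, fun _ _ _ => rfl⟩ : Unit ↪ J))
      (w := w) (z := w) fun j _ => w j]
    · funext z
      congr 1
      exact if_pos fun q hq => absurd rfl (hq q ())
    · intro j u; rfl
    · intro q hq; rfl
  rw [h1]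
  refine (congrFun (run_par_prod (fun _ _ hij _ _ => hij) (fun _ => [[QACGate.single () U]])
    (fun _ => 1) (fun j => basis fun _ => w j) fun _ _ _ => rfl) z).trans ?_
  simp only [one_mul]
  refine Finset.prod_congr rfl fun j _ => ?_
  have h3 : ∀ b : Bool, ((update (z ∘ (⟨fun _ => j, fun _ _ _ => rfl⟩ : Unit ↪ J)) () b)
      = fun _ => w j) ↔ b = w j := by
    intro b
    rw [funext_iff]
    simp
  simp only [run_cons, run_nil, one_mul, runLayer_cons, runLayer_nil, mul_one, QACGate.act_single,
    basis_apply, h3]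
  simp
  rfl

theorem run_symm_apply {Q : Type} [Fintype Q] [DecidableEq Q] (C : Layers Q) (w z : Q → Bool) :
    run C.symm (basis w) z = star (run C (basis z) w) := by
  rw [← qinner_basis_left z (run C.symm (basis w)), ← qinner_run, qinner]
  simp [basis_apply]

/-- A circuit that prepares a superposition of `|0…0⟩`, `|1…1⟩` and a small rest. -/
theorem exists_column (m : ℕ) (hm : 2 ≤ m) (c s : ℝ) (h : c ^ 2 + s ^ 2 = 1) :
    ∃ C : Layers (Fin m), C.WF ∧ C.length ≤ 7 ∧
      run C (basis fun _ => false) (fun _ => false) = ((1 - 2 * (s ^ 2) ^ m : ℝ) : ℂ) ∧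
      run C (basis fun _ => false) (fun _ => true) = ((-2 * s ^ m * c ^ m : ℝ) : ℂ) := by
  have : NeZero m := ⟨by omega⟩
  let S : Finset (Fin m) := Finset.univ.erase 0
  have hS : S.Nonempty := ⟨⟨1, by omega⟩, by simp [S, Fin.ext_iff]⟩
  have hS0 : (0 : Fin m) ∉ S := by simp [S]
  let F := flipPat S hS 0 hS0 (fun _ => true) true
  let R := gateLayer (Fin m) (rotGate c s h)
  have hR := wf_gateLayer (J := Fin m) (rotGate c s h)
  have hRl := length_gateLayer (J := Fin m) (rotGate c s h)
  have hR1 : run R (basis fun _ => false) (fun _ => true) = (s : ℂ) ^ m := by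
    simp [R, run_gateLayer_basis, rotGate]
  have hR2 : run R (basis fun _ => true) (fun _ => true) = (c : ℂ) ^ m := by
    simp [R, run_gateLayer_basis, rotGate]
  have hne : (fun _ : Fin m => true) ≠ fun _ => false := fun h => by simpa using congrFun h 0
  -- The sign flip at the all-one state changes the rotated state by -2s^m|1…1⟩. Undoing the
  -- rotation then yields the two stated amplitudes, with factors s^m and c^m from the inverse
  -- rotation.
  have hF : run F (run R (basis fun _ => false))
      = run R (basis fun _ => false) - (2 * (s : ℂ) ^ m) • basis fun _ => true := by
    funext z
    rw [run_flipPat_of_iff S hS 0 hS0 _ _ _ _ (p := z = fun _ => true), Pi.sub_apply, Pi.smul_apply,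
      basis_apply]
    · split_ifs with hz
      · rw [hz, hR1, smul_eq_mul]; ring
      · simp
    · constructor
      · rintro rfl; simp
      · intro h
        funext q
        by_cases hq : q = 0
        · rw [hq, h.2]
        · exact h.1 q (by simp [S, hq])
  have hrun : run (R ++ F ++ R.symm) (basis fun _ => false)
      = basis (fun _ => false) - (2 * (s : ℂ) ^ m) • run R.symm (basis fun _ => true) := by
    rw [run_append, run_append, Module.End.mul_apply, Module.End.mul_apply, hF, map_sub, map_smul,
      run_symm_run]
  refine ⟨R ++ F ++ R.symm, (hR.append (wf_flipPat _ _ _ _ _ _)).append hR.symm, ?_, ?_, ?_⟩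
  · simp only [List.length_append, Layers.length_symm, F, length_flipPat]
    change R.length ≤ 1 at hRl
    omega
  · rw [hrun, Pi.sub_apply, Pi.smul_apply, run_symm_apply, hR1, basis_apply, if_pos rfl]
    simp
    ring
  · rw [hrun, Pi.sub_apply, Pi.smul_apply, run_symm_apply, hR2, basis_apply, if_neg hne]
    simp

end Column

/-! ### Many columns in parallel: the nekomata on `m` targets. -/

section Grid

/-- Distinct basis states do not interfere. Values in a real module cover both real masses and
complex phases. -/
theorem sum_norm_sq_sum_basis {Q Γ α : Type} [Fintype Q] [DecidableEq Q] [Fintype Γ]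
    [AddCommMonoid α] [Module ℝ α]
    {w : Γ → Q → Bool} (hw : Injective w) (Φ : Γ → ℂ) (f : (Q → Bool) → α) :
    ∑ z, ‖(∑ x, Φ x • basis (w x)) z‖ ^ 2 • f z = ∑ x, ‖Φ x‖ ^ 2 • f (w x) := by
  classical
  symm
  refine Fintype.sum_of_injective w hw _ _ ?_ ?_
  · intro z hz
    rw [Finset.sum_apply, Finset.sum_eq_zero]
    · simp
    · intro x _
      rw [Pi.smul_apply, basis_apply, if_neg fun h => hz ⟨x, h.symm⟩, smul_zero]
  · intro x
    rw [Finset.sum_apply, Finset.sum_eq_single x]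
    · rw [Pi.smul_apply, basis_apply, if_pos rfl, smul_eq_mul, mul_one]
    · intro y _ hy
      rw [Pi.smul_apply, basis_apply, if_neg fun h => hy (hw h).symm, smul_zero]
    · simp

/-- Preparing a state in a part of the register. -/
theorem run_embed_zero {Γ Q : Type} [Fintype Γ] [DecidableEq Γ] [Fintype Q] [DecidableEq Q]
    (e : Γ ↪ Q) (G : Layers Γ) {w : (Γ → Bool) → Q → Bool} (hw : ∀ x r, w x (e r) = x r)
    (hw0 : ∀ x q, (∀ r, e r ≠ q) → w x q = false) :
    run (G.embed e) (basis fun _ => false)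
      = ∑ x, run G (basis fun _ => false) x • basis (w x) := by
  have hag : ∀ x y, agreeOn (fun q => ∀ r, e r ≠ q) (fun _ => false) y * basis x (y ∘ e)
      = basis (w x) y := by
    intro x y
    rw [← agreeOn_mul_basis e (w := w x) (z := fun _ => false) fun q hq => (hw0 x q hq).symm]
    congr 2
    funext r
    exact (hw x r).symm
  have hb : basis (fun _ => false) = fun y : Q → Bool =>
      agreeOn (fun q => ∀ r, e r ≠ q) (fun _ => false) y * basis (fun _ => false) (y ∘ e) := by
    funext y
    rw [hag]
    congr 1
    funext q
    by_cases hq : ∃ r, e r = q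
    · obtain ⟨r, rfl⟩ := hq
      rw [hw]
    · rw [hw0 _ _ (not_exists.1 hq)]
  rw [hb, run_embed_mul e G _ _ fun z a => agreeOn_extend e (fun _ h => h) _ _ _]
  funext y
  conv_lhs => rw [QVec.eq_sum (run G _)]
  rw [Finset.sum_apply, Finset.sum_apply, Finset.mul_sum]
  refine Finset.sum_congr rfl fun x _ => ?_
  rw [Pi.smul_apply, Pi.smul_apply, ← hag, smul_eq_mul, smul_eq_mul]
  ring

/-- The columns of a grid. -/
def gridEquiv (m N : ℕ) : ((Σ _ : Fin m, Fin N) → Bool) ≃ (Fin N → Fin m → Bool) where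
  toFun x k i := x ⟨i, k⟩
  invFun y p := y p.2 p.1
  left_inv _ := rfl
  right_inv _ := rfl

theorem sum_grid (m N : ℕ) (f : (Fin m → Bool) → ℝ) :
    ∑ x : (Σ _ : Fin m, Fin N) → Bool, ∏ k, f (fun i => x ⟨i, k⟩) = (∑ y, f y) ^ N := by
  rw [Fintype.sum_pow]
  exact Fintype.sum_equiv (gridEquiv m N) _ _ fun _ => rfl

/-- `N` independent columns are combined by the disjunction along each row: the targets are all zero
if every column is zero, and all one as soon as one column is all ones. `h0` and `h1` bound these
two probabilities. -/
theorem HasNekomata.of_column (m N : ℕ) (hm : 2 ≤ m) (C : Layers (Fin m)) (hW : C.WF)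
    (h0 : 1 / 8 ≤ (‖run C (basis fun _ => false) (fun _ => false)‖ ^ 2) ^ N)
    (h1 : 1 / 8 ≤ 1 - (1 - ‖run C (basis fun _ => false) (fun _ => true)‖ ^ 2) ^ N) :
    HasNekomata (Fin m) (3 * (C.length + 4) + 18) (m * N + 2) := by
  have : NeZero m := ⟨by omega⟩
  set χ := run C (basis fun _ => false) with hχ
  let Γ := Σ _ : Fin m, Fin N
  obtain ⟨A, _, _, T, hTW, hTl, hA, hT⟩ :
      QComp 4 0 fun (x : (Σ _ : Fin m, Fin N) → Bool) (i : Fin m) =>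
        decide (∃ k, x ⟨i, k⟩ = true) := by
    have h := QComp.sigma (I := Fin m) (fun _ => QComp.or (ι := Fin N))
    rw [mul_zero] at h
    refine h.reindex (Embedding.refl _) (Equiv.sigmaUnique (Fin m) fun _ => Unit) ?_
    rintro x ⟨i, ⟨⟩⟩
    rw [Bool.eq_iff_iff]
    simp [Equiv.sigmaUnique]
  let ec : Fin N → (Fin m ↪ Σ _ : Fin m, Fin N) := fun k => ⟨fun i => ⟨i, k⟩, fun i j h => by
    simpa using h⟩
  have hec : ∀ k l, k ≠ l → ∀ a b, ec k a ≠ ec l b := by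
    intro k l hkl a b h
    have h2 : k = l := congrArg (fun p : Σ _ : Fin m, Fin N => p.2) h
    exact hkl h2
  let G : Layers (Σ _ : Fin m, Fin N) := Layers.par ec fun _ => C
  have hGW : G.WF := Layers.WF.par hec fun _ => hW
  have hGl : G.length ≤ C.length := Layers.length_par_le ec fun _ => le_rfl
  let Φ : QVec (Σ _ : Fin m, Fin N) := fun x => ∏ k, χ fun i => x ⟨i, k⟩
  have hΦ : run G (basis fun _ => false) = Φ := by
    have hb : basis (fun _ => false) = fun x : (Σ _ : Fin m, Fin N) → Bool =>
        1 * ∏ k, basis (fun _ => false) (x ∘ ec k) := by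
      rw [basis_eq_agreeOn_mul_prod (e := ec) (w := fun _ => false) (z := fun _ => false)
        fun _ _ => false]
      · funext z
        congr 1
        exact if_pos fun q hq => absurd rfl (hq q.2 q.1)
      · intro j u; rfl
      · intro q hq; rfl
    rw [hb]
    refine (run_par_prod hec (fun _ => C) (fun _ => 1) (fun _ => basis fun _ => false)
      fun _ _ _ => rfl).trans ?_
    funext x
    rw [one_mul]
    rfl
  let eG : (Σ _ : Fin m, Fin N) ↪ Fin m ⊕ (Σ _ : Fin m, Fin N) ⊕ A :=
    ⟨fun g => .inr (.inl g), fun g g' => by simp⟩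
  let eT : (Σ _ : Fin m, Fin N) ⊕ Fin m ⊕ A ↪ Fin m ⊕ (Σ _ : Fin m, Fin N) ⊕ A :=
    ⟨Sum.elim (fun g => .inr (.inl g)) (Sum.elim .inl fun a => .inr (.inr a)),
      by rintro (g | i | a) (g' | i' | a') <;> simp⟩
  let w : ((Σ _ : Fin m, Fin N) → Bool) → (Fin m → Bool) → Fin m ⊕ (Σ _ : Fin m, Fin N) ⊕ A → Bool :=
    fun x y => Sum.elim y (Sum.elim x fun _ => false)
  let hor : ((Σ _ : Fin m, Fin N) → Bool) → Fin m → Bool := fun x i => decide (∃ k, x ⟨i, k⟩ = true)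
  have hG : run (G.embed eG) (basis fun _ => false) = ∑ x, Φ x • basis (w x fun _ => false) := by
    rw [run_embed_zero eG G (w := fun x => w x fun _ => false) (fun _ _ => rfl), hΦ]
    rintro x (i | g | a) hq
    · rfl
    · exact absurd rfl (hq g)
    · rfl
  have hTx : ∀ x, run (T.embed eT) (basis (w x fun _ => false)) = basis (w x (hor x)) := by
    intro x
    refine run_embed_basis (hT x (Set.mem_univ _)) ?_ ?_ ?_
    · rintro (g | i | a) <;> rfl
    · rintro (g | i | a) <;> rfl
    · rintro (i | g | a) hq
      · exact absurd rfl (hq (.inr (.inl i)))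
      · rfl
      · rfl
  have hrun : run (G.embed eG ++ T.embed eT) (basis fun _ => false)
      = ∑ x, Φ x • basis (w x (hor x)) := by
    rw [run_append, Module.End.mul_apply, hG, map_sum]
    simp only [map_smul, hTx]
  have hwi : Injective fun x => w x (hor x) := by
    intro x y hxy
    funext g
    exact congrFun hxy (.inr (.inl g))
  have hmass : ∀ (P : (Fin m → Bool) → Prop) [DecidablePred P],
      ∑ z : Fin m ⊕ (Σ _ : Fin m, Fin N) ⊕ A → Bool, (if P fun i => z (.inl i) then
        ‖run (G.embed eG ++ T.embed eT) (basis fun _ => false) z‖ ^ 2 else 0)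
      = ∑ x, if P (hor x) then ‖Φ x‖ ^ 2 else 0 := by
    intro P _
    have h := sum_norm_sq_sum_basis hwi Φ fun z => if P fun i => z (.inl i) then (1 : ℝ) else 0
    simp only [smul_eq_mul, mul_ite, mul_one, mul_zero] at h
    rw [hrun, h]
    rfl
  have hΦn : ∀ x, ‖Φ x‖ ^ 2 = ∏ k, ‖χ fun i => x ⟨i, k⟩‖ ^ 2 := by
    intro x
    simp only [Φ, norm_prod, Finset.prod_pow]
  refine (HasNekomata.of_mass (G.embed eG ++ T.embed eT) ((hGW.embed eG).append (hTW.embed eT))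
    ?_ ?_).mono ?_ ?_
  -- The all-zero grid alone already has the mass in `h0`.
  · refine le_trans ?_ (le_of_eq (@hmass (fun t => ∀ i, t i = false) fun _ => Fintype.decidableForallFintype).symm)
    refine h0.trans ?_
    refine le_trans (le_of_eq ?_) (Finset.single_le_sum (f := fun x =>
      @ite ℝ (∀ i, hor x i = false) Fintype.decidableForallFintype (‖Φ x‖ ^ 2) 0) (fun x _ => ?_)
      (Finset.mem_univ fun _ => false))
    · simp [hor, hΦn]
    · split_ifs <;> positivity
  · refine le_trans ?_ (le_of_eq (@hmass (fun t => ∀ i, t i = true) fun _ => Fintype.decidableForallFintype).symm)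
    refine h1.trans ?_
    have htot : ∑ x, ‖Φ x‖ ^ 2 = 1 := by
      rw [← hΦ]; exact sum_norm_sq_run_basis _ _
    have htotχ : ∑ y, ‖χ y‖ ^ 2 = 1 := sum_norm_sq_run_basis _ _
    have hsub : 1 - ‖χ fun _ => true‖ ^ 2
        = ∑ y, if y = (fun _ => true) then 0 else ‖χ y‖ ^ 2 := by
      rw [← htotχ, ← Finset.sum_erase_add _ _ (Finset.mem_univ fun _ => true), add_sub_cancel_right,
        ← Finset.sum_erase_add _ _ (Finset.mem_univ fun _ => true), if_pos rfl, add_zero]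
      exact Finset.sum_congr rfl fun y hy => by rw [if_neg (Finset.ne_of_mem_erase hy)]
    -- The grids without an all-one column have total mass (1 - δ)^N, δ being the all-one mass of a
    -- column; in every other grid all targets are one.
    rw [hsub, ← sum_grid, ← htot, ← Finset.sum_sub_distrib]
    refine Finset.sum_le_sum fun x _ => ?_
    rw [hΦn]
    by_cases hx : ∃ k, (fun i => x ⟨i, k⟩) = fun _ => true
    · obtain ⟨k, hk⟩ := hx
      have hz : ∏ k, (if (fun i => x ⟨i, k⟩) = (fun _ => true) then 0
          else ‖χ fun i => x ⟨i, k⟩‖ ^ 2) = 0 := Finset.prod_eq_zero (Finset.mem_univ k) (by rw [if_pos hk])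
      rw [if_pos, hz, sub_zero]
      intro i
      simp only [hor, decide_eq_true_eq]
      exact ⟨k, congrFun hk i⟩
    · push Not at hx
      simp only [hx, if_false, sub_self]
      split_ifs <;> positivity
  · simp only [List.length_append, Layers.length_embed]; omega
  · simp only [Fintype.card_sum, Fintype.card_sigma, Fintype.card_fin, Finset.sum_const,
      Finset.card_univ, smul_eq_mul]
    omega

/-- Exact nekomata on `m` targets, with exponentially many ancillas. -/
theorem hasNekomata_fin (m : ℕ) (hm : 2 ≤ m) :
    HasNekomata (Fin m) 51 (m * (8 ^ (m - 1) * m ^ m) + 2) := by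
  have hm0 : (0 : ℝ) < m := by positivity
  have hm2 : (2 : ℝ) ≤ m := by exact_mod_cast hm
  have hs : (1 / (8 * m) : ℝ) ≤ 1 / 16 := by
    apply one_div_le_one_div_of_le (by norm_num); linarith
  have hs0 : (0 : ℝ) < 1 / (8 * m) := by positivity
  set c := √(1 - 1 / (8 * m : ℝ)) with hc
  set s := √(1 / (8 * m : ℝ)) with hs'
  have hc2 : c ^ 2 = 1 - 1 / (8 * m : ℝ) := Real.sq_sqrt (by linarith)
  have hs2 : s ^ 2 = 1 / (8 * m : ℝ) := Real.sq_sqrt hs0.le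
  obtain ⟨C, hW, hl, hC0, hC1⟩ := exists_column m hm c s (by rw [hc2, hs2]; ring)
  -- With s² = 1/(8m), a column is all ones with probability about 4ε, where ε = s^(2m). `N` is
  -- chosen so that Nε = 1/8.
  set N := 8 ^ (m - 1) * m ^ m with hN
  set ε := (1 / (8 * m) : ℝ) ^ m with hε
  have hNε : (N : ℝ) * ε = 1 / 8 := by
    obtain ⟨k, rfl⟩ : ∃ k, m = k + 1 := ⟨m - 1, by omega⟩
    rw [hN, hε, Nat.add_sub_cancel]
    push_cast
    push_cast at hm0
    rw [div_pow, one_pow, mul_pow, pow_succ (8 : ℝ) k]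
    field_simp
  have hε0 : 0 < ε := by positivity
  have hε1 : ε ≤ 1 / 16 := by
    calc ε ≤ (1 / (8 * m) : ℝ) ^ 1 := pow_le_pow_of_le_one hs0.le (by linarith) (by omega)
      _ ≤ 1 / 16 := by rw [pow_one]; exact hs
  -- Bernoulli: (1 - 1/(8m))^m ≥ 1 - 1/8.
  have hcm : (7 / 8 : ℝ) ≤ (c ^ 2) ^ m := by
    have h := one_add_mul_le_pow (a := -(1 / (8 * m : ℝ))) (by linarith) m
    rw [hc2, sub_eq_add_neg]
    refine le_trans (le_of_eq ?_) h
    field_simp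
    norm_num
  refine (HasNekomata.of_column m N hm C hW ?_ ?_).mono (by omega) le_rfl
  · rw [hC0, Complex.norm_real, Real.norm_eq_abs, sq_abs, hs2, ← hε, ← pow_mul]
    -- Bernoulli again: (1 - 2ε)^(2N) ≥ 1 - 4Nε = 1/2.
    have h := one_add_mul_le_pow (a := -(2 * ε)) (by linarith) (2 * N)
    rw [← sub_eq_add_neg] at h
    refine le_trans ?_ h
    push_cast
    nlinarith
  · have hδ : ‖run C (basis fun _ => false) fun _ => true‖ ^ 2 = 4 * ε * (c ^ 2) ^ m := by
      rw [hC1, Complex.norm_real, Real.norm_eq_abs, sq_abs, hε, ← hs2]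
      ring
    have hδ1 : ‖run C (basis fun _ => false) fun _ => true‖ ^ 2 ≤ 1 := by
      rw [← sum_norm_sq_run_basis C fun _ => false]
      exact Finset.single_le_sum (f := fun y => ‖run C (basis fun _ => false) y‖ ^ 2)
        (fun y _ => by positivity) (Finset.mem_univ _)
    set δ := ‖run C (basis fun _ => false) fun _ => true‖ ^ 2
    have hδ3 : 3 * ε ≤ δ := by rw [hδ]; nlinarith
    -- Since Nδ ≥ 3/8, (1 - δ)^N ≤ (1 + δ)^(-N) ≤ 8/11, so some column is all ones with probability
    -- at least 3/11.
    have h1 : (1 : ℝ) + N * δ ≤ (1 + δ) ^ N := one_add_mul_le_pow (by linarith) N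
    have h2 : (1 - δ) ^ N * (1 + δ) ^ N ≤ 1 := by
      rw [← mul_pow]
      exact pow_le_one₀ (by nlinarith) (by nlinarith)
    have h3 : (11 / 8 : ℝ) ≤ (1 + δ) ^ N := by
      refine le_trans ?_ h1
      have : (N : ℝ) * (3 * ε) ≤ N * δ := by gcongr
      linarith
    have h4 : (0 : ℝ) ≤ (1 - δ) ^ N := pow_nonneg (by linarith) N
    nlinarith

end Grid

/-! ### Size bookkeeping in powers of 2 ^ (m ^ 2). -/

section Sizes

/-- Sizes are measured in powers of `2 ^ (m ^ 2)`, numbers of copies in powers of `m`. -/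
abbrev expSq (m : ℕ) : ℕ := 2 ^ m ^ 2

theorem one_lt_expSq {m : ℕ} (hm : 2 ≤ m) : 1 < expSq m :=
  Nat.one_lt_two_pow (by positivity)

theorem le_expSq_pow {m : ℕ} (hm : 2 ≤ m) {a r s : ℕ} (h : a ≤ expSq m ^ r) (hrs : r ≤ s) :
    a ≤ expSq m ^ s :=
  h.trans (Nat.pow_le_pow_right (one_lt_expSq hm).le hrs)

theorem add_le_expSq_pow {m : ℕ} (hm : 2 ≤ m) {a b r s : ℕ} (ha : a ≤ expSq m ^ r)
    (hb : b ≤ expSq m ^ s) : a + b ≤ expSq m ^ (r + s + 1) := by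
  have h1 : a ≤ expSq m ^ (r + s) := le_expSq_pow hm ha (by omega)
  have h2 : b ≤ expSq m ^ (r + s) := le_expSq_pow hm hb (by omega)
  have h3 := one_lt_expSq hm
  rw [pow_succ]
  nlinarith [Nat.zero_le (expSq m ^ (r + s))]

theorem mul_le_expSq_pow {m : ℕ} {a b r s : ℕ} (ha : a ≤ expSq m ^ r)
    (hb : b ≤ expSq m ^ s) : a * b ≤ expSq m ^ (r + s) := by
  rw [pow_add]
  exact Nat.mul_le_mul ha hb

theorem pow_le_expSq_pow {m : ℕ} (hm : 2 ≤ m) (r : ℕ) : m ^ r ≤ expSq m ^ r :=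
  Nat.pow_le_pow_left ((Nat.lt_two_pow_self (n := m)).le.trans
    (Nat.pow_le_pow_right (by norm_num) (by nlinarith))) r

end Sizes

/-! ### Fan-out to polynomially many places in `m`. -/

section Copy

/-- Copying a bit, to polynomially many places in `m`. -/
theorem QComp.exists_copy (r : ℕ) : ∃ d c, ∀ m, 2 ≤ m → ∀ (J : Type) [Fintype J] [DecidableEq J],
    Fintype.card J ≤ m ^ r → QComp d (expSq m ^ c) fun (b : Unit → Bool) (_ : J) => b () := by
  have hone : ∀ m, 2 ≤ m →
      QComp 461 (expSq m ^ 4) fun (b : Unit → Bool) (_ : Fin m) => b () := by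
    intro m hm
    have : Nonempty (Fin m) := ⟨⟨0, by omega⟩⟩
    -- Depth: 51 for the nekomata, 4 · 51 + 23 = 227 for parity, 2 · 227 + 7 = 461 for copying.
    refine (QComp.copy_of_parity (QComp.parity (hasNekomata_fin m hm))).mono (by norm_num) ?_
    rw [Fintype.card_fin]
    have h1 : m < 2 ^ m := Nat.lt_two_pow_self
    have h2 : m * (8 ^ (m - 1) * m ^ m) ≤ 2 ^ (3 * m ^ 2) := by
      calc m * (8 ^ (m - 1) * m ^ m) ≤ 2 ^ m * (8 ^ (m - 1) * (2 ^ m) ^ m) := by gcongr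
        _ = 2 ^ (m + 3 * (m - 1) + m * m) := by
            rw [show 8 = 2 ^ 3 by rfl, ← pow_mul, ← pow_mul, pow_add, pow_add, mul_assoc]
        _ ≤ 2 ^ (3 * m ^ 2) := Nat.pow_le_pow_right (by norm_num) (by
            have : 4 * m ≤ 2 * m ^ 2 := by nlinarith
            have : m * m = m ^ 2 := by ring
            omega)
    have h3 : 2 * m + 3 ≤ 2 ^ (3 * m ^ 2) := by
      calc 2 * m + 3 ≤ 2 * 2 ^ m + 2 * 2 ^ m := by omega
        _ = 2 ^ (m + 2) := by rw [pow_add]; ring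
        _ ≤ 2 ^ (3 * m ^ 2) := Nat.pow_le_pow_right (by norm_num) (by nlinarith)
    calc 2 * m + (m * (8 ^ (m - 1) * m ^ m) + 2) + 1
        ≤ 2 ^ (3 * m ^ 2) + 2 ^ (3 * m ^ 2) := by omega
      _ = 2 ^ (3 * m ^ 2 + 1) := by rw [pow_succ]; ring
      _ ≤ 2 ^ (m ^ 2 * 4) := Nat.pow_le_pow_right (by norm_num) (by nlinarith)
      _ = _ := by rw [expSq, ← pow_mul]
  induction r with
  | zero =>
    refine ⟨4, 0, fun m _ J _ _ hJ => ?_⟩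
    rw [pow_zero] at hJ
    have := Fintype.card_le_one_iff_subsingleton.1 hJ
    exact (QComp.proj (⟨fun _ => (), fun _ _ _ => Subsingleton.elim _ _⟩ : J ↪ Unit)).mono le_rfl
      (Nat.zero_le _)
  | succ r ih =>
    obtain ⟨d, c, h⟩ := ih
    refine ⟨2 * (2 * 461 + d) + 4, (1 + r) + ((1 + 4 + 1) + (1 + c) + 1) + 1, fun m hm J _ _ hJ => ?_⟩
    -- First `m` copies, then `m ^ r` copies of each; `QComp.proj` selects as many as `J` needs.
    have h1 : QComp (2 * 461 + d) (m + expSq m ^ 4 + m * expSq m ^ c)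
        fun (b : Unit → Bool) (_ : Σ _ : Fin m, Fin (m ^ r)) => b () := by
      have h2 : QComp d (m * expSq m ^ c) fun (y : Fin m → Bool) (k : Σ _ : Fin m, Fin (m ^ r)) =>
          y k.1 := by
        have := QComp.sigma (I := Fin m) fun _ => h m hm (Fin (m ^ r)) (by simp)
        rw [Fintype.card_fin] at this
        exact this.reindex (Equiv.sigmaUnique (Fin m) fun _ => Unit).toEmbedding (Equiv.refl _)
          fun _ _ => rfl
      refine (QComp.comp h2 (hone m hm)).mono le_rfl ?_
      rw [Fintype.card_fin]
    have hc : Fintype.card (Σ _ : Fin m, Fin (m ^ r)) = m * m ^ r := by simp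
    obtain ⟨f⟩ : Nonempty (J ↪ Σ _ : Fin m, Fin (m ^ r)) := by
      rw [Embedding.nonempty_iff_card_le, hc]
      rw [pow_succ'] at hJ
      exact hJ
    refine (QComp.comp (QComp.proj f) h1).mono le_rfl ?_
    rw [hc, add_zero]
    have hm1 : m ≤ expSq m ^ 1 := by simpa using pow_le_expSq_pow hm 1
    exact add_le_expSq_pow hm (mul_le_expSq_pow hm1 (pow_le_expSq_pow hm r))
      (add_le_expSq_pow hm (add_le_expSq_pow hm hm1 le_rfl) (mul_le_expSq_pow hm1 le_rfl))

/-- Evaluating polynomially many functions in `m` on the same input. -/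
theorem QComp.exists_fork (r t s : ℕ) : ∃ d c, ∀ m, 2 ≤ m → ∀ (d' : ℕ) (J ι : Type) [Fintype J]
    [DecidableEq J] [Fintype ι] [DecidableEq ι] (κ : J → Type) [∀ j, DecidableEq (κ j)]
    (g : ∀ j, (ι → Bool) → κ j → Bool), Fintype.card J ≤ m ^ r → Fintype.card ι ≤ expSq m ^ t →
    (∀ j, QComp d' (expSq m ^ s) (g j)) →
    QComp (d + d') (expSq m ^ c) fun x (k : Σ j, κ j) => g k.1 x k.2 := by
  obtain ⟨d, c, h⟩ := QComp.exists_copy r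
  refine ⟨2 * d, ((t + r) + (t + c) + 1) + (r + s) + 1,
    fun m hm d' J ι _ _ _ _ κ _ g hJ hι hg => ?_⟩
  have hJ' := hJ.trans (pow_le_expSq_pow hm r)
  exact (QComp.fork (h m hm J hJ) hg).mono le_rfl (add_le_expSq_pow hm (add_le_expSq_pow hm
    (mul_le_expSq_pow hι hJ') (mul_le_expSq_pow hι le_rfl)) (mul_le_expSq_pow hJ' le_rfl))

end Copy

/-! ### Exact counting of few bits by a Fourier test. -/

section Count

/-- With `t` read in binary this is the geometric sum of the powers of ρ below 2^e; it factors as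
∏(1 + ρ^(2^j)), which telescopes to ρ^(2^e) - 1 when multiplied by ρ - 1. -/
theorem sum_prod_ite_pow (e : ℕ) (ρ : ℂ) (h1 : ρ ≠ 1) (h : ρ ^ 2 ^ e = 1) :
    ∑ t : Fin e → Bool, ∏ j, (if t j then ρ ^ 2 ^ (j : ℕ) else 1) = 0 := by
  have h2 : ∏ j : Fin e, ∑ b : Bool, (if b then ρ ^ 2 ^ (j : ℕ) else 1) = 0 := by
    simp only [Fintype.sum_bool, if_true, Bool.false_eq_true, if_false]
    rw [Fin.prod_univ_eq_prod_range (fun j => ρ ^ 2 ^ j + 1) e]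
    refine (mul_eq_zero.1 (?_ : (ρ - 1) * _ = 0)).resolve_left (sub_ne_zero.2 h1)
    rw [← sub_eq_zero.2 h]
    clear h
    induction e with
    | zero => simp
    | succ e ih => rw [Finset.prod_range_succ, ← mul_assoc, ih, pow_succ, pow_mul]; ring
  rw [← h2, Finset.prod_univ_sum, Fintype.piFinset_univ]

variable {β : Type} [Fintype β] [DecidableEq β] [Nonempty β]

/-- Testing the number of ones, for an input that is given `e` times. -/
theorem QCompOn.countCopies (e : ℕ) [NeZero e] {dc sc k : ℕ} (hβ : Fintype.card β < 2 ^ e)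
    (hk : k < 2 ^ e) (hc : QComp dc sc fun (b : Unit → Bool) (_ : β) => b ()) :
    QCompOn {x : Fin e × β → Bool | ∀ j b, x (j, b) = x (0, b)} (4 * (1 + dc) + 23)
      (2 * (e * Fintype.card β) + (e + e * sc))
      fun x (_ : Unit) => decide (popcount (fun b => x (0, b)) = k) := by
  have hcp : QComp dc (e * sc) fun (t : Fin e → Bool) (p : Fin e × β) => t p.1 := by
    have := QComp.sigma (I := Fin e) fun _ => hc
    rw [Fintype.card_fin] at this
    exact this.reindex (Equiv.sigmaUnique (Fin e) fun _ => Unit).toEmbedding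
      (Equiv.sigmaEquivProd _ _) fun _ _ => rfl
  obtain ⟨A, _, _, T, hTW, hTl, hA, hT⟩ := hcp
  obtain ⟨b₀⟩ := ‹Nonempty β›
  have : Nonempty (Fin e × β) := ⟨(0, b₀)⟩
  let eG : Fin e ↪ (Fin e × β) ⊕ Fin e ⊕ A := ⟨fun g => .inr (.inl g), fun g g' => by simp⟩
  let eT : Fin e ⊕ (Fin e × β) ⊕ A ↪ (Fin e × β) ⊕ Fin e ⊕ A :=
    ⟨Sum.elim (fun g => .inr (.inl g)) (Sum.elim .inl fun a => .inr (.inr a)),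
      by rintro (g | i | a) (g' | i' | a') <;> simp⟩
  let w : (Fin e → Bool) → (Fin e × β → Bool) → (Fin e × β) ⊕ Fin e ⊕ A → Bool :=
    fun t y => Sum.elim y (Sum.elim t fun _ => false)
  set G := gateLayer (Fin e) hGate
  have hG : run (G.embed eG) (basis fun _ => false)
      = ∑ t, run G (basis fun _ => false) t • basis (w t fun _ => false) := by
    refine run_embed_zero eG G (fun _ _ => rfl) ?_
    rintro t (i | g | a) hq
    · rfl
    · exact absurd rfl (hq g)
    · rfl
  have hTt : ∀ t, run (T.embed eT) (basis (w t fun _ => false)) = basis (w t fun p => t p.1) := by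
    intro t
    refine run_embed_basis (hT t (Set.mem_univ _)) ?_ ?_ ?_
    · rintro (g | i | a) <;> rfl
    · rintro (g | i | a) <;> rfl
    · rintro (i | g | a) hq
      · exact absurd rfl (hq (.inr (.inl i)))
      · rfl
      · rfl
  have hrun : run (G.embed eG ++ T.embed eT) (basis fun _ => false)
      = ∑ t, run G (basis fun _ => false) t • basis (w t fun p => t p.1) := by
    rw [run_append, Module.End.mul_apply, hG, map_sum]
    simp only [map_smul, hTt]
  have hwi : Injective fun t => w t fun p => t p.1 := by
    intro x y hxy
    funext g
    exact congrFun hxy (.inr (.inl g))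
  have hGn : ∀ t, ‖run G (basis fun _ => false) t‖ ^ 2 = (1 / 2 : ℝ) ^ e := by
    intro t
    rw [run_gateLayer_basis, norm_prod, ← Finset.prod_pow]
    have : ∀ j, ‖(hGate : Matrix Bool Bool ℂ) (t j) false‖ ^ 2 = 1 / 2 := by
      intro j
      simp [hGate]
    simp only [this, Finset.prod_const, Finset.card_univ, Fintype.card_fin]
  obtain ⟨ζ, hζ⟩ : ∃ ζ : ℂ, IsPrimitiveRoot ζ (2 ^ e) :=
    ⟨_, Complex.isPrimitiveRoot_exp (2 ^ e) (by positivity)⟩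
  have hζn : ‖ζ‖ = 1 := hζ.norm'_eq_one (by positivity)
  have hζ0 : ζ ≠ 0 := by rintro rfl; simp at hζn
  -- If `t` encodes τ in binary, the total phase is ζ^(τ(|x| - k)). The correction by -k must occur
  -- once for each digit, hence only at `b₀`.
  let ω : Fin e × β → ℂ := fun p => ζ ^ 2 ^ (p.1 : ℕ)
  let φ : Fin e × β → ℂ := fun p => if p.2 = b₀ then (ζ⁻¹ ^ k) ^ 2 ^ (p.1 : ℕ) else 1
  have hphase : ∀ x : Fin e × β → Bool, (∀ j b, x (j, b) = x (0, b)) → ∀ t : Fin e → Bool,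
      ctrlPhase ω φ x (fun p => t p.1) = ∏ j, if t j then
        (ζ ^ popcount (fun b => x (0, b)) * ζ⁻¹ ^ k) ^ 2 ^ (j : ℕ) else 1 := by
    intro x hx t
    rw [ctrlPhase, Fintype.prod_prod_type, Fintype.prod_prod_type, ← Finset.prod_mul_distrib]
    refine Finset.prod_congr rfl fun j _ => ?_
    simp only [hx j]
    by_cases htj : t j = true
    swap
    · rw [if_neg htj]
      refine (congrArg₂ (· * ·) (Finset.prod_eq_one fun b _ => if_neg ?_)
        (Finset.prod_eq_one fun b _ => if_neg htj)).trans (mul_one 1)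
      simp [htj]
    · simp only [htj, ω, φ, Bool.and_true, if_true, Finset.prod_ite_eq', Finset.mem_univ]
      rw [Finset.prod_ite, Finset.prod_const_one, mul_one, Finset.prod_const, mul_pow, ← pow_mul,
        ← pow_mul, popcount, mul_comm]
      ring
  have hlen : (G.embed eG ++ T.embed eT).length ≤ 1 + dc := by
    simp only [List.length_append, Layers.length_embed]
    exact add_le_add (length_gateLayer _) hTl
  refine (QCompOn.phaseTest (G.embed eG ++ T.embed eT)
    (((wf_gateLayer _).embed eG).append (hTW.embed eT)) ω φ (fun i => ?_) (fun i => ?_) _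
    (fun x => decide (popcount (fun b => x (0, b)) = k)) ?_ ?_).mono ?_ ?_
  · simp [ω, hζn]
  · simp only [φ]
    split_ifs <;> simp [hζn]
  · intro x hx hg z hz
    obtain ⟨t, rfl⟩ : ∃ t, z = w t fun p => t p.1 := by
      by_contra! h
      apply hz
      rw [hrun, Finset.sum_apply]
      refine Finset.sum_eq_zero fun t _ => ?_
      rw [Pi.smul_apply, basis_apply, if_neg (h t), smul_zero]
    refine (hphase x hx t).trans (Finset.prod_eq_one fun j _ => ?_)
    rw [of_decide_eq_true hg, ← mul_pow, mul_inv_cancel₀ hζ0, one_pow, one_pow, ite_self]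
  · intro x hx hg
    have h := sum_norm_sq_sum_basis hwi (run G (basis fun _ => false))
      fun z => ctrlPhase ω φ x fun i => z (.inl i)
    rw [← hrun] at h
    simp only [Complex.real_smul] at h
    refine h.trans ?_
    simp only [hGn]
    rw [← Finset.mul_sum]
    refine mul_eq_zero_of_right _ ?_
    rw [← sum_prod_ite_pow e (ζ ^ popcount (fun b => x (0, b)) * ζ⁻¹ ^ k)]
    · exact Finset.sum_congr rfl fun t _ => hphase x hx t
    · intro h
      rw [inv_pow, mul_inv_eq_one₀ (pow_ne_zero _ hζ0)] at h
      -- Both counts are below the order 2^e of ζ, so equal powers would force equal counts.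
      refine of_decide_eq_false hg (hζ.pow_inj ?_ hk h)
      exact (Finset.card_le_univ _).trans_lt hβ
    · rw [mul_pow, inv_pow, inv_pow, pow_right_comm, hζ.pow_eq_one, pow_right_comm ζ k,
        hζ.pow_eq_one]
      simp
  · omega
  · simp only [Fintype.card_sum, Fintype.card_prod, Fintype.card_fin]
    omega

end Count

/-- Testing whether the number of ones is `k`, for inputs of polynomial length in `m`. -/
theorem QComp.exists_count (r : ℕ) : ∃ d c, ∀ m, 2 ≤ m → ∀ (β : Type) [Fintype β] [DecidableEq β]
    [Nonempty β] (k : ℕ), Fintype.card β ≤ m ^ r → k ≤ Fintype.card β →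
    QComp d (expSq m ^ c) fun (y : β → Bool) (_ : Unit) => decide (popcount y = k) := by
  obtain ⟨d, c, h⟩ := QComp.exists_copy (r + 1)
  refine ⟨2 * d + (4 * (1 + d) + 23), ((r + 1) + r + (r + c) + 1) + ((1 + ((r + 1) + r)) +
    ((r + 1) + ((r + 1) + c) + 1) + 1) + 1, fun m hm β _ _ _ k hβ hk => ?_⟩
  -- Large enough for m^r < 2^e, yet itself at most a power of `m`, so that fan-out still provides
  -- the copies.
  · set e := r * m + 1
    have : NeZero e := ⟨by omega⟩
    have hme : m ^ r < 2 ^ e := by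
      calc m ^ r ≤ (2 ^ m) ^ r := Nat.pow_le_pow_left Nat.lt_two_pow_self.le r
        _ = 2 ^ (r * m) := by rw [← pow_mul, mul_comm]
        _ < 2 ^ e := Nat.pow_lt_pow_right (by norm_num) (by omega)
    have her : e ≤ m ^ (r + 1) := by
      have h1 : r + 1 ≤ m ^ r := (Nat.lt_two_pow_self (n := r)).trans_le (Nat.pow_le_pow_left hm r)
      rw [pow_succ]
      have : (r + 1) * m ≤ m ^ r * m := Nat.mul_le_mul_right m h1
      simp only [e]
      nlinarith
    have hcp : QComp d (Fintype.card β * expSq m ^ c)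
        fun (y : β → Bool) (p : Fin e × β) => y p.2 := by
      have := QComp.sigma (I := β) fun _ => h m hm (Fin e) (by simpa using her)
      exact this.reindex (Equiv.sigmaUnique β fun _ => Unit).toEmbedding
        ((Equiv.sigmaEquivProd _ _).trans (Equiv.prodComm _ _)) fun _ _ => rfl
    have hct := QCompOn.countCopies e (hβ.trans_lt hme) ((hk.trans hβ).trans_lt hme)
      (h m hm β (hβ.trans (Nat.pow_le_pow_right (by omega) (by omega))))
    -- The promise that the `e` input copies agree holds because they were just made.
    refine (QCompOn.comp hct hcp fun y _ j b => rfl).mono le_rfl ?_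
    have he := her.trans (pow_le_expSq_pow hm _)
    have hb := hβ.trans (pow_le_expSq_pow hm _)
    have h2 : 2 ≤ expSq m ^ 1 := by rw [pow_one]; exact one_lt_expSq hm
    rw [Fintype.card_prod, Fintype.card_fin]
    exact add_le_expSq_pow hm (add_le_expSq_pow hm (mul_le_expSq_pow he hb)
      (mul_le_expSq_pow hb le_rfl)) (add_le_expSq_pow hm (mul_le_expSq_pow h2
      (mul_le_expSq_pow he hb)) (add_le_expSq_pow hm he (mul_le_expSq_pow he le_rfl)))

/-! ### Derandomization by repeated halving. -/

section Halving

/-- If every point is bad for at most half of the choices, then `l` choices leave at most a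
`2⁻ˡ`-fraction of the points that are bad for all of them. -/
theorem exists_halving {Y Z : Type} [Fintype Y] [Fintype Z] [Nonempty Z] (bad : Y → Z → Prop)
    [∀ y, DecidablePred (bad y)] (h : ∀ y, 2 * (Finset.univ.filter (bad y)).card ≤ Fintype.card Z)
    (l : ℕ) : ∃ z : Fin l → Z,
      2 ^ l * (Finset.univ.filter fun y => ∀ i, bad y (z i)).card ≤ Fintype.card Y := by
  induction l with
  | zero => exact ⟨Fin.elim0, by simp⟩
  | succ l ih =>
    obtain ⟨z, hz⟩ := ih
    set S := Finset.univ.filter fun y => ∀ i, bad y (z i)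
    -- Averaging: over all choices, the surviving points are bad at most half of the time.
    obtain ⟨z₀, hz₀⟩ : ∃ z₀, 2 * (S.filter fun y => bad y z₀).card ≤ S.card := by
      by_contra! hc
      have h1 : ∑ z₀, S.card < ∑ z₀, 2 * (S.filter fun y => bad y z₀).card :=
        Finset.sum_lt_sum_of_nonempty Finset.univ_nonempty fun z₀ _ => hc z₀
      have h2 : ∑ z₀, (S.filter fun y => bad y z₀).card
          = ∑ y ∈ S, (Finset.univ.filter (bad y)).card := by
        simp only [Finset.card_filter]
        exact Finset.sum_comm
      have h3 : ∑ y ∈ S, 2 * (Finset.univ.filter (bad y)).card ≤ ∑ y ∈ S, Fintype.card Z :=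
        Finset.sum_le_sum fun y _ => h y
      rw [← Finset.mul_sum] at h1 h3
      rw [h2] at h1
      simp only [Finset.sum_const, smul_eq_mul, Finset.card_univ] at h1 h3
      rw [mul_comm S.card] at h3
      omega
    refine ⟨Fin.cons z₀ z, ?_⟩
    have : (Finset.univ.filter fun y => ∀ i, bad y ((Fin.cons z₀ z : Fin (l + 1) → Z) i))
        = S.filter fun y => bad y z₀ := by
      ext y
      simp [S, Fin.forall_fin_succ, and_comm]
    rw [this, pow_succ, mul_assoc]
    exact (Nat.mul_le_mul_left _ hz₀).trans hz

end Halving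

/-! ### Hash families that separate small sets. -/

section Hash

variable {ι : Type} [Fintype ι] [DecidableEq ι]

/-- A function that collides at `i` and `j` can be reassigned at `i` in `B` ways; its old value
there is remembered at `j`, so all results differ. -/
theorem card_mul_card_filter_eq_le {B : ℕ} {i j : ι} (hij : i ≠ j) :
    B * (Finset.univ.filter fun h : ι → Fin B => h i = h j).card
      ≤ Fintype.card (ι → Fin B) := by
  have : Fintype.card (Fin B × {h : ι → Fin B // h i = h j}) ≤ Fintype.card (ι → Fin B) := by
    refine Fintype.card_le_of_injective (fun p => update p.2.1 i p.1) ?_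
    rintro ⟨b, h, hh⟩ ⟨b', h', hh'⟩ he
    have hb : b = b' := by simpa using congrFun he i
    have hn : ∀ q, q ≠ i → h q = h' q := fun q hq => by simpa [hq] using congrFun he q
    have : h = h' := by
      funext q
      by_cases hq : q = i
      · rw [hq, hh, hh', hn j hij.symm]
      · exact hn q hq
    simp [hb, this]
  simpa [Fintype.card_subtype] using this

/-- Few functions into `2 * K ^ 2` buckets such that every set of size at most `K` is separated by
one of them. -/
theorem exists_hash (K l : ℕ) (hK : 0 < K) (hl : Fintype.card ι ^ K < 2 ^ l) :
    ∃ h : Fin l → ι → Fin (2 * K ^ 2), ∀ S : Finset ι, S.Nonempty → S.card ≤ K →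
      ∃ a, Set.InjOn (h a) S := by
  classical
  have hB : 0 < 2 * K ^ 2 := by positivity
  have : NeZero (2 * K ^ 2) := ⟨hB.ne'⟩
  -- A union bound over K² pairs, each colliding with probability at most 1/(2K²), makes every tuple
  -- bad for at most half of the functions.
  obtain ⟨z, hz⟩ := exists_halving (Y := Fin K → ι) (Z := ι → Fin (2 * K ^ 2))
    (fun y h => ∃ p : Fin K × Fin K, y p.1 ≠ y p.2 ∧ h (y p.1) = h (y p.2)) (fun y => by
      refine le_of_mul_le_mul_left (a := K ^ 2) ?_ (by positivity)
      calc K ^ 2 * (2 * (Finset.univ.filter fun h : ι → Fin (2 * K ^ 2) =>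
            ∃ p : Fin K × Fin K, y p.1 ≠ y p.2 ∧ h (y p.1) = h (y p.2)).card)
          ≤ K ^ 2 * (2 * ∑ p : Fin K × Fin K, (Finset.univ.filter fun h : ι → Fin (2 * K ^ 2) =>
            y p.1 ≠ y p.2 ∧ h (y p.1) = h (y p.2)).card) := by
            gcongr
            refine (Finset.card_le_card ?_).trans Finset.card_biUnion_le
            intro h hh
            simpa using hh
        _ = ∑ p : Fin K × Fin K, 2 * K ^ 2 * (Finset.univ.filter fun h : ι → Fin (2 * K ^ 2) =>
            y p.1 ≠ y p.2 ∧ h (y p.1) = h (y p.2)).card := by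
            rw [← Finset.mul_sum]; ring
        _ ≤ ∑ p : Fin K × Fin K, Fintype.card (ι → Fin (2 * K ^ 2)) := by
            refine Finset.sum_le_sum fun p _ => ?_
            by_cases hp : y p.1 = y p.2
            · simp [hp]
            · simpa [hp] using card_mul_card_filter_eq_le hp
        _ = _ := by
              rw [Finset.sum_const, Finset.card_univ, Fintype.card_prod, Fintype.card_fin,
                smul_eq_mul, pow_two]) l
  -- There are fewer than 2^l tuples, so a 2^(-l)-fraction of them is empty.
  have hz0 : (Finset.univ.filter fun y : Fin K → ι => ∀ i, ∃ p : Fin K × Fin K,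
      y p.1 ≠ y p.2 ∧ z i (y p.1) = z i (y p.2)).card = 0 := by
    by_contra hne
    have : 2 ^ l * 1 ≤ Fintype.card (Fin K → ι) :=
      le_trans (Nat.mul_le_mul_left _ (Nat.one_le_iff_ne_zero.2 hne)) hz
    simp at this
    omega
  refine ⟨z, fun S ⟨i₀, hi₀⟩ hS => ?_⟩
  -- A smaller set is listed as a `K`-tuple by repeating its element `i₀`.
  let y : Fin K → ι := fun a => if ha : a.1 < S.card then (S.equivFin.symm ⟨a, ha⟩).1 else i₀
  rw [Finset.card_eq_zero, Finset.filter_eq_empty_iff] at hz0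
  have hy := hz0 (Finset.mem_univ y)
  push Not at hy
  obtain ⟨a, ha⟩ := hy
  have hsur : ∀ i ∈ S, ∃ b, y b = i := fun i hi =>
    ⟨⟨S.equivFin ⟨i, hi⟩, (S.equivFin ⟨i, hi⟩).2.trans_le hS⟩, by simp [y]⟩
  refine ⟨a, fun i hi j hj hij => ?_⟩
  obtain ⟨b, rfl⟩ := hsur i hi
  obtain ⟨b', rfl⟩ := hsur j hj
  by_contra hne
  exact ha (b, b') hne hij

end Hash

/-! ### Thresholds near the two ends, and symmetric functions with a constant middle. -/

section Threshold

theorem eq_xor_decide {a b : Bool} {P : Prop} [Decidable P] (h : P ↔ b = a) :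
    b = xor (!a) (decide P) := by
  by_cases hP : P <;> cases a <;> cases b <;> simp_all

theorem QComp.comp_expSq {m : ℕ} (hm : 2 ≤ m) {ι κ μ : Type} [DecidableEq ι] [DecidableEq κ]
    [DecidableEq μ] [Fintype κ] {d d' s s' t : ℕ} {g : (ι → Bool) → κ → Bool}
    {h : (κ → Bool) → μ → Bool} (hh : QComp d' (expSq m ^ s') h) (hg : QComp d (expSq m ^ s) g)
    (hκ : Fintype.card κ ≤ expSq m ^ t) :
    QComp (2 * d + d') (expSq m ^ (t + s + 1 + s' + 1)) fun x => h (g x) :=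
  (QComp.comp hh hg).mono le_rfl
    (add_le_expSq_pow hm (add_le_expSq_pow hm hκ le_rfl) le_rfl)

variable {ι : Type} [Fintype ι] [DecidableEq ι]

/-- The buckets that contain an element `i` with `x i ≠ b`. -/
def hits {B : ℕ} (b : Bool) (h : ι → Fin B) (x : ι → Bool) (k : Fin B) : Bool :=
  decide (∃ i, h i = k ∧ x i ≠ b)

theorem QComp.hits {B : ℕ} (b : Bool) (h : ι → Fin B) : QComp 4 0 (hits b h) := by
  have h1 := QComp.sigma (I := Fin B) fun k =>
    QComp.pattern (ι := {i // h i = k}) (fun _ => b) true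
  rw [mul_zero] at h1
  refine h1.reindex (Equiv.sigmaFiberEquiv h).toEmbedding (Equiv.sigmaUnique _ _) ?_
  rintro x ⟨k, ⟨⟩⟩
  rw [Bool.eq_iff_iff]
  simp [_root_.hits, Equiv.sigmaUnique, Equiv.sigmaFiberEquiv]

/-- Hashing can only merge elements, so no hash function overestimates the count; this makes the
disjunction over all of them sound. -/
theorem popcount_hits_le {B : ℕ} (b : Bool) (h : ι → Fin B) (x : ι → Bool) :
    popcount (hits b h x) ≤ popcount fun i => xor b (x i) := by
  classical
  refine (Finset.card_le_card (t := (Finset.univ.filter fun i => (xor b (x i)) = true).image h)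
    ?_).trans Finset.card_image_le
  intro k hk
  simp only [hits, Finset.mem_filter, Finset.mem_univ, true_and, decide_eq_true_eq] at hk
  obtain ⟨i, rfl, hi⟩ := hk
  refine Finset.mem_image_of_mem h (Finset.mem_filter.2 ⟨Finset.mem_univ _, ?_⟩)
  cases b <;> cases hx : x i <;> simp_all

theorem le_popcount_hits {B : ℕ} (b : Bool) (h : ι → Fin B) (x : ι → Bool) (S : Finset ι)
    (hS : ∀ i ∈ S, x i ≠ b) (hh : Set.InjOn h S) : S.card ≤ popcount (hits b h x) := by
  classical
  rw [← Finset.card_image_of_injOn hh]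
  refine Finset.card_le_card fun k hk => ?_
  obtain ⟨i, hi, rfl⟩ := Finset.mem_image.1 hk
  simp only [hits, Finset.mem_filter, Finset.mem_univ, true_and, decide_eq_true_eq]
  exact ⟨i, rfl, hS i hi⟩

/-- The number of ones is at least `k` if and only if this is so for the buckets that are hit. -/
theorem le_popcount_iff {K l : ℕ} (hl : 0 < l) {h : Fin l → ι → Fin (2 * K ^ 2)}
    (hh : ∀ S : Finset ι, S.Nonempty → S.card ≤ K → ∃ a, Set.InjOn (h a) S) (b : Bool)
    (x : ι → Bool) {k : ℕ} (hk : k ≤ K) :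
    (∃ a, k ≤ popcount (hits b (h a) x)) ↔ k ≤ popcount fun i => xor b (x i) := by
  refine ⟨fun ⟨a, ha⟩ => ha.trans (popcount_hits_le _ _ _), fun hx => ?_⟩
  rcases k.eq_zero_or_pos with rfl | hk0
  · exact ⟨⟨0, hl⟩, Nat.zero_le _⟩
  · obtain ⟨S, hS, rfl⟩ := Finset.exists_subset_card_eq hx
    obtain ⟨a, ha⟩ := hh S (Finset.card_pos.1 hk0) hk
    refine ⟨a, le_popcount_hits b _ x S (fun i hi => ?_) ha⟩
    have := (Finset.mem_filter.1 (hS hi)).2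
    cases b <;> cases hx : x i <;> simp_all

/-- Comparing the number of ones with all polynomially small numbers. -/
theorem QComp.exists_threshold (r : ℕ) : ∃ d c, ∀ m, 2 ≤ m → ∀ (ι : Type) [Fintype ι]
    [DecidableEq ι] (b : Bool), Fintype.card ι ≤ expSq m ^ 1 →
    QComp d (expSq m ^ c) fun (x : ι → Bool) (k : Fin (m ^ r + 1)) =>
      decide ((k : ℕ) ≤ popcount fun i => xor b (x i)) := by
  obtain ⟨d₁, c₁, hcount⟩ := QComp.exists_count (2 * r + 1)
  obtain ⟨d₂, c₂, hfork₂⟩ := QComp.exists_fork (2 * r + 2) (2 * r + 1) c₁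
  obtain ⟨d₃, c₃, hfork₃⟩ := QComp.exists_fork (r + 3) 1 ((2 * r + 1) + 0 + 1 + c₂ + 1)
  obtain ⟨d₄, c₄, hfork₄⟩ := QComp.exists_fork (r + 1) ((r + 3) + (2 * r + 2)) 0
  -- Depth and exponent are left open here; the compositions below determine them independently of
  -- `m`.
  apply Exists.intro
  apply Exists.intro
  intro m hm ι _ _ b hι
  have hm0 : 0 < m := by omega
  have hone : ∀ s, 1 ≤ m ^ s := fun s => Nat.one_le_pow _ _ hm0
  have hsucc : ∀ s, m ^ s + 1 ≤ m ^ (s + 1) := fun s => by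
    rw [pow_succ]; nlinarith [hone s]
  set K := m ^ r with hKdef
  have hK : 0 < K := hone r
  -- As |ι| ≤ 2^(m²), there are at most 2^(m²K) tuples of length `K`, fewer than 2^l.
  set l := m ^ 2 * K + 1 with hl
  set B := 2 * K ^ 2 with hB
  obtain ⟨h, hh⟩ : ∃ h : Fin l → ι → Fin B, ∀ S : Finset ι, S.Nonempty → S.card ≤ K →
      ∃ a, Set.InjOn (h a) S := exists_hash (ι := ι) K l hK (by
    calc Fintype.card ι ^ K ≤ (expSq m ^ 1) ^ K := Nat.pow_le_pow_left hι K
      _ = 2 ^ (m ^ 2 * K) := by rw [pow_one, ← pow_mul]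
      _ < 2 ^ l := Nat.pow_lt_pow_right (by norm_num) (by omega))
  have : NeZero B := ⟨by positivity⟩
  have hBm : B ≤ m ^ (2 * r + 1) := by
    calc B ≤ m * K ^ 2 := Nat.mul_le_mul_right _ hm
      _ = m ^ (2 * r + 1) := by rw [hKdef]; ring
  have hB1m : B + 1 ≤ m ^ (2 * r + 2) := (Nat.add_le_add_right hBm 1).trans (hsucc _)
  have hlm : l ≤ m ^ (r + 3) := by
    calc l = m ^ (r + 2) + 1 := by rw [hl, hKdef]; ring
      _ ≤ m ^ (r + 3) := hsucc _
  have h2 : QComp (d₂ + d₁) (expSq m ^ c₂) fun (y : Fin B → Bool) (p : Σ _ : Fin (B + 1), Unit) =>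
      decide (popcount y = p.1) := by
    refine hfork₂ m hm d₁ (Fin (B + 1)) (Fin B) (fun _ => Unit)
      (fun k y _ => decide (popcount y = k)) ?_ ?_ fun k => hcount m hm _ _ ?_ ?_
    · simpa using hB1m
    · simpa using hBm.trans (pow_le_expSq_pow hm _)
    · simpa using hBm
    · simpa using k.is_le
  have h3 : ∀ a, QComp (2 * 4 + (d₂ + d₁)) (expSq m ^ ((2 * r + 1) + 0 + 1 + c₂ + 1))
      fun (x : ι → Bool) (p : Σ _ : Fin (B + 1), Unit) =>
        decide (popcount (_root_.hits b (h a) x) = p.1) := fun a =>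
    QComp.comp_expSq (t := 2 * r + 1) (s := 0) hm h2 ((QComp.hits b (h a)).mono le_rfl (Nat.zero_le _))
      (by rw [Fintype.card_fin]; exact hBm.trans (pow_le_expSq_pow hm _))
  have h4 : QComp (d₃ + (2 * 4 + (d₂ + d₁))) (expSq m ^ c₃)
      fun (x : ι → Bool) (p : Σ _ : Fin l, Σ _ : Fin (B + 1), Unit) =>
        decide (popcount (_root_.hits b (h p.1) x) = p.2.1) :=
    hfork₃ m hm _ (Fin l) ι (fun _ => Σ _ : Fin (B + 1), Unit)
      (fun a x p => decide (popcount (_root_.hits b (h a) x) = p.1)) (by simpa using hlm) hι h3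
  have hcard : Fintype.card (Σ _ : Fin l, Σ _ : Fin (B + 1), Unit)
      ≤ expSq m ^ ((r + 3) + (2 * r + 2)) := by
    simpa using mul_le_expSq_pow (hlm.trans (pow_le_expSq_pow hm _))
      (hB1m.trans (pow_le_expSq_pow hm _))
  -- The count is at least k iff under some hash function the number of hit buckets equals some k' ≥
  -- k; the exact counts are available from `h4`.
  have h5 : QComp (d₄ + 4) (expSq m ^ c₄)
      fun (y : (Σ _ : Fin l, Σ _ : Fin (B + 1), Unit) → Bool) (k : Σ _ : Fin (K + 1), Unit) =>
        decide (∃ p : {p : Σ _ : Fin l, Σ _ : Fin (B + 1), Unit // (k.1 : ℕ) ≤ p.2.1},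
          y p.1 = true) := by
    refine hfork₄ m hm 4 (Fin (K + 1)) _ (fun _ => Unit) (fun k y _ =>
      decide (∃ p : {p : Σ _ : Fin l, Σ _ : Fin (B + 1), Unit // (k : ℕ) ≤ p.2.1},
        y p.1 = true)) ?_ hcard fun k => ?_
    · simpa using hsucc r
    · refine ((QComp.or (ι := {p : Σ _ : Fin l, Σ _ : Fin (B + 1), Unit //
        (k : ℕ) ≤ p.2.1})).reindex (Embedding.subtype _) (Equiv.refl _) ?_).mono le_rfl
          (Nat.zero_le _)
      intro x k
      rfl
  refine (QComp.comp_expSq hm h5 h4 hcard).reindex (Embedding.refl _) (Equiv.sigmaUnique _ _) ?_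
  rintro x ⟨k, ⟨⟩⟩
  change decide ((k : ℕ) ≤ popcount fun i => xor b (x i)) = decide
    (∃ p : {p : Σ _ : Fin l, Σ _ : Fin (B + 1), Unit // (k : ℕ) ≤ p.2.1},
      decide (popcount (_root_.hits b (h p.1.1) x) = p.1.2.1) = true)
  rw [Bool.eq_iff_iff]
  simp only [decide_eq_true_eq]
  refine (le_popcount_iff (by omega) hh b x k.is_le).symm.trans ⟨?_, ?_⟩
  · rintro ⟨a, ha⟩
    have hlt : popcount (_root_.hits b (h a) x) < B + 1 := by
      have := Finset.card_le_univ (Finset.univ.filter fun k => _root_.hits b (h a) x k = true)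
      rw [Fintype.card_fin] at this
      exact Nat.lt_succ_of_le this
    exact ⟨⟨⟨a, ⟨_, hlt⟩, ()⟩, ha⟩, rfl⟩
  · rintro ⟨⟨⟨a, k', ⟨⟩⟩, hk⟩, ha⟩
    exact ⟨a, hk.trans (le_of_eq ha.symm)⟩

/-- Symmetric functions that are constant except for few or many ones. -/
theorem QComp.exists_boundary (r : ℕ) : ∃ d c, ∀ m, 2 ≤ m → ∀ (ι : Type) [Fintype ι]
    [DecidableEq ι] (bad : Set (Bool × Fin (m ^ r))) (a : Bool), Fintype.card ι ≤ expSq m ^ 1 →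
    ∀ g : (ι → Bool) → Bool,
    (∀ x, g x ≠ a ↔ ∃ p ∈ bad, popcount (fun i => xor p.1 (x i)) = p.2) →
    QComp d (expSq m ^ c) fun (x : ι → Bool) (_ : Unit) => g x := by
  obtain ⟨d₁, c₁, hth⟩ := QComp.exists_threshold r
  obtain ⟨d₂, c₂, hfork₂⟩ := QComp.exists_fork 1 1 c₁
  obtain ⟨d₃, c₃, hfork₃⟩ := QComp.exists_fork (r + 1) (1 + (r + 1)) 0
  apply Exists.intro
  apply Exists.intro
  intro m hm ι _ _ bad a hι g hg
  classical
  have hm0 : 0 < m := by omega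
  have hsucc : m ^ r + 1 ≤ m ^ (r + 1) := by
    rw [pow_succ]; nlinarith [Nat.one_le_pow r m hm0]
  have h1 : QComp (d₂ + d₁) (expSq m ^ c₂) fun (x : ι → Bool) (p : Σ _ : Bool, Fin (m ^ r + 1)) =>
      decide ((p.2 : ℕ) ≤ popcount fun i => xor p.1 (x i)) :=
    hfork₂ m hm d₁ Bool ι (fun _ => Fin (m ^ r + 1)) (fun b x k => decide
      ((k : ℕ) ≤ popcount fun i => xor b (x i))) (by simpa using hm) hι fun b => hth m hm ι b hι
  have hcard : Fintype.card (Σ _ : Bool, Fin (m ^ r + 1)) ≤ expSq m ^ (1 + (r + 1)) := by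
    simpa using mul_le_expSq_pow (pow_le_expSq_pow hm 1 |>.trans' (by simpa using hm))
      (hsucc.trans (pow_le_expSq_pow hm _))
  -- Weight exactly j means: at least j, but not at least j + 1. The bit `c` selects the threshold
  -- and its required value.
  have h2 : QComp (d₃ + 4) (expSq m ^ c₃) fun (y : (Σ _ : Bool, Fin (m ^ r + 1)) → Bool)
      (p : Σ _ : bad, Unit) => decide (∀ c : Bool,
        y ⟨p.1.1.1, if c then p.1.1.2.succ else p.1.1.2.castSucc⟩ = !c) := by
    refine hfork₃ m hm 4 bad _ (fun _ => Unit) (fun p y _ => decide (∀ c : Bool,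
      y ⟨p.1.1, if c then p.1.2.succ else p.1.2.castSucc⟩ = !c)) ?_ hcard fun p => ?_
    · refine (Fintype.card_subtype_le _).trans ?_
      simp only [Fintype.card_prod, Fintype.card_bool, Fintype.card_fin]
      rw [pow_succ']
      exact Nat.mul_le_mul_right _ hm
    · refine ((QComp.pattern (fun c : Bool => !c) false).reindex
        ⟨fun c => ⟨p.1.1, if c then p.1.2.succ else p.1.2.castSucc⟩, ?_⟩ (Equiv.refl _) ?_).mono
          le_rfl (Nat.zero_le _)
      · intro c c' h
        have h' := congrArg (fun s : Σ _ : Bool, Fin (m ^ r + 1) => (s.2 : ℕ)) h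
        cases c <;> cases c' <;> simp at h' ⊢
      · intro x k
        rw [Bool.false_xor]
        exact decide_eq_decide.2 Iff.rfl
  -- If no bad weight is present, the conjunction is true and the output is `a`; otherwise it is the
  -- negation of `a`.
  have h3 : QComp 4 (expSq m ^ 0) fun (y : (Σ _ : bad, Unit) → Bool) (_ : Unit) =>
      xor (!a) (decide (∀ p, y p = false)) :=
    (QComp.pattern (fun _ => false) (!a)).mono le_rfl (Nat.zero_le _)
  have hcard' : Fintype.card (Σ _ : bad, Unit) ≤ expSq m ^ (r + 1) := by
    simp only [Fintype.card_sigma, Fintype.card_unit, Finset.sum_const, Finset.card_univ,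
      smul_eq_mul, mul_one]
    refine (Fintype.card_subtype_le _).trans (le_trans ?_ (pow_le_expSq_pow hm _))
    simp only [Fintype.card_prod, Fintype.card_bool, Fintype.card_fin]
    rw [pow_succ']
    exact Nat.mul_le_mul_right _ hm
  refine (QComp.comp_expSq hm h3 (QComp.comp_expSq hm h2 h1 hcard) hcard').reindex
    (Embedding.refl _) (Equiv.refl _) ?_
  rintro x ⟨⟩
  have key : (∀ p : Σ _ : bad, Unit, decide (∀ c : Bool, decide
      (((if c then p.1.1.2.succ else p.1.1.2.castSucc : Fin (m ^ r + 1)) : ℕ)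
        ≤ popcount fun i => xor p.1.1.1 (x i)) = !c) = false) ↔ g x = a := by
    rw [← not_iff_not, ← ne_eq (g x), hg]
    push Not
    constructor
    · rintro ⟨⟨⟨p, hp⟩, ⟨⟩⟩, h⟩
      refine ⟨p, hp, ?_⟩
      simp only [ne_eq, decide_eq_false_iff_not, not_not] at h
      have h1 := h true
      have h2 := h false
      simp at h1 h2
      omega
    · rintro ⟨p, hp, h⟩
      refine ⟨⟨⟨p, hp⟩, ()⟩, ?_⟩
      simp only [ne_eq, decide_eq_false_iff_not, not_not]
      rw [h]
      rintro (_ | _) <;> simp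
  exact eq_xor_decide key

end Threshold

/-! ### Low-degree functions on the cube and Smolensky's bound. -/

section Degree

variable {ι K : Type} [Fintype ι] [DecidableEq ι] [Field K]

/-- The multilinear monomial of the variables in `T`. -/
def cubeMonomial (K : Type) [Field K] (T : Finset ι) : (ι → Bool) → K := fun y =>
  if ∀ i ∈ T, y i = true then 1 else 0

/-- The functions on the cube that are given by polynomials of degree at most `t`. -/
def degLE (ι K : Type) [Fintype ι] [DecidableEq ι] [Field K] (t : ℕ) :
    Submodule K ((ι → Bool) → K) :=
  Submodule.span K (cubeMonomial K '' {T | T.card ≤ t})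

theorem degLE_mono {s t : ℕ} (h : s ≤ t) : degLE ι K s ≤ degLE ι K t :=
  Submodule.span_mono (Set.image_mono fun _ hT => le_trans hT h)

theorem cubeMonomial_mem {T : Finset ι} {t : ℕ} (h : T.card ≤ t) : cubeMonomial K T ∈ degLE ι K t :=
  Submodule.subset_span ⟨T, h, rfl⟩

theorem one_mem_degLE (t : ℕ) : (1 : (ι → Bool) → K) ∈ degLE ι K t := by
  convert cubeMonomial_mem (K := K) (T := (∅ : Finset ι)) (Nat.zero_le t)
  funext y
  simp [cubeMonomial]

theorem mul_mem_degLE {s t : ℕ} {f g : (ι → Bool) → K} (hf : f ∈ degLE ι K s)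
    (hg : g ∈ degLE ι K t) : f * g ∈ degLE ι K (s + t) := by
  have h := Submodule.mul_mem_mul hf hg
  rw [degLE, degLE, Submodule.span_mul_span] at h
  refine Submodule.span_le.2 ?_ h
  rintro _ ⟨_, ⟨S, hS, rfl⟩, _, ⟨T, hT, rfl⟩, rfl⟩
  have h : cubeMonomial K S * cubeMonomial K T = cubeMonomial K (S ∪ T) := ?_
  · change cubeMonomial K S * cubeMonomial K T ∈ degLE ι K (s + t)
    rw [h]
    exact cubeMonomial_mem ((Finset.card_union_le S T).trans (add_le_add hS hT))
  funext y
  simp only [cubeMonomial, Pi.mul_apply, Finset.mem_union, or_imp, forall_and, ite_and]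
  split_ifs <;> simp

theorem prod_mem_degLE {α : Type} (S : Finset α) {t : ℕ} {f : α → (ι → Bool) → K}
    (hf : ∀ a ∈ S, f a ∈ degLE ι K t) : ∏ a ∈ S, f a ∈ degLE ι K (S.card * t) := by
  classical
  induction S using Finset.induction_on with
  | empty => simpa using one_mem_degLE 0
  | insert a S ha ih =>
    rw [Finset.prod_insert ha, Finset.card_insert_of_notMem ha, add_mul, one_mul, add_comm]
    exact mul_mem_degLE (hf a (Finset.mem_insert_self _ _))
      (ih fun b hb => hf b (Finset.mem_insert_of_mem hb))

/-- A bit as an element of `K`. -/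
def bitVal (K : Type) [Field K] (b : Bool) : K := if b then 1 else 0

theorem bitVal_coord_mem (i : ι) : (fun y : ι → Bool => bitVal K (y i)) ∈ degLE ι K 1 := by
  convert cubeMonomial_mem (K := K) (T := {i}) (le_of_eq (Finset.card_singleton i))
  simp [cubeMonomial, bitVal]

theorem const_mem_degLE (c : K) (t : ℕ) : (fun _ : ι → Bool => c) ∈ degLE ι K t := by
  convert (degLE ι K t).smul_mem c (one_mem_degLE t)
  simp

theorem finrank_degLE_le (t : ℕ) :
    Module.finrank K (degLE ι K t) ≤ ∑ i ∈ Finset.range (t + 1), (Fintype.card ι).choose i := by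
  classical
  have h : (cubeMonomial K '' {T : Finset ι | T.card ≤ t})
      = ((Finset.univ.filter fun T : Finset ι => T.card ≤ t).image (cubeMonomial K) :
        Finset ((ι → Bool) → K)) := by
    ext f; simp
  rw [degLE, h]
  refine (finrank_span_finset_le_card _).trans (Finset.card_image_le.trans ?_)
  have h2 : (Finset.univ.filter fun T : Finset ι => T.card ≤ t)
      = (Finset.range (t + 1)).biUnion fun i => Finset.univ.powersetCard i := by
    ext T
    simp
  rw [h2]
  refine Finset.card_biUnion_le.trans (le_of_eq ?_)
  simp

/-- Smolensky's dimension bound: `ω ^ |y|` differs from every polynomial of small degree on many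
points. -/
theorem smolensky {ω : K} (h0 : ω ≠ 0) (h1 : ω ≠ 1) {h D : ℕ} (hι : Fintype.card ι = 2 * h + 1)
    (E : Finset (ι → Bool)) {G : (ι → Bool) → K} (hG : G ∈ degLE ι K D)
    (hE : ∀ y ∉ E, G y = ω ^ popcount y) :
    2 ^ (2 * h + 1) ≤ E.card + ∑ i ∈ Finset.range (h + D + 1), (2 * h + 1).choose i := by
  let R : ((ι → Bool) → K) →ₗ[K] ({y // y ∉ E} → K) := LinearMap.funLeft K K Subtype.val
  have hz : ∀ a b : K, ∀ i : ι, (fun y : ι → Bool => if y i then a else b) ∈ degLE ι K 1 := by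
    intro a b i
    convert (degLE ι K 1).add_mem ((degLE ι K 1).smul_mem (a - b) (bitVal_coord_mem i))
      (const_mem_degLE b 1) using 1
    funext y
    cases hy : y i <;> simp [bitVal, hy]
  -- Off `E`, a product over more than h variables equals ω^|y|, that is `G`, times the inverse
  -- product over the complement, which has at most h variables.
  have hZ : ∀ T : Finset ι, R (∏ i ∈ T, fun y => if y i then ω else 1)
      ∈ (degLE ι K (h + D)).map R := by
    intro T
    rcases le_or_gt T.card h with hT | hT
    · refine Submodule.mem_map_of_mem (degLE_mono (by omega : T.card * 1 ≤ h + D) ?_)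
      exact prod_mem_degLE T fun i _ => hz _ _ i
    · refine ⟨G * ∏ i ∈ Tᶜ, fun y => if y i then ω⁻¹ else 1, ?_, ?_⟩
      · refine degLE_mono (?_ : D + Tᶜ.card * 1 ≤ h + D)
          (mul_mem_degLE hG (prod_mem_degLE _ fun i _ => hz _ _ i))
        rw [Finset.card_compl, hι]
        omega
      · funext ⟨y, hy⟩
        simp only [R, LinearMap.funLeft_apply, Pi.mul_apply, Finset.prod_apply]
        have hω : ω ^ popcount y = ∏ i, if y i then ω else 1 := by
          rw [Finset.prod_ite, Finset.prod_const_one, mul_one, Finset.prod_const, popcount]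
        rw [hE y hy, hω, ← Finset.prod_mul_prod_compl T, mul_assoc, ← Finset.prod_mul_distrib,
          Finset.prod_eq_one (s := Tᶜ), mul_one]
        intro i _
        split_ifs <;> simp [h0]
  have htop : (degLE ι K (h + D)).map R = ⊤ := by
    rw [eq_top_iff]
    rintro f -
    obtain ⟨g, rfl⟩ := LinearMap.funLeft_surjective_of_injective K K _ Subtype.val_injective f
    change R g ∈ _
    -- Interpolation in variables z_i ∈ {1, ω}: the indicator of a point has the factors (z_i -
    -- 1)/(ω - 1) at its ones and (ω - z_i)/(ω - 1) at its zeros.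
    have hg : g = ∑ y₀, g y₀ • ∏ i, ((fun y : ι → Bool => if y₀ i then -(ω - 1)⁻¹ else ω * (ω - 1)⁻¹)
        + (if y₀ i then (ω - 1)⁻¹ else -(ω - 1)⁻¹) • fun y : ι → Bool => if y i then ω else 1) := by
      have hω1 : ω - 1 ≠ 0 := sub_ne_zero.2 h1
      funext y
      rw [Finset.sum_apply, Finset.sum_eq_single y]
      · rw [Pi.smul_apply, Finset.prod_apply, Finset.prod_eq_one, smul_eq_mul, mul_one]
        intro i _
        simp only [Pi.add_apply, Pi.smul_apply, smul_eq_mul]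
        cases y i <;> simp <;> field_simp <;> ring
      · intro y₀ _ hy
        obtain ⟨i, hi⟩ := Function.ne_iff.1 hy
        rw [Pi.smul_apply, Finset.prod_apply, Finset.prod_eq_zero (Finset.mem_univ i), smul_zero]
        simp only [Pi.add_apply, Pi.smul_apply, smul_eq_mul]
        cases h3 : y i <;> cases h4 : y₀ i <;> simp_all
        ring
      · simp
    rw [hg, map_sum]
    refine Submodule.sum_mem _ fun y₀ _ => ?_
    rw [map_smul]
    refine Submodule.smul_mem _ _ ?_
    rw [Finset.prod_add, map_sum]
    refine Submodule.sum_mem _ fun T _ => ?_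
    have : ((∏ i ∈ T, fun y : ι → Bool => if y₀ i then -(ω - 1)⁻¹ else ω * (ω - 1)⁻¹)
        * ∏ i ∈ Finset.univ \ T, (if y₀ i then (ω - 1)⁻¹ else -(ω - 1)⁻¹) •
          fun y : ι → Bool => if y i then ω else 1)
        = ((∏ i ∈ T, if y₀ i then -(ω - 1)⁻¹ else ω * (ω - 1)⁻¹)
        * ∏ i ∈ Finset.univ \ T, (if y₀ i then (ω - 1)⁻¹ else -(ω - 1)⁻¹)) •
          ∏ i ∈ Finset.univ \ T, fun y : ι → Bool => if y i then ω else 1 := by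
      funext y
      simp only [Pi.mul_apply, Finset.prod_apply, Pi.smul_apply, smul_eq_mul,
        Finset.prod_mul_distrib]
      ring
    rw [this, map_smul]
    exact Submodule.smul_mem _ _ (hZ _)
  -- All functions off `E` come from degree at most h + D; comparing dimensions gives the bound.
  have h2 := (Submodule.finrank_map_le R (degLE ι K (h + D))).trans (finrank_degLE_le _)
  rw [htop, finrank_top, Module.finrank_fintype_fun_eq_card, hι] at h2
  have h3 : Fintype.card {y // y ∉ E} = 2 ^ (2 * h + 1) - E.card := by
    rw [Fintype.card_subtype_compl, Fintype.card_coe]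
    simp [hι]
  omega

end Degree

/-! ### Sums of binomial coefficients slightly beyond the middle. -/

section Binomial

theorem centralBinom_sq_mul_le (h : ℕ) : h.centralBinom ^ 2 * (2 * h + 1) ≤ 16 ^ h := by
  induction h with
  | zero => simp
  | succ h ih =>
    refine le_of_mul_le_mul_left (a := (h + 1) ^ 2) ?_ (by positivity)
    calc (h + 1) ^ 2 * ((h + 1).centralBinom ^ 2 * (2 * (h + 1) + 1))
        = ((h + 1) * (h + 1).centralBinom) ^ 2 * (2 * h + 3) := by ring
      _ = (h.centralBinom ^ 2 * (2 * h + 1)) * (4 * ((2 * h + 1) * (2 * h + 3))) := by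
          rw [Nat.succ_mul_centralBinom_succ]; ring
      _ ≤ 16 ^ h * (16 * (h + 1) ^ 2) := Nat.mul_le_mul ih (by nlinarith)
      _ = (h + 1) ^ 2 * 16 ^ (h + 1) := by ring

/-- The lower half contributes 4^h, and each of the `D` further terms is at most the middle
coefficient. By the central binomial bound these add at most 4^h/2. -/
theorem sum_choose_le {h D : ℕ} (hD : 16 * D ^ 2 ≤ 2 * h + 3) :
    4 * ∑ i ∈ Finset.range (h + D + 1), (2 * h + 1).choose i ≤ 3 * 2 ^ (2 * h + 1) := by
  have h1 : ∑ i ∈ Finset.range (h + D + 1), (2 * h + 1).choose i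
      ≤ 4 ^ h + D * (2 * h + 1).choose h := by
    rw [show h + D + 1 = h + 1 + D by ring, Finset.sum_range_add, Nat.sum_range_choose_halfway]
    refine Nat.add_le_add_left ?_ _
    calc ∑ i ∈ Finset.range D, (2 * h + 1).choose (h + 1 + i)
        ≤ ∑ i ∈ Finset.range D, (2 * h + 1).choose h := Finset.sum_le_sum fun i _ => by
          have := Nat.choose_le_middle (h + 1 + i) (2 * h + 1)
          rwa [show (2 * h + 1) / 2 = h by omega] at this
      _ = _ := by simp
  have h2 : 2 * (2 * h + 1).choose h = (h + 1).centralBinom := by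
    rw [Nat.centralBinom, show 2 * (h + 1) = 2 * h + 1 + 1 by ring, Nat.choose_succ_succ,
      ← Nat.choose_symm_half]
    ring
  have h3 : 2 * (D * (2 * h + 1).choose h) ≤ 4 ^ h := by
    have h4 := centralBinom_sq_mul_le (h + 1)
    rw [← h2] at h4
    refine (Nat.pow_le_pow_iff_left (n := 2) two_ne_zero).1 ?_
    have h5 : (4 ^ h) ^ 2 = 16 ^ h := by rw [← pow_mul, mul_comm, pow_mul]; norm_num
    rw [h5]
    rw [pow_succ 16 h] at h4
    nlinarith [Nat.mul_le_mul_left ((2 * h + 1).choose h ^ 2) hD]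
  have h6 : 2 ^ (2 * h + 1) = 2 * 4 ^ h := by rw [pow_succ, pow_mul]; ring
  omega

end Binomial

/-! ### Polynomial approximation of constant-depth circuits. -/

section Approximation

variable {ι K : Type} [Fintype ι] [DecidableEq ι] [Field K]

theorem prod_two_mul_mem_degLE {l t : ℕ} {f : Fin l → (ι → Bool) → K}
    (hf : ∀ τ, f τ ∈ degLE ι K t) :
    (1 - ∏ τ, (1 - f τ ^ 2)) ∈ degLE ι K (2 * l * t) := by
  have h : ∏ τ, (1 - f τ ^ 2) ∈ degLE ι K ((Finset.univ : Finset (Fin l)).card * (t + t)) :=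
    prod_mem_degLE _ fun τ _ => (degLE ι K _).sub_mem (one_mem_degLE _)
      (by rw [pow_two]; exact mul_mem_degLE (hf τ) (hf τ))
  refine (degLE ι K _).sub_mem (one_mem_degLE _) ?_
  convert h using 2
  rw [Finset.card_univ, Fintype.card_fin]
  ring

/-- Approximating a disjunction: the error is exponentially small in `l`, where the degree grows
linearly in `l`. -/
theorem exists_approx_or (hK : ∀ k : ℕ, (k : K) = 0 ∨ (k : K) ^ 2 = 1) {W : Type} [Fintype W]
    [DecidableEq W] (S : Finset W) (b : W → (ι → Bool) → Bool) (P : W → (ι → Bool) → K) {t : ℕ}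
    (hP : ∀ w ∈ S, P w ∈ degLE ι K t) (l : ℕ) :
    ∃ Q ∈ degLE ι K (2 * l * t), ∃ E : Finset (ι → Bool),
      2 ^ l * E.card ≤ 2 ^ Fintype.card ι ∧ ∀ y ∉ E, (∀ w ∈ S, P w y = bitVal K (b w y)) →
        Q y = bitVal K (decide (∃ w ∈ S, b w y = true)) := by
  classical
  let σ : (ι → Bool) → Finset W → K := fun y Z => ∑ w ∈ S.filter (· ∈ Z), bitVal K (b w y)
  obtain ⟨z, hz⟩ := exists_halving (Y := ι → Bool) (Z := Finset W)
    (fun y Z => (∃ w ∈ S, b w y = true) ∧ σ y Z = 0) (fun y => by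
      by_cases hy : ∃ w ∈ S, b w y = true
      · obtain ⟨w₀, hw₀, hb⟩ := hy
        -- Toggling a true wire `w₀` in the random subset changes the sum by one, so subsets with
        -- sum zero are paired with subsets with nonzero sum.
        have hdisj : Disjoint (Finset.univ.filter fun Z => (∃ w ∈ S, b w y = true) ∧ σ y Z = 0)
            ((Finset.univ.filter fun Z => (∃ w ∈ S, b w y = true) ∧ σ y Z = 0).image
              fun Z => symmDiff Z {w₀}) := by
          rw [Finset.disjoint_left]
          intro Z hZ hZ'
          obtain ⟨Z', hZ2, rfl⟩ := Finset.mem_image.1 hZ'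
          have h1 := (Finset.mem_filter.1 hZ).2.2
          have h2 := (Finset.mem_filter.1 hZ2).2.2
          have key : ∀ Z : Finset W, w₀ ∉ Z → σ y (insert w₀ Z) = 1 + σ y Z := by
            intro Z hZ
            have : S.filter (· ∈ insert w₀ Z) = insert w₀ (S.filter (· ∈ Z)) := by
              ext w
              by_cases hw : w = w₀ <;> simp [hw, hw₀]
            simp only [σ]
            rw [this, Finset.sum_insert (by simp [hZ]), hb]
            simp [bitVal]
          by_cases hw : w₀ ∈ Z'
          · have h3 : symmDiff Z' {w₀} = Z'.erase w₀ := by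
              ext w; by_cases hw : w = w₀ <;> simp_all [Finset.mem_symmDiff]
            rw [h3] at h1
            have h4 := key (Z'.erase w₀) (by simp)
            rw [Finset.insert_erase hw, h1, h2] at h4
            simp at h4
          · have h3 : symmDiff Z' {w₀} = insert w₀ Z' := by
              ext w; by_cases hw : w = w₀ <;> simp_all [Finset.mem_symmDiff]
            rw [h3, key _ hw, h2] at h1
            simp at h1
        have h := Finset.card_le_univ (Finset.disjUnion _ _ hdisj)
        have hinj : Injective fun Z : Finset W => symmDiff Z {w₀} := symmDiff_left_injective _
        rwa [Finset.card_disjUnion, Finset.card_image_of_injective _ hinj, ← two_mul] at h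
      · simp [hy]) l
  -- By `hK` the square of each subset sum is 0 or 1 when the inputs are exact; the polynomial is
  -- the disjunction of these `l` squares.
  refine ⟨1 - ∏ τ, (1 - (∑ w ∈ S.filter (· ∈ z τ), P w) ^ 2), prod_two_mul_mem_degLE fun τ =>
    (degLE ι K t).sum_mem fun w hw => hP w (Finset.mem_filter.1 hw).1, _, by simpa using hz, ?_⟩
  intro y hy hPy
  have hσ : ∀ τ, (∑ w ∈ S.filter (· ∈ z τ), P w) y = σ y (z τ) := by
    intro τ
    rw [Finset.sum_apply]
    exact Finset.sum_congr rfl fun w hw => hPy w (Finset.mem_filter.1 hw).1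
  simp only [Pi.sub_apply, Pi.one_apply, Finset.prod_apply, Pi.pow_apply, hσ]
  by_cases hb : ∃ w ∈ S, b w y = true
  · rw [decide_eq_true hb]
    simp only [Finset.mem_filter, Finset.mem_univ, true_and, not_forall, hb] at hy
    obtain ⟨τ, hτ⟩ := hy
    have hnat : σ y (z τ) = (((S.filter (· ∈ z τ)).filter fun w => b w y = true).card : K) := by
      simp [σ, bitVal]
    rw [Finset.prod_eq_zero (Finset.mem_univ τ), sub_zero]
    · rfl
    · rw [hnat] at hτ ⊢
      rw [(hK _).resolve_left hτ, sub_self]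
  · rw [decide_eq_false hb]
    have : ∀ τ, σ y (z τ) = 0 := fun τ => Finset.sum_eq_zero fun w hw => by
      rw [Bool.eq_false_iff.2 fun h => hb ⟨w, (Finset.mem_filter.1 hw).1, h⟩]
      rfl
    simp [this, bitVal]

theorem bitVal_not (b : Bool) : bitVal K (!b) = 1 - bitVal K b := by
  cases b <;> simp [bitVal]

theorem exists_approx_and (hK : ∀ k : ℕ, (k : K) = 0 ∨ (k : K) ^ 2 = 1) {W : Type} [Fintype W]
    [DecidableEq W] (S : Finset W) (b : W → (ι → Bool) → Bool) (P : W → (ι → Bool) → K) {t : ℕ}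
    (hP : ∀ w ∈ S, P w ∈ degLE ι K t) (l : ℕ) :
    ∃ Q ∈ degLE ι K (2 * l * t), ∃ E : Finset (ι → Bool),
      2 ^ l * E.card ≤ 2 ^ Fintype.card ι ∧ ∀ y ∉ E, (∀ w ∈ S, P w y = bitVal K (b w y)) →
        Q y = bitVal K (decide (∀ w ∈ S, b w y = true)) := by
  obtain ⟨Q, hQ, E, hE, h⟩ := exists_approx_or hK S (fun w y => !b w y) (fun w => 1 - P w)
    (fun w hw => (degLE ι K t).sub_mem (one_mem_degLE t) (hP w hw)) l
  refine ⟨1 - Q, (degLE ι K _).sub_mem (one_mem_degLE _) hQ, E, hE, fun y hy hPy => ?_⟩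
  rw [Pi.sub_apply, Pi.one_apply, h y hy fun w hw => by
    rw [Pi.sub_apply, Pi.one_apply, hPy w hw, bitVal_not], ← bitVal_not]
  congr 1
  rw [Bool.eq_iff_iff]
  simp

theorem exists_approx_gate (hK : ∀ k : ℕ, (k : K) = 0 ∨ (k : K) ^ 2 = 1) {W : Type} [Fintype W]
    [DecidableEq W] (g : ACGate W) (b : W → (ι → Bool) → Bool) (P : W → (ι → Bool) → K) {t : ℕ}
    (hP : ∀ w ∈ g.inputs, P w ∈ degLE ι K t) {l : ℕ} (hl : 0 < l) :
    ∃ Q ∈ degLE ι K (2 * l * t), ∃ E : Finset (ι → Bool),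
      2 ^ l * E.card ≤ 2 ^ Fintype.card ι ∧ ∀ y ∉ E,
        (∀ w ∈ g.inputs, P w y = bitVal K (b w y)) → Q y = bitVal K (g.eval fun w => b w y) := by
  cases g with
  | not w =>
    refine ⟨1 - P w, (degLE ι K _).sub_mem (one_mem_degLE _) (degLE_mono ?_
      (hP w (Finset.mem_singleton_self w))), ∅, by simp, fun y _ h => ?_⟩
    · nlinarith
    · rw [Pi.sub_apply, Pi.one_apply, h w (Finset.mem_singleton_self w), ← bitVal_not]
      rfl
  | and S =>
    obtain ⟨Q, hQ, E, hE, h⟩ := exists_approx_and hK S b P hP l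
    refine ⟨Q, hQ, E, hE, fun y hy hy' => (h y hy hy').trans (congrArg _ ?_)⟩
    exact decide_eq_decide.2 Iff.rfl
  | or S =>
    obtain ⟨Q, hQ, E, hE, h⟩ := exists_approx_or hK S b P hP l
    refine ⟨Q, hQ, E, hE, fun y hy hy' => (h y hy hy').trans (congrArg _ ?_)⟩
    exact decide_eq_decide.2 Iff.rfl

/-- The gates of a circuit of small depth are approximated by polynomials of small degree. -/
theorem ACCircuit.exists_approx_gateVal (hK : ∀ k : ℕ, (k : K) = 0 ∨ (k : K) ^ 2 = 1) {n : ℕ}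
    (C : ACCircuit n) (x : (ι → Bool) → Fin n → Bool)
    (hx : ∀ i, (fun y => bitVal K (x y i)) ∈ degLE ι K 1) {l : ℕ} (hl : 0 < l) (j : ℕ)
    (hj : j < C.size) :
    ∃ Q ∈ degLE ι K ((2 * l) ^ C.gateDepth ⟨j, hj⟩), ∃ E : Finset (ι → Bool),
      2 ^ l * E.card ≤ (C.size + 1) ^ C.gateDepth ⟨j, hj⟩ * 2 ^ Fintype.card ι ∧
        ∀ y ∉ E, Q y = bitVal K (C.gateVal (x y) ⟨j, hj⟩) := by
  classical
  induction j using Nat.strong_induction_on with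
  | _ j ih =>
    choose P hP E hE hPE using fun i : Fin j => ih i i.2 (i.2.trans hj)
    set s := (C.gate ⟨j, hj⟩).inputs.sup (Sum.elim (fun _ => 0) fun i : Fin j =>
      C.gateDepth ⟨i, i.2.trans hj⟩) with hs
    have hd : C.gateDepth ⟨j, hj⟩ = s + 1 := by rw [ACCircuit.gateDepth]
    have hsup : ∀ i : Fin j, Sum.inr i ∈ (C.gate ⟨j, hj⟩).inputs →
        C.gateDepth ⟨i, i.2.trans hj⟩ ≤ s := fun i hi =>
      Finset.le_sup (f := Sum.elim (fun _ => 0) fun i : Fin j =>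
        C.gateDepth ⟨i, i.2.trans hj⟩) hi
    obtain ⟨Q, hQ, E', hE', hQE⟩ := exists_approx_gate hK (C.gate ⟨j, hj⟩)
      (fun w y => Sum.elim (x y) (fun i : Fin j => C.gateVal (x y) ⟨i, i.2.trans hj⟩) w)
      (Sum.elim (fun i y => bitVal K (x y i)) P) (t := (2 * l) ^ s) (by
        rintro (i | i) hi
        · exact degLE_mono (Nat.one_le_pow _ _ (by omega)) (hx i)
        · exact degLE_mono (Nat.pow_le_pow_right (by omega) (hsup i hi)) (hP i)) hl
    rw [hd]
    -- Errors of the gate itself and of its fewer than `C.size` input gates add up, which costs a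
    -- factor `C.size + 1` per level.
    refine ⟨Q, by rwa [pow_succ'], E' ∪ (Finset.univ.filter fun i : Fin j =>
      Sum.inr i ∈ (C.gate ⟨j, hj⟩).inputs).biUnion E, ?_, fun y hy => ?_⟩
    · calc 2 ^ l * (E' ∪ (Finset.univ.filter fun i : Fin j =>
            Sum.inr i ∈ (C.gate ⟨j, hj⟩).inputs).biUnion E).card
          ≤ 2 ^ l * (E'.card + ∑ i with Sum.inr i ∈ (C.gate ⟨j, hj⟩).inputs, (E i).card) :=
            Nat.mul_le_mul_left _ ((Finset.card_union_le _ _).trans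
              (Nat.add_le_add_left Finset.card_biUnion_le _))
        _ = 2 ^ l * E'.card
            + ∑ i with Sum.inr i ∈ (C.gate ⟨j, hj⟩).inputs, 2 ^ l * (E i).card := by
            rw [mul_add, Finset.mul_sum]
        _ ≤ 2 ^ Fintype.card ι + ∑ i with Sum.inr i ∈ (C.gate ⟨j, hj⟩).inputs,
            (C.size + 1) ^ s * 2 ^ Fintype.card ι := by
            refine add_le_add hE' (Finset.sum_le_sum fun i hi => (hE i).trans ?_)
            exact Nat.mul_le_mul_right _ (Nat.pow_le_pow_right (by omega)
              (hsup i (Finset.mem_filter.1 hi).2))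
        _ ≤ (C.size + 1) ^ s * 2 ^ Fintype.card ι
            + C.size * ((C.size + 1) ^ s * 2 ^ Fintype.card ι) := by
            refine add_le_add (Nat.le_mul_of_pos_left _ (by positivity)) ?_
            rw [Finset.sum_const, smul_eq_mul]
            refine Nat.mul_le_mul_right _ ((Finset.card_le_univ _).trans ?_)
            rw [Fintype.card_fin]
            exact hj.le
        _ = (C.size + 1) ^ (s + 1) * 2 ^ Fintype.card ι := by ring
    · simp only [Finset.mem_union, Finset.mem_biUnion, Finset.mem_filter, Finset.mem_univ,
        true_and, not_or, not_exists, not_and] at hy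
      rw [hQE y hy.1, ACCircuit.gateVal]
      rintro (i | i) hi
      · rfl
      · exact hPE i y (hy.2 i hi)

theorem ACCircuit.exists_approx (hK : ∀ k : ℕ, (k : K) = 0 ∨ (k : K) ^ 2 = 1) {n d : ℕ}
    (C : ACCircuit n) (hC : C.depth ≤ d) (x : (ι → Bool) → Fin n → Bool)
    (hx : ∀ i, (fun y => bitVal K (x y i)) ∈ degLE ι K 1) {l : ℕ} (hl : 0 < l) :
    ∃ Q ∈ degLE ι K ((2 * l) ^ d), ∃ E : Finset (ι → Bool),
      2 ^ l * E.card ≤ (C.size + 1) ^ d * 2 ^ Fintype.card ι ∧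
        ∀ y ∉ E, Q y = bitVal K (C.eval (x y)) := by
  rcases ho : C.output with i | j
  · refine ⟨_, degLE_mono (Nat.one_le_pow _ _ (by omega)) (hx i), ∅, by simp, fun y _ => ?_⟩
    rw [ACCircuit.eval, ho]
    rfl
  · have hd : C.gateDepth j ≤ d := by
      rw [ACCircuit.depth, ho] at hC
      exact hC
    obtain ⟨Q, hQ, E, hE, h⟩ := C.exists_approx_gateVal hK x hx hl j j.2
    refine ⟨Q, degLE_mono (Nat.pow_le_pow_right (by omega) hd) hQ, E, hE.trans ?_, fun y hy => ?_⟩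
    · exact Nat.mul_le_mul_right _ (Nat.pow_le_pow_right (by omega) hd)
    · rw [h y hy, ACCircuit.eval, ho]
      rfl

end Approximation

/-! ### Equal windows and roots of unity. -/

section Periods

/-- The windows of length `M + 1` of a sequence at distance `q` coincide somewhere in the range. -/
def IsWindowShift (s : ℕ → Bool) (M q : ℕ) : Prop :=
  1 ≤ q ∧ ∃ r, r + q ≤ M ∧ ∀ i ≤ M, s (r + i) = s (r + q + i)

/-- The minimal shift divides all shifts. -/
theorem IsWindowShift.dvd {s : ℕ → Bool} {M q q' : ℕ} (hq : IsWindowShift s M q)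
    (hmin : ∀ g, IsWindowShift s M g → q ≤ g) (hq' : IsWindowShift s M q') : q ∣ q' := by
  obtain ⟨h1, r, hr, hs⟩ := hq
  obtain ⟨h1', r', hr', hs'⟩ := hq'
  have hq0 : (0 : ℤ) < q := by exact_mod_cast h1
  -- The two overlapping windows at distance `q` make the sequence `q`-periodic on their union,
  -- starting at `r`; `t` is its periodic extension.
  let t : ℤ → Bool := fun j => s (r + (j % q).toNat)
  have ht : ∀ j ≤ q + M, t j = s (r + j) := by
    have key : ∀ a b, a * q + b ≤ q + M → s (r + (a * q + b)) = s (r + b) := by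
      intro a b
      induction a with
      | zero => simp
      | succ a ih =>
        intro hab
        rw [add_mul, one_mul] at hab ⊢
        rw [show r + (a * q + q + b) = r + q + (a * q + b) by ring, ← hs _ (by omega)]
        exact ih (by omega)
    intro j hj
    have h := key (j / q) (j % q) (by rw [Nat.div_add_mod']; exact hj)
    rw [Nat.div_add_mod'] at h
    rw [h]
    rfl
  have htq : Periodic t (q : ℤ) := fun j => by simp [t]
  have htm : ∀ i j : ℤ, i % q = j % q → t i = t j := fun i j h => by simp only [t, h]
  have htq' : Periodic t (q' : ℤ) := by
    intro j
    -- A representative of j modulo `q` lying in both ranges; the truncated difference covers r' < r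
    -- as well.
    set b : ℕ := (r' - r) + ((j - (r' - r : ℕ)) % q).toNat with hb
    have h2 : (((j - (r' - r : ℕ)) % q).toNat : ℤ) = (j - (r' - r : ℕ)) % q :=
      Int.toNat_of_nonneg (Int.emod_nonneg _ hq0.ne')
    have h3 : ((j - (r' - r : ℕ)) % q).toNat < q := by
      have := Int.emod_lt_of_pos (j - (r' - r : ℕ)) hq0
      omega
    have h4 : (b : ℤ) % q = j % q := by
      rw [hb, Nat.cast_add, h2, Int.add_emod_emod]
      congr 1
      ring
    rw [htm (j + q') (b + q') (by rw [Int.add_emod, ← h4, ← Int.add_emod]), htm j b h4.symm,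
      ← Nat.cast_add, ht _ (by omega), ht _ (by omega)]
    have h5 := hs' (r + b - r') (by omega)
    rw [show r' + (r + b - r') = r + b by omega] at h5
    rw [h5]
    congr 1
    omega
  have htg : Periodic t ((q.gcd q' : ℕ) : ℤ) := by
    rw [Nat.gcd_eq_gcd_ab, mul_comm (q : ℤ), mul_comm (q' : ℤ)]
    exact (htq.int_mul _).add_period (htq'.int_mul _)
  have hg : q.gcd q' ≤ q := Nat.gcd_le_left _ h1
  -- By Bézout the gcd is a period of `t`, hence a shift at `r`, and minimality of `q` makes it
  -- equal to `q`.
  have hgq := hmin (q.gcd q') ⟨Nat.gcd_pos_of_pos_left _ h1, r, by omega, fun i hi => by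
    rw [← ht i (by omega), ← htg i, ← Nat.cast_add, ht _ (by omega)]
    congr 1
    ring⟩
  rw [← le_antisymm hg hgq]
  exact Nat.gcd_dvd_right _ _

/-- The minimal shift serves: a shift by one would identify the values at M and M + 1. Without any
shift, 2 serves vacuously. -/
theorem exists_two_le_dvd_windowShift {s : ℕ → Bool} {M : ℕ} (h : s M ≠ s (M + 1)) :
    ∃ g, 2 ≤ g ∧ ∀ q, IsWindowShift s M q → g ∣ q := by
  classical
  by_cases he : ∃ q, IsWindowShift s M q
  · have hq := Nat.find_spec he
    refine ⟨Nat.find he, ?_, fun q hq' => hq.dvd (fun g hg => Nat.find_min' he hg) hq'⟩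
    obtain ⟨h1, r, hr, hs⟩ := hq
    by_contra hlt
    obtain h2 : Nat.find he = 1 := by omega
    rw [h2] at hr hs
    apply h
    have := hs (M - r) (by omega)
    rwa [show r + (M - r) = M by omega, show r + 1 + (M - r) = M + 1 by omega] at this
  · exact ⟨2, le_rfl, fun q hq => absurd ⟨q, hq⟩ he⟩

theorem zmod_two_eq_zero_or_sq_eq_one : ∀ a : ZMod 2, a = 0 ∨ a ^ 2 = 1 := by decide

theorem zmod_three_eq_zero_or_sq_eq_one : ∀ a : ZMod 3, a = 0 ∨ a ^ 2 = 1 := by decide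

theorem neg_one_ne_one_zmod_three : (-1 : ZMod 3) ≠ 1 := by decide

/-- An element of a field of characteristic two or three whose powers are determined by the
windows of a non-constant sequence. -/
theorem exists_pow_eq_of_window_eq {s : ℕ → Bool} {M : ℕ} (h : s M ≠ s (M + 1)) :
    ∃ (K : Type) (_ : Field K), (∀ k : ℕ, (k : K) = 0 ∨ (k : K) ^ 2 = 1) ∧
      ∃ ω : K, ω ≠ 0 ∧ ω ≠ 1 ∧ ∀ r ≤ M, ∀ r' ≤ M, (∀ i ≤ M, s (r + i) = s (r' + i)) →
        ω ^ r = ω ^ r' := by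
  obtain ⟨g, hg, hdvd⟩ := exists_two_le_dvd_windowShift h
  obtain ⟨K, hK, hk, ω, h0, h1, hω⟩ : ∃ (K : Type) (_ : Field K),
      (∀ k : ℕ, (k : K) = 0 ∨ (k : K) ^ 2 = 1) ∧ ∃ ω : K, ω ≠ 0 ∧ ω ≠ 1 ∧ ω ^ g = 1 := by
    -- For even g, -1 in characteristic 3; for odd g, a primitive g-th root of unity in
    -- characteristic 2.
    rcases Nat.even_or_odd g with he | ho
    · exact ⟨ZMod 3, inferInstance, fun k => zmod_three_eq_zero_or_sq_eq_one k, -1,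
        neg_ne_zero.2 one_ne_zero, neg_one_ne_one_zmod_three, he.neg_one_pow⟩
    · have : NeZero (g : AlgebraicClosure (ZMod 2)) := ⟨fun hz => by
        rw [CharP.cast_eq_zero_iff (AlgebraicClosure (ZMod 2)) 2] at hz
        exact (Nat.not_even_iff_odd.2 ho) (even_iff_two_dvd.2 hz)⟩
      obtain ⟨ω, hω⟩ := HasEnoughRootsOfUnity.exists_primitiveRoot (AlgebraicClosure (ZMod 2)) g
      refine ⟨AlgebraicClosure (ZMod 2), inferInstance, fun k => ?_, ω, hω.ne_zero (by omega),
        hω.ne_one (by omega), hω.pow_eq_one⟩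
      rw [← map_natCast (algebraMap (ZMod 2) (AlgebraicClosure (ZMod 2)))]
      rcases zmod_two_eq_zero_or_sq_eq_one k with h2 | h2
      · rw [h2, map_zero]
        exact Or.inl rfl
      · rw [← map_pow, h2, map_one]
        exact Or.inr rfl
  refine ⟨K, hK, hk, ω, h0, h1, ?_⟩
  have key : ∀ r r', r ≤ r' → r' ≤ M → (∀ i ≤ M, s (r + i) = s (r' + i)) → ω ^ r = ω ^ r' := by
    intro r r' hrr hr hs
    obtain ⟨q, rfl⟩ := Nat.exists_eq_add_of_le hrr
    rcases q.eq_zero_or_pos with rfl | hq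
    · rfl
    · obtain ⟨c, hc⟩ := hdvd q ⟨hq, r, hr, hs⟩
      rw [hc, pow_add, pow_mul, hω, one_pow, mul_one]
  intro r hr r' hr' hs
  rcases le_total r r' with hrr | hrr
  · exact key r r' hrr hr' hs
  · exact (key r' r hrr hr fun i hi => (hs i hi).symm).symm

end Periods

/-! ### A symmetric function of small constant depth cannot change in the middle. -/

section LowerBound

/-- The value of a symmetric function on inputs with `j` ones. -/
def weightVal {n : ℕ} (f : (Fin n → Bool) → Bool) (j : ℕ) : Bool := f fun i => decide ((i : ℕ) < j)

theorem card_filter_fin_lt {n j : ℕ} (h : j ≤ n) :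
    (Finset.univ.filter fun i : Fin n => (i : ℕ) < j).card = j := by
  rw [Fin.card_filter_val_lt, min_eq_right h]

theorem hammingWeight_lt {n j : ℕ} (h : j ≤ n) :
    hammingWeight (fun i : Fin n => decide ((i : ℕ) < j)) = j := by
  simpa [hammingWeight] using card_filter_fin_lt h

theorem IsSymmetric.eq_weightVal {n : ℕ} {f : (Fin n → Bool) → Bool} (hf : IsSymmetric f)
    (x : Fin n → Bool) : f x = weightVal f (hammingWeight x) :=
  hf _ _ (hammingWeight_lt ((Finset.card_le_univ _).trans_eq (Fintype.card_fin n))).symm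

theorem hammingWeight_append {M n j : ℕ} (y : Fin M → Bool) (h : j ≤ n) :
    hammingWeight (Fin.append y fun i : Fin n => decide ((i : ℕ) < j)) = popcount y + j := by
  rw [hammingWeight, Finset.card_filter, Fin.sum_univ_add, popcount, Finset.card_filter]
  simp only [Fin.append_left, Fin.append_right]
  rw [← Finset.card_filter, ← Finset.card_filter]
  congr 1
  simpa using card_filter_fin_lt h

/-- A symmetric function with a small circuit of small depth takes the same value on the inputs of
consecutive weights, unless there are few ones or few zeros. -/
theorem ACCircuit.weightVal_succ_eq {M n' h d k l : ℕ} (hM : M = 2 * h + 1)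
    (C : ACCircuit (M + n')) (hC : C.depth ≤ d)
    (hf : IsSymmetric C.eval) (hk : M ≤ k) (hkn : k ≤ n') (hl : 0 < l)
    (hD : 16 * ((2 * l) ^ (d + 1)) ^ 2 ≤ 2 * h + 3)
    (hsize : 4 * ((M + 1) * ((C.size + 1) ^ d + 1)) < 2 ^ l) :
    weightVal C.eval k = weightVal C.eval (k + 1) := by
  classical
  by_contra hne
  let s : ℕ → Bool := fun j => weightVal C.eval (k - M + j)
  obtain ⟨K, _, hK, ω, h0, h1, hω⟩ := exists_pow_eq_of_window_eq (s := s) (M := M) (by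
    simp only [s]
    rwa [Nat.sub_add_cancel hk, ← add_assoc, Nat.sub_add_cancel hk])
  -- Padding with k - M + i ones makes the circuit return entry i of the window at |y|.
  let x : Fin (M + 1) → (Fin M → Bool) → Fin (M + n') → Bool := fun i y =>
    Fin.append y fun p : Fin n' => decide ((p : ℕ) < k - M + i)
  have hx : ∀ i y, C.eval (x i y) = s (popcount y + i) := by
    intro i y
    rw [hf.eq_weightVal, hammingWeight_append y (by have := i.is_le; omega)]
    simp only [s]
    congr 1
    ring
  have hxd : ∀ i p, (fun y => bitVal K (x i y p)) ∈ degLE (Fin M) K 1 := by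
    intro i p
    refine Fin.addCases (fun p => ?_) (fun p => ?_) p
    · simpa only [x, Fin.append_left] using bitVal_coord_mem p
    · simpa only [x, Fin.append_right] using const_mem_degLE _ 1
  choose P hP E hE hPE using fun i => C.exists_approx hK hC (x i) (hxd i) hl
  simp only [Fintype.card_fin] at hE
  -- `Q w` approximates the test whether the windows at |y| and at `w` agree.
  choose Q hQ E' hE' hQE using fun w : Fin (M + 1) => exists_approx_and hK
    (Finset.univ : Finset (Fin (M + 1)))
    (fun i (y : Fin M → Bool) => if s (w + i) then C.eval (x i y) else !C.eval (x i y))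
    (fun i => if s (w + i) then P i else 1 - P i) (t := (2 * l) ^ d) (fun i _ => by
      split_ifs
      · exact hP i
      · exact (degLE _ K _).sub_mem (one_mem_degLE _) (hP i)) l
  simp only [Fintype.card_fin] at hE'
  -- Only the first position of each window counts, so that exactly one summand survives at each y;
  -- its coefficient is ω^|y| because the windows agree.
  let c : Fin (M + 1) → K := fun w =>
    if ∃ w' : ℕ, w' < w ∧ ∀ i ≤ M, s (w' + i) = s (w + i) then 0 else ω ^ (w : ℕ)
  have hG : ∑ w, c w • Q w ∈ degLE (Fin M) K ((2 * l) ^ (d + 1)) := by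
    rw [pow_succ']
    exact Submodule.sum_mem _ fun w _ => Submodule.smul_mem _ _ (hQ w)
  set F := Finset.univ.biUnion E ∪ Finset.univ.biUnion E' with hF
  have hsm := smolensky h0 h1 (ι := Fin M) (by rw [Fintype.card_fin, hM]) F hG (by
    intro y hy
    simp only [hF, Finset.mem_union, Finset.mem_biUnion, Finset.mem_univ, true_and, not_or,
      not_exists] at hy
    have hQy : ∀ w, Q w y = if ∀ i ≤ M, s (popcount y + i) = s (w + i) then 1 else 0 := by
      intro w
      rw [hQE w y (hy.2 w), bitVal]
      · refine if_congr ?_ rfl rfl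
        simp only [decide_eq_true_eq, Finset.mem_univ, true_imp_iff, hx]
        constructor
        · intro hw i hi
          have := hw ⟨i, by omega⟩
          cases h3 : s (w + i) <;> simpa [h3] using this
        · intro hw i
          rw [hw i i.is_le]
          cases s (w + i) <;> rfl
      · intro i _
        have := hPE i y (hy.1 i)
        split_ifs
        · exact this
        · rw [Pi.sub_apply, Pi.one_apply, this, bitVal_not]
    have hpc : popcount y ≤ M := (Finset.card_le_univ _).trans_eq (Fintype.card_fin M)
    have hex : ∃ w, ∀ i ≤ M, s (popcount y + i) = s (w + i) := ⟨popcount y, fun _ _ => rfl⟩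
    have hw := Nat.find_spec hex
    have hwle : Nat.find hex ≤ popcount y := Nat.find_min' hex fun _ _ => rfl
    rw [Finset.sum_apply, Finset.sum_eq_single ⟨Nat.find hex, by omega⟩]
    · rw [Pi.smul_apply, hQy, if_pos hw, smul_eq_mul, mul_one]
      simp only [c]
      rw [if_neg, hω _ hpc _ (hwle.trans hpc) hw]
      rintro ⟨w', hw', h3⟩
      exact Nat.find_min hex hw' fun i hi => (hw i hi).trans (h3 i hi).symm
    · intro w _ hne
      rw [Pi.smul_apply, hQy]
      split_ifs with h3
      · have h4 : Nat.find hex < w := lt_of_le_of_ne (Nat.find_min' hex h3) fun h5 =>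
          hne (Fin.ext h5.symm)
        simp only [c]
        rw [if_pos ⟨_, h4, fun i hi => (hw i hi).symm.trans (h3 i hi)⟩, zero_smul]
      · exact smul_zero _
    · intro hn
      exact absurd (Finset.mem_univ _) hn)
  have hFc : 2 ^ l * F.card ≤ (M + 1) * ((C.size + 1) ^ d + 1) * 2 ^ M := by
    calc 2 ^ l * F.card ≤ 2 ^ l * (∑ i, (E i).card + ∑ w, (E' w).card) :=
          Nat.mul_le_mul_left _ ((Finset.card_union_le _ _).trans
            (add_le_add Finset.card_biUnion_le Finset.card_biUnion_le))
      _ = ∑ i, 2 ^ l * (E i).card + ∑ w, 2 ^ l * (E' w).card := by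
          rw [mul_add, Finset.mul_sum, Finset.mul_sum]
      _ ≤ ∑ i : Fin (M + 1), (C.size + 1) ^ d * 2 ^ M + ∑ w : Fin (M + 1), 2 ^ M :=
          add_le_add (Finset.sum_le_sum fun i _ => hE i) (Finset.sum_le_sum fun w _ => hE' w)
      _ = _ := by
          simp only [Finset.sum_const, Finset.card_univ, Fintype.card_fin, smul_eq_mul]
          ring
  -- Fewer than a quarter of the points are exceptional, and the binomial sum is at most three
  -- quarters of 2^M, against Smolensky's bound.
  have hF4 : 4 * F.card < 2 ^ M := by
    refine lt_of_mul_lt_mul_left (a := 2 ^ l) ?_ (Nat.zero_le _)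
    calc 2 ^ l * (4 * F.card) = 4 * (2 ^ l * F.card) := by ring
      _ ≤ 4 * ((M + 1) * ((C.size + 1) ^ d + 1) * 2 ^ M) := Nat.mul_le_mul_left _ hFc
      _ = 4 * ((M + 1) * ((C.size + 1) ^ d + 1)) * 2 ^ M := by ring
      _ < 2 ^ l * 2 ^ M := Nat.mul_lt_mul_of_pos_right hsize (by positivity)
  have hch := sum_choose_le hD
  have hp : 2 ^ M = 2 ^ (2 * h + 1) := by rw [hM]
  rw [hp] at hF4
  omega

end LowerBound

/-! ### Choice of parameters and conclusion. -/

section Final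

/-- The measure of the length of the input that is used for sizes. -/
def logRoot (n : ℕ) : ℕ := Nat.sqrt (Nat.log 2 n) + 2

theorem two_le_logRoot (n : ℕ) : 2 ≤ logRoot n := Nat.le_add_left _ _

/-- With the reverse estimate that follows, 2 ^ (m ^ 2) and n are polynomially related; the added 2
in `logRoot` absorbs rounding and ensures m ≥ 2. -/
theorem le_expSq_logRoot (n : ℕ) : n ≤ expSq (logRoot n) := by
  refine (Nat.lt_pow_succ_log_self (b := 2) (by norm_num) n).le.trans
    (Nat.pow_le_pow_right (by norm_num) ?_)
  have h := Nat.lt_succ_sqrt (Nat.log 2 n)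
  unfold logRoot
  nlinarith

theorem expSq_logRoot_le (n : ℕ) : expSq (logRoot n) ≤ 16 * (n + 1) ^ 5 := by
  have h1 : logRoot n ^ 2 ≤ 5 * Nat.log 2 n + 4 := by
    have h := Nat.sqrt_le (Nat.log 2 n)
    unfold logRoot
    nlinarith [Nat.sqrt_le_self (Nat.log 2 n)]
  have h2 : 2 ^ Nat.log 2 n ≤ n + 1 := by
    rcases n.eq_zero_or_pos with rfl | hn
    · simp
    · exact (Nat.pow_log_le_self 2 hn.ne').trans (Nat.le_succ n)
  calc expSq (logRoot n) ≤ 2 ^ (5 * Nat.log 2 n + 4) := Nat.pow_le_pow_right (by norm_num) h1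
    _ = 16 * (2 ^ Nat.log 2 n) ^ 5 := by rw [pow_add, mul_comm 5, pow_mul]; ring
    _ ≤ 16 * (n + 1) ^ 5 := by gcongr

theorem popcount_xor {n : ℕ} (b : Bool) (x : Fin n → Bool) :
    popcount (fun i => xor b (x i)) = if b then n - hammingWeight x else hammingWeight x := by
  cases b
  · simp [popcount, hammingWeight]
  · have h := Finset.card_filter_add_card_filter_not (s := (Finset.univ : Finset (Fin n)))
      (fun i => x i = true)
    simp only [Finset.card_univ, Fintype.card_fin] at h
    simp only [popcount, hammingWeight, Bool.true_xor, Bool.not_eq_true', if_true]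
    simp only [Bool.not_eq_true] at h
    omega

theorem hammingWeight_le {n : ℕ} (x : Fin n → Bool) : hammingWeight x ≤ n :=
  (Finset.card_le_univ _).trans_eq (Fintype.card_fin n)

/-- Symmetric functions that are constant on the inputs with neither few zeros nor few ones. -/
theorem QComp.exists_symmetric (r : ℕ) : ∃ d c, ∀ n (f : (Fin n → Bool) → Bool), IsSymmetric f →
    (∃ a, ∀ x, logRoot n ^ r ≤ hammingWeight x → hammingWeight x + logRoot n ^ r ≤ n → f x = a) →
    QComp d (expSq (logRoot n) ^ c) fun (x : Fin n → Bool) (_ : Unit) => f x := by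
  obtain ⟨d, c, h⟩ := QComp.exists_boundary r
  refine ⟨d, c, fun n f hf ⟨a, ha⟩ => ?_⟩
  -- The bad set lists the weights with value different from `a`, counted from the zeros (`true`) or
  -- from the ones (`false`).
  refine h _ (two_le_logRoot n) (Fin n) {p | ∃ x, f x ≠ a ∧
    popcount (fun i => xor p.1 (x i)) = p.2} a (by simpa using le_expSq_logRoot n) f fun x => ?_
  constructor
  · intro hx
    by_cases h1 : logRoot n ^ r ≤ hammingWeight x
    · have h2 : n - hammingWeight x < logRoot n ^ r := by
        have := mt (ha x h1) hx
        have := hammingWeight_le x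
        omega
      refine ⟨(true, ⟨_, h2⟩), ⟨x, hx, ?_⟩, ?_⟩ <;> simpa using popcount_xor true x
    · refine ⟨(false, ⟨_, not_le.1 h1⟩), ⟨x, hx, ?_⟩, ?_⟩ <;> simpa using popcount_xor false x
  · rintro ⟨p, ⟨y, hy, hyp⟩, hxp⟩
    rw [hf x y]
    · exact hy
    · have := hxp.trans hyp.symm
      rw [popcount_xor, popcount_xor] at this
      have hx := hammingWeight_le x
      have hy := hammingWeight_le y
      split_ifs at this <;> omega

theorem QComp.exists_circuit {n d s : ℕ} {f : (Fin n → Bool) → Bool}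
    (h : QComp d s fun (x : Fin n → Bool) (_ : Unit) => f x) :
    ∃ (a : ℕ) (C : QACCircuit (Register n a)),
      C.depth ≤ d ∧ C.size ≤ (d + 1) * (n + s + 1) ∧ Decides C f 0 := by
  obtain ⟨A, _, _, C, hW, hl, hA, hC⟩ := h
  let e : Fin n ⊕ Unit ⊕ A ↪ Register n (Fintype.card A) :=
    ((Equiv.refl _).sumCongr ((Equiv.sumComm _ _).trans
      ((Fintype.equivFin A).sumCongr (Equiv.refl _)))).toEmbedding
  have hcard : Fintype.card (Register n (Fintype.card A)) ≤ n + s + 1 := by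
    simp only [Fintype.card_sum, Fintype.card_fin, Fintype.card_unit]
    omega
  have hWe := hW.embed e
  refine ⟨_, ⟨C.embed e, hWe⟩, ?_, ?_, ?_⟩
  · simpa [QACCircuit.depth] using hl
  · have hsum : ((C.embed e).map List.length).sum ≤ d * (n + s + 1) := by
      refine (List.sum_le_card_nsmul _ (n + s + 1) ?_).trans ?_
      · intro k hk
        obtain ⟨L, hL, rfl⟩ := List.mem_map.1 hk
        exact (length_le_of_pairwise_disjoint (hWe L hL)).trans hcard
      · simp only [List.length_map, smul_eq_mul, Layers.length_embed]
        exact Nat.mul_le_mul_right _ hl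
    rw [QACCircuit.size, add_mul, one_mul]
    exact add_le_add hsum hcard
  · intro x
    have hrun : run (C.embed e) (basis (Register.init (Fintype.card A) x))
        = basis (Sum.elim x (Sum.elim (fun _ => false) fun _ => f x)) := by
      refine run_embed_basis (hC x (Set.mem_univ _)) ?_ ?_ ?_
      · rintro (i | i | i) <;> rfl
      · rintro (i | i | i) <;> rfl
      · intro q hq
        obtain ⟨r, hr⟩ := ((Equiv.refl _).sumCongr ((Equiv.sumComm _ _).trans
          ((Fintype.equivFin A).sumCongr (Equiv.refl _)))).surjective q
        exact absurd hr (hq r)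
    have hent : ∀ y, (⟨C.embed e, hWe⟩ : QACCircuit (Register n (Fintype.card A))).toMatrix y
        (Register.init _ x) = basis (Sum.elim x (Sum.elim (fun _ => false) fun _ => f x)) y := by
      intro y
      rw [← hrun]
      have := congrFun (QACCircuit.toMatrix_mulVec ⟨C.embed e, hWe⟩
        (basis (Register.init (Fintype.card A) x))) y
      rw [← this, Matrix.mulVec, dotProduct]
      simp [basis_apply]
    rw [sub_zero, outputProb]
    simp only [hent, basis_apply]
    refine le_of_eq ?_
    rw [Finset.sum_eq_single (Sum.elim x (Sum.elim (fun _ => false) fun _ => f x))]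
    · simp [Register.out]
    · intro y _ hy
      simp [hy]
    · simp

theorem eval_le_expSq_pow (p : Polynomial ℕ) :
    ∃ c, ∀ m, 2 ≤ m → ∀ n ≤ expSq m, p.eval n ≤ expSq m ^ c := by
  induction p using Polynomial.induction_on' with
  | add p q hp hq =>
    obtain ⟨c, hc⟩ := hp
    obtain ⟨c', hc'⟩ := hq
    refine ⟨c + c' + 1, fun m hm n hn => ?_⟩
    rw [Polynomial.eval_add]
    exact add_le_expSq_pow hm (hc m hm n hn) (hc' m hm n hn)
  | monomial k a =>
    refine ⟨a + k, fun m hm n hn => ?_⟩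
    rw [Polynomial.eval_monomial]
    exact mul_le_expSq_pow ((Nat.lt_two_pow_self (n := a)).le.trans
      (Nat.pow_le_pow_left (one_lt_expSq hm) a)) (Nat.pow_le_pow_left hn k)

theorem exists_poly_lt_two_pow (e : ℕ) :
    ∃ l₀, ∀ l ≥ l₀, 4 * (16 * ((4 * l) ^ e) ^ 2 + 2) < 2 ^ l := by
  have h := (tendsto_pow_const_div_const_pow_of_one_lt (e * 2) (r := 2) (by norm_num)).const_mul
    ((64 * 4 ^ (e * 2) : ℝ))
  have h' := (tendsto_pow_const_div_const_pow_of_one_lt 0 (r := 2) (by norm_num)).const_mul (8 : ℝ)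
  have h2 := h.add h'
  rw [mul_zero, mul_zero, add_zero] at h2
  obtain ⟨l₀, hl₀⟩ := Filter.eventually_atTop.1 (h2.eventually (gt_mem_nhds one_pos))
  refine ⟨l₀, fun l hl => ?_⟩
  have h3 := hl₀ l hl
  rw [← mul_div_assoc, ← mul_div_assoc, ← add_div, div_lt_one (by positivity)] at h3
  have h4 : (4 * (16 * ((4 * l) ^ e) ^ 2 + 2) : ℝ) < 2 ^ l := by
    refine lt_of_le_of_lt (le_of_eq ?_) h3
    rw [← pow_mul, mul_pow]
    ring
  exact_mod_cast h4

theorem ACCircuit.weightVal_succ_eq' {M n h d k l : ℕ} (hM : M = 2 * h + 1) (C : ACCircuit n)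
    (hC : C.depth ≤ d) (hf : IsSymmetric C.eval) (hk : M ≤ k) (hkn : k + M ≤ n) (hl : 0 < l)
    (hD : 16 * ((2 * l) ^ (d + 1)) ^ 2 ≤ 2 * h + 3)
    (hsize : 4 * ((M + 1) * ((C.size + 1) ^ d + 1)) < 2 ^ l) :
    weightVal C.eval k = weightVal C.eval (k + 1) := by
  obtain ⟨n', rfl⟩ := Nat.exists_eq_add_of_le (show M ≤ n by omega)
  exact C.weightVal_succ_eq hM hC hf hk (by omega) hl hD hsize

/-- Symmetric functions in `AC⁰` are constant on the inputs with neither few zeros nor few ones. -/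
theorem exists_const_of_mem_SymAC0 {f : BoolFamily} (hf : f ∈ SymAC0) : ∃ r, ∀ n, ∃ a, ∀ x,
    logRoot n ^ r ≤ hammingWeight x → hammingWeight x + logRoot n ^ r ≤ n → f n x = a := by
  obtain ⟨⟨d, p, hp⟩, hsym⟩ := hf
  obtain ⟨c, hc⟩ := eval_le_expSq_pow p
  obtain ⟨l₀, hl₀⟩ := exists_poly_lt_two_pow (d + 1)
  -- Ensures both l ≥ l₀ and (C.size + 1)^d + 1 ≤ 2^l for l = A m².
  set A := l₀ + ((c + 0 + 1) * d + 0 + 1) + 1 with hA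
  refine ⟨4 + (4 * A + 2) * ((d + 1) * 2) + 1, fun n => ?_⟩
  obtain ⟨C, hCd, hCs, hCf⟩ := hp n
  have hfC : C.eval = f n := funext hCf
  have hsC : IsSymmetric C.eval := by rw [hfC]; exact hsym n
  rw [← hfC]
  have hm := two_le_logRoot n
  have hN := le_expSq_logRoot n
  generalize logRoot n = m at hm hN ⊢
  set l := A * m ^ 2 with hl
  have hAl : A ≤ l := Nat.le_mul_of_pos_right A (by positivity)
  -- The lower bound is applied with 2l in place of l, so D = (4l)^(d+1) and 16D² = 2h.
  set h := 8 * ((4 * l) ^ (d + 1)) ^ 2 with hh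
  have hML : 2 * h + 1 + 1 ≤ m ^ (4 + (4 * A + 2) * ((d + 1) * 2) + 1) := by
    have h1 : (4 * l) ^ ((d + 1) * 2) ≤ m ^ ((4 * A + 2) * ((d + 1) * 2)) := by
      rw [pow_mul m]
      refine Nat.pow_le_pow_left ?_ _
      rw [hl, ← mul_assoc, pow_add]
      exact Nat.mul_le_mul_right _ ((Nat.lt_two_pow_self).le.trans (Nat.pow_le_pow_left hm _))
    have h2 : 16 ≤ m ^ 4 := Nat.pow_le_pow_left hm 4
    have h3 := Nat.mul_le_mul h2 h1
    have h4 : 2 ≤ m ^ (4 + (4 * A + 2) * ((d + 1) * 2)) :=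
      hm.trans (Nat.le_self_pow (by omega) m)
    rw [← pow_add] at h3
    have h5 := Nat.mul_le_mul_left (m ^ (4 + (4 * A + 2) * ((d + 1) * 2))) hm
    rw [← pow_succ] at h5
    rw [hh, ← pow_mul]
    omega
  -- One factor 2^l pays for the circuit size, the other for the polynomial in l.
  have hsize : 4 * ((2 * h + 1 + 1) * ((C.size + 1) ^ d + 1)) < 2 ^ (2 * l) := by
    have h1 : (C.size + 1) ^ d + 1 ≤ 2 ^ l := by
      have h2 := add_le_expSq_pow (b := 1) (s := 0) hm (hCs.trans (hc m hm n hN)) le_rfl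
      have h3 := Nat.pow_le_pow_left h2 d
      rw [← pow_mul] at h3
      refine (add_le_expSq_pow (b := 1) (s := 0) hm h3 le_rfl).trans ?_
      rw [← pow_mul, hl, mul_comm A]
      exact Nat.pow_le_pow_right (by norm_num) (Nat.mul_le_mul_left _ (by omega))
    have h2 := hl₀ l (by omega)
    calc 4 * ((2 * h + 1 + 1) * ((C.size + 1) ^ d + 1))
        ≤ 4 * ((2 * h + 1 + 1) * 2 ^ l) :=
          Nat.mul_le_mul_left _ (Nat.mul_le_mul_left _ h1)
      _ = 4 * (16 * ((4 * l) ^ (d + 1)) ^ 2 + 2) * 2 ^ l := by rw [hh]; ring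
      _ < 2 ^ l * 2 ^ l := Nat.mul_lt_mul_of_pos_right h2 (by positivity)
      _ = 2 ^ (2 * l) := by rw [two_mul, pow_add]
  set L := m ^ (4 + (4 * A + 2) * ((d + 1) * 2) + 1)
  -- Consecutive middle weights have equal values; walk up from L.
  have hconst : ∀ j ≥ L, j + L ≤ n → weightVal C.eval j = weightVal C.eval L := by
    intro j hj
    induction j, hj using Nat.le_induction with
    | base => exact fun _ => rfl
    | succ j hj ih =>
      intro hjn
      rw [← C.weightVal_succ_eq' rfl hCd hsC (by omega) (by omega) (by omega) _ hsize]
      · exact ih (by omega)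
      · rw [hh, show 2 * (2 * l) = 4 * l by ring]
        omega
  refine ⟨weightVal C.eval L, fun x hx hxn => ?_⟩
  rw [hsC.eq_weightVal, hconst _ hx hxn]

end Final

/-- Every symmetric Boolean function in `AC⁰` is exactly computable in `QAC⁰`. -/
theorem theorem1p6 : SymAC0 ⊆ EQAC0 := by
  intro f hf
  obtain ⟨r, hr⟩ := exists_const_of_mem_SymAC0 hf
  obtain ⟨d, c, h⟩ := QComp.exists_symmetric r
  refine ⟨d, Polynomial.C (d + 1) * (Polynomial.X + (16 * (Polynomial.X + 1) ^ 5) ^ c + 1),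
    fun n => ?_⟩
  obtain ⟨a, C, hd, hs, hC⟩ := (h n (f n) (hf.2 n) (hr n)).exists_circuit
  refine ⟨a, C, hd, hs.trans ?_, hC⟩
  simp only [Polynomial.eval_mul, Polynomial.eval_C, Polynomial.eval_add, Polynomial.eval_X,
    Polynomial.eval_pow, Polynomial.eval_one, Polynomial.eval_ofNat]
  gcongr
  exact expSq_logRoot_le n
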